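/- All graphs are finite and simple. For a graph $H$ let $|H|$ be its order, $\alpha_H$ its independence number and $\gamma_H=|H|-\alpha_H-1$. Let $\mathbb H$ be a nonempty (finite or infinite) family of graphs, each of minimum degree at least $1$ and none of them isomorphic to a star $K_{1,t}$, and put $\gamma_{\mathbb H}=\min_{H\in\mathbb H}\gamma_H$. A graph is $\mathbb H$-minor-free if no member of $\mathbb H$ is a minor of it, and $\mathbb H$-minor-saturated if it is $\mathbb H$-minor-free but adding any edge between two distinct non-adjacent vertices produces a graph that has some member of $\mathbb H$ as a minor. Let $SAT(n,\mathbb H_{minor})$ be the set of $n$-vertex $\mathbb H$-minor-saturated graphs, and let $SPEX(n,\mathbb H_{minor})$ be the set of $n$-vertex $\mathbb H$-minor-free graphs whose adjacency spectral radius is maximum among all $n$-vertex $\mathbb H$-minor-free graphs. For $s\ge 0$ let $\Gamma_s(H)$ be the set of $s$-vertex induced subgraphs of $H$, and let $\Gamma_s^*(H)$ be the set of those $K\in\Gamma_s(H)$ that are irreducible, i.e. such that no member of $\Gamma_s(H)$ is isomorphic to a proper subgraph of $K$. Put $$\Gamma(\mathbb H)=\bigcup_{H\in\mathbb H}\Gamma^*_{|H|-\gamma_{\mathbb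 H}}(H).$$ **Theorem.** There is an $N$, depending only on $\mathbb H$, such that the following holds for all $n\ge N$ and all $G^*\in SPEX(n,\mathbb H_{minor})$. Let $L$ be the set of dominating vertices of $G^*$, i.e. of the vertices adjacent to all other vertices. Then $|L|=\gamma_{\mathbb H}$ and $$G^*-L\in SAT\big(n-\gamma_{\mathbb H},\Gamma(\mathbb H)_{minor}\big).$$ In particular, if $\mathbb H=\{H\}$, then $G^*-L\in SAT\big(n-\gamma_H,\Gamma^*_{\alpha_H+1}(H)_{minor}\big)$. -/

import Mathlib

/-- A finite simple graph. -/
structure FinGraph where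
  V : Type
  [finite : Finite V]
  graph : SimpleGraph V

namespace FinGraph

attribute [instance] FinGraph.finite

/-- The order `|G|`. -/
noncomputable def order (G : FinGraph) : ℕ := Nat.card G.V

/-- The subgraph `G[S]` induced by a set `S` of vertices. -/
def induce (G : FinGraph) (S : Set G.V) : FinGraph where
  V := S
  graph := G.graph.induce S

/-- The graph `G - S` obtained by deleting a set `S` of vertices. -/
def delete (G : FinGraph) (S : Set G.V) : FinGraph := G.induce Sᶜ

/-- The graph `G + uv`. -/
def addEdge (G : FinGraph) (u v : G.V) : FinGraph where
  V := G.V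
  graph := G.graph ⊔ SimpleGraph.edge u v

/-- `H` is a minor of `G`: there is a model of `H` in `G`, that is, a family of pairwise disjoint
(nonempty) connected branch sets in `G`, one for each vertex of `H`, such that `G` has an edge
between the branch sets of any two adjacent vertices of `H`. -/
def IsMinor (H G : FinGraph) : Prop :=
  ∃ B : H.V → Set G.V,
    (∀ v, (G.graph.induce (B v)).Connected) ∧
    (∀ v w, v ≠ w → Disjoint (B v) (B w)) ∧
    (∀ v w, H.graph.Adj v w → ∃ x ∈ B v, ∃ y ∈ B w, G.graph.Adj x y)

/-- `G` contains no member of the family `F` as a minor. -/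
def MinorFree (F : Set FinGraph) (G : FinGraph) : Prop := ∀ H ∈ F, ¬ H.IsMinor G

/-- `G` is `F`-minor-saturated: it is `F`-minor-free, but the addition of any edge creates a
member of `F` as a minor. -/
def MinorSaturated (F : Set FinGraph) (G : FinGraph) : Prop :=
  G.MinorFree F ∧
    ∀ u v : G.V, u ≠ v → ¬ G.graph.Adj u v → ∃ H ∈ F, H.IsMinor (G.addEdge u v)

/-- `SAT(n, F_minor)`: the `n`-vertex `F`-minor-saturated graphs. -/
def SAT (n : ℕ) (F : Set FinGraph) : Set FinGraph :=
  {G | G.order = n ∧ G.MinorSaturated F}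

open Classical in
/-- The spectral radius of (the adjacency matrix of) `G`. The matrix is real symmetric, so all its
eigenvalues are real. -/
noncomputable def rho (G : FinGraph) : ENNReal :=
  letI := Fintype.ofFinite G.V
  spectralRadius ℝ (G.graph.adjMatrix ℝ)

/-- `SPEX(n, F_minor)`: the `n`-vertex `F`-minor-free graphs whose spectral radius is maximal among
all `n`-vertex `F`-minor-free graphs. -/
def SPEX (n : ℕ) (F : Set FinGraph) : Set FinGraph :=
  {G | G.order = n ∧ G.MinorFree F ∧
    ∀ G' : FinGraph, G'.order = n → G'.MinorFree F → G'.rho ≤ G.rho}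

/-- The set of dominating vertices: those adjacent to every other vertex. -/
def dominatingVertices (G : FinGraph) : Set G.V :=
  G.graph.universalVerts

/-- The independence number `α_H`. -/
noncomputable def alpha (H : FinGraph) : ℕ := H.graph.indepNum

/-- `γ_H = |H| - α_H - 1`. The natural subtraction is not truncated as soon as `H` has an edge. -/
noncomputable def gamma (H : FinGraph) : ℕ := H.order - H.alpha - 1

/-- `γ_F = min {γ_H : H ∈ F}` for a nonempty family `F`. -/
noncomputable def familyGamma (F : Set FinGraph) : ℕ := sInf (gamma '' F)

/-- `H` is isomorphic to a star `K_{1,t}`. -/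
def IsStar (H : FinGraph) : Prop :=
  ∃ t : ℕ, Nonempty (H.graph ≃g completeBipartiteGraph (Fin 1) (Fin t))

/-- `H` has at least one vertex and no isolated vertices, i.e. minimum degree at least one. -/
def MinDegreePos (H : FinGraph) : Prop :=
  Nonempty H.V ∧ ∀ v, ∃ w, H.graph.Adj v w

/-- `Γ_s(H)`: the `s`-vertex induced subgraphs of `H`. -/
def inducedSubgraphs (s : ℕ) (H : FinGraph) : Set FinGraph :=
  {K | ∃ S : Set H.V, S.ncard = s ∧ K = H.induce S}

/-- `K` is isomorphic to a proper subgraph of `G`. -/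
def IsoProperSubgraph (K G : FinGraph) : Prop :=
  ∃ G' : G.graph.Subgraph, G' ≠ ⊤ ∧ Nonempty (K.graph ≃g G'.coe)

/-- `Γ*_s(H)`: the irreducible members `K` of `Γ_s(H)`, i.e. those for which no member of `Γ_s(H)`
is isomorphic to a proper subgraph of `K`. -/
def irreducibleInduced (s : ℕ) (H : FinGraph) : Set FinGraph :=
  {K | K ∈ inducedSubgraphs s H ∧ ∀ K' ∈ inducedSubgraphs s H, ¬ K'.IsoProperSubgraph K}

/-- `Γ(F) = ⋃_{H ∈ F} Γ*_{|H| - γ_F}(H)`. -/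
def Gam (F : Set FinGraph) : Set FinGraph :=
  ⋃ H ∈ F, irreducibleInduced (H.order - familyGamma F) H

end FinGraph

/-!
Let `k = γ_F` and let `G` be an extremal graph of large order `n`, with spectral radius `ρ`. By
Mader's theorem all subgraphs of `G` have bounded average degree, and `G` contains no `K_{k+1,M}`
for a suitable constant `M`, whereas `ρ² ≥ k(n - k)` because the join of `K_k` with an edgeless
graph is `F`-minor-free. Counting walks of length two with a Perron vector `x` as weight, one finds
that exactly `k` entries of `x` are close to the maximum, those at a set `L` of vertices of degree
close to `n`, while all other entries are small.

Suppose that some vertex of `L` is not dominating. Make all vertices of `L` dominating, and pay for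
this by deleting all other edges at the vertices not adjacent to all of `L` and at a bounded number
of common neighbours `W` of `L` held in reserve. As `x` is small outside `L`, the quadratic form
increases. The new graph is a join of `L` with a graph whose nontrivial part lies in `G`, so a model
of a member of `F` of bounded order can be moved into `G` by means of `W`. Bounded order suffices:
graphs without large star minors consist of boundedly many vertices and paths, so they are
well-quasi-ordered by the minor relation, and outside `L` no large star minor arises. This
contradicts the extremality of `G`.

Hence the vertices of `L` dominate. A graph with `k` dominating vertices has a member of `F` as a
minor if and only if the rest of the graph has a member of `Γ(F)` as a minor, and adding an edge
increases `ρ` as the Perron vector is positive.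
-/

/-! ### Models of minors and joins -/

namespace GraphMinor

open Set SimpleGraph

section Connectivity

variable {U V W : Type*}

theorem connected_induce_iff_closed {G : SimpleGraph V} {S : Set V} :
    (G.induce S).Connected ↔ S.Nonempty ∧ ∀ T : Set V, (∃ x ∈ S, x ∈ T) →
      (∀ x ∈ S, x ∈ T → ∀ y ∈ S, G.Adj x y → y ∈ T) → S ⊆ T := by
  constructor
  · refine fun h => ⟨nonempty_coe_sort.mp h.nonempty, ?_⟩
    rintro T ⟨x, hxS, hxT⟩ hclosed y hy
    have mem_of_walk : ∀ (a b : S) (_ : (G.induce S).Walk a b), a.1 ∈ T → b.1 ∈ T := by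
      intro a b p
      induction p with
      | nil => exact id
      | @cons a b _ hab _ ih => exact fun ha => ih (hclosed a a.2 ha b b.2 hab)
    obtain ⟨p⟩ := h.preconnected ⟨x, hxS⟩ ⟨y, hy⟩
    exact mem_of_walk _ _ p hxT
  · rintro ⟨⟨x, hx⟩, h⟩
    have hreach : S ⊆ {y | ∃ hy : y ∈ S, (G.induce S).Reachable ⟨x, hx⟩ ⟨y, hy⟩} := by
      refine h _ ⟨x, hx, hx, Reachable.refl _⟩ ?_
      rintro a ha ⟨_, hr⟩ b hb hab
      exact ⟨hb, hr.trans (Adj.reachable (G := G.induce S) (u := ⟨a, ha⟩) (v := ⟨b, hb⟩) hab)⟩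
    exact connected_iff_exists_forall_reachable _ |>.mpr ⟨⟨x, hx⟩, fun y => (hreach y.2).2⟩

theorem connected_induce_singleton (G : SimpleGraph V) (v : V) : (G.induce {v}).Connected :=
  (connected_iff _).mpr ⟨Preconnected.of_subsingleton, inferInstance⟩

theorem connected_induce_mono {G G' : SimpleGraph V} (h : G ≤ G') {S : Set V}
    (hS : (G.induce S).Connected) : (G'.induce S).Connected :=
  hS.mono fun _ _ hab => h hab

theorem connected_induce_image_iff {G : SimpleGraph V} {G' : SimpleGraph W} (f : G ↪g G')
    {T : Set V} : (G'.induce (f '' T)).Connected ↔ (G.induce T).Connected := by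
  have hrange : f '' T = range (f.comp (Embedding.induce T)) := by
    ext x
    simp
  rw [hrange]
  exact (f.comp (Embedding.induce T)).isoInduceRange.connected_iff.symm

theorem connected_induce_biUnion {G : SimpleGraph V} {K : SimpleGraph U} {S : Set U}
    {B : U → Set V} (hS : (K.induce S).Connected) (hB : ∀ x ∈ S, (G.induce (B x)).Connected)
    (hadj : ∀ x ∈ S, ∀ y ∈ S, K.Adj x y → ∃ a ∈ B x, ∃ b ∈ B y, G.Adj a b) :
    (G.induce (⋃ x ∈ S, B x)).Connected := by
  rw [connected_induce_iff_closed] at hS ⊢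
  have hB' := fun x hx => connected_induce_iff_closed.mp (hB x hx)
  obtain ⟨⟨x, hx⟩, hclosed⟩ := hS
  obtain ⟨a, ha⟩ := (hB' x hx).1
  refine ⟨⟨a, mem_biUnion hx ha⟩, ?_⟩
  rintro T ⟨a, ha, haT⟩ hT
  have hfull : ∀ y ∈ S, ∀ b ∈ B y, b ∈ T → B y ⊆ T := fun y hy b hb hbT =>
    (hB' y hy).2 T ⟨b, hb, hbT⟩ fun c hc hcT d hd hcd =>
      hT c (mem_biUnion hy hc) hcT d (mem_biUnion hy hd) hcd
  obtain ⟨y, hy, hay⟩ := mem_iUnion₂.mp ha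
  refine iUnion₂_subset (hclosed {y | B y ⊆ T} ⟨y, hy, hfull y hy a hay haT⟩ ?_)
  intro u hu huT v hv huv
  obtain ⟨c, hc, d, hd, hcd⟩ := hadj u hu v hv huv
  exact hfull v hv d hd (hT c (mem_biUnion hu hc) (huT hc) d (mem_biUnion hv hd) hcd)

end Connectivity

section Models

variable {U V W : Type*}

/-- The branch sets `B` form a model of `H` in `G`: they are connected and pairwise disjoint, and
adjacent vertices of `H` have adjacent branch sets. -/
structure IsModel (H : SimpleGraph U) (G : SimpleGraph V) (B : U → Set V) : Prop where
  connected : ∀ v, (G.induce (B v)).Connected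
  disjoint : ∀ v w, v ≠ w → Disjoint (B v) (B w)
  adj : ∀ v w, H.Adj v w → ∃ x ∈ B v, ∃ y ∈ B w, G.Adj x y

/-- The minor relation between graphs on arbitrary vertex types. It extends `FinGraph.IsMinor`, see
`FinGraph.isMinor_iff`. -/
def MinorOf (H : SimpleGraph U) (G : SimpleGraph V) : Prop := ∃ B : U → Set V, IsModel H G B

theorem IsModel.nonempty {H : SimpleGraph U} {G : SimpleGraph V} {B : U → Set V}
    (hB : IsModel H G B) (v : U) : (B v).Nonempty :=
  nonempty_coe_sort.mp (hB.connected v).nonempty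

theorem IsModel.mono {H H' : SimpleGraph U} {G G' : SimpleGraph V} {B : U → Set V}
    (hB : IsModel H G B) (hH : H' ≤ H) (hG : G ≤ G') : IsModel H' G' B where
  connected v := connected_induce_mono hG (hB.connected v)
  disjoint := hB.disjoint
  adj v w hvw := by
    obtain ⟨x, hx, y, hy, hxy⟩ := hB.adj v w (hH hvw)
    exact ⟨x, hx, y, hy, hG hxy⟩

theorem IsModel.comp {T : Type*} {H : SimpleGraph U} {G : SimpleGraph V} {K : SimpleGraph T}
    {B : U → Set V} (hB : IsModel H G B) (f : K →g H) (hf : Function.Injective f) :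
    IsModel K G (B ∘ f) where
  connected v := hB.connected (f v)
  disjoint _ _ hvw := hB.disjoint _ _ (hf.ne hvw)
  adj _ _ hvw := hB.adj _ _ (f.map_adj hvw)

theorem IsModel.singleton {H : SimpleGraph U} {G : SimpleGraph V} {f : U → V}
    (hf : Function.Injective f) (h : ∀ v w, H.Adj v w → G.Adj (f v) (f w)) :
    IsModel H G fun v => {f v} where
  connected v := connected_induce_singleton G (f v)
  disjoint _ _ hvw := disjoint_singleton.mpr (hf.ne hvw)
  adj v w hvw := ⟨f v, rfl, f w, rfl, h v w hvw⟩

theorem IsModel.image {H : SimpleGraph U} {G : SimpleGraph V} {G' : SimpleGraph W}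
    {B : U → Set V} (hB : IsModel H G B) (f : G ↪g G') : IsModel H G' fun v => f '' B v where
  connected v := (connected_induce_image_iff f).mpr (hB.connected v)
  disjoint v w hvw := (disjoint_image_iff f.injective).mpr (hB.disjoint v w hvw)
  adj v w hvw := by
    obtain ⟨x, hx, y, hy, hxy⟩ := hB.adj v w hvw
    exact ⟨f x, mem_image_of_mem f hx, f y, mem_image_of_mem f hy, f.map_adj_iff.mpr hxy⟩

theorem MinorOf.of_injective {H : SimpleGraph U} {G : SimpleGraph V} (f : U → V)
    (hf : Function.Injective f) (h : ∀ v w, H.Adj v w → G.Adj (f v) (f w)) : MinorOf H G :=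
  ⟨_, IsModel.singleton hf h⟩

theorem MinorOf.refl (G : SimpleGraph V) : MinorOf G G :=
  MinorOf.of_injective id Function.injective_id fun _ _ h => h

theorem MinorOf.trans {K : SimpleGraph U} {H : SimpleGraph V} {G : SimpleGraph W}
    (hKH : MinorOf K H) (hHG : MinorOf H G) : MinorOf K G := by
  obtain ⟨B, hB⟩ := hKH
  obtain ⟨C, hC⟩ := hHG
  refine ⟨fun v => ⋃ x ∈ B v, C x, ?_, ?_, ?_⟩
  · exact fun v => connected_induce_biUnion (hB.connected v) (fun x _ => hC.connected x)
      fun x _ y _ hxy => hC.adj x y hxy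
  · intro v w hvw
    simp only [disjoint_iUnion_left, disjoint_iUnion_right]
    exact fun x hx y hy =>
      hC.disjoint _ _ fun h => Set.disjoint_left.mp (hB.disjoint v w hvw) (h ▸ hy) hx
  · intro v w hvw
    obtain ⟨x, hx, y, hy, hxy⟩ := hB.adj v w hvw
    obtain ⟨a, ha, b, hb, hab⟩ := hC.adj x y hxy
    exact ⟨a, mem_biUnion hx ha, b, mem_biUnion hy hb, hab⟩

theorem minorOf_induce_iff {H : SimpleGraph U} {G : SimpleGraph V} {S : Set V} :
    MinorOf H (G.induce S) ↔ ∃ B : U → Set V, IsModel H G B ∧ ∀ v, B v ⊆ S := by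
  constructor
  · rintro ⟨B, hB⟩
    exact ⟨_, hB.image (Embedding.induce S), fun v => by rintro _ ⟨x, -, rfl⟩; exact x.2⟩
  · rintro ⟨B, hB, hS⟩
    refine ⟨fun v => Subtype.val ⁻¹' B v, fun v => ?_,
      fun v w hvw => (hB.disjoint v w hvw).preimage _, fun v w hvw => ?_⟩
    · have himage : Embedding.induce (G := G) S '' (Subtype.val ⁻¹' B v) = B v :=
        Subtype.image_preimage_val S (B v) |>.trans (inter_eq_right.mpr (hS v))
      rw [← connected_induce_image_iff (Embedding.induce S), himage]
      exact hB.connected v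
    · obtain ⟨x, hx, y, hy, hxy⟩ := hB.adj v w hvw
      exact ⟨⟨x, hS v hx⟩, hx, ⟨y, hS w hy⟩, hy, hxy⟩

theorem MinorOf.of_induce_compl {H : SimpleGraph U} {G : SimpleGraph V} {S : Set U}
    {B : S → Set V} {C : (Sᶜ : Set U) → Set V} (hB : IsModel (H.induce S) G B)
    (hC : IsModel (H.induce Sᶜ) G C) (hdisj : ∀ v w, Disjoint (B v) (C w))
    (hadj : ∀ v w, ∃ x ∈ B v, ∃ y ∈ C w, G.Adj x y) : MinorOf H G := by
  classical
  let D : U → Set V := fun v => if h : v ∈ S then B ⟨v, h⟩ else C ⟨v, h⟩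
  have hDB : ∀ v (h : v ∈ S), D v = B ⟨v, h⟩ := fun v h => dif_pos h
  have hDC : ∀ v (h : v ∉ S), D v = C ⟨v, h⟩ := fun v h => dif_neg h
  refine ⟨D, fun v => ?_, fun v w hvw => ?_, fun v w hvw => ?_⟩
  · by_cases hv : v ∈ S
    · exact hDB v hv ▸ hB.connected _
    · exact hDC v hv ▸ hC.connected _
  · by_cases hv : v ∈ S <;> by_cases hw : w ∈ S
    · exact hDB v hv ▸ hDB w hw ▸ hB.disjoint _ _ fun h => hvw (congrArg Subtype.val h)
    · exact hDB v hv ▸ hDC w hw ▸ hdisj _ _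
    · exact hDC v hv ▸ hDB w hw ▸ (hdisj _ _).symm
    · exact hDC v hv ▸ hDC w hw ▸ hC.disjoint _ _ fun h => hvw (congrArg Subtype.val h)
  · by_cases hv : v ∈ S <;> by_cases hw : w ∈ S
    · exact hDB v hv ▸ hDB w hw ▸ hB.adj _ _ hvw
    · exact hDB v hv ▸ hDC w hw ▸ hadj _ _
    · obtain ⟨x, hx, y, hy, hxy⟩ := hadj ⟨w, hw⟩ ⟨v, hv⟩
      exact hDC v hv ▸ hDB w hw ▸ ⟨y, hy, x, hx, hxy.symm⟩
    · exact hDC v hv ▸ hDC w hw ▸ hC.adj _ _ hvw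

end Models

section Join

variable {U V : Type*}

/-- The graph obtained from `R` by making every vertex of `L` adjacent to all other vertices, that
is, the join of the complete graph on `L` with `R - L`. -/
def joinGraph (L : Set V) (R : SimpleGraph V) : SimpleGraph V where
  Adj u v := u ≠ v ∧ (u ∈ L ∨ v ∈ L ∨ R.Adj u v)
  symm := ⟨fun u v h => ⟨h.1.symm, by
    rcases h.2 with h | h | h
    exacts [Or.inr (Or.inl h), Or.inl h, Or.inr (Or.inr h.symm)]⟩⟩
  loopless := ⟨fun v h => h.1 rfl⟩

theorem le_joinGraph (L : Set V) (R : SimpleGraph V) : R ≤ joinGraph L R :=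
  fun _ _ h => ⟨h.ne, Or.inr (Or.inr h)⟩

theorem induce_compl_joinGraph (L : Set V) (R : SimpleGraph V) :
    (joinGraph L R).induce Lᶜ = R.induce Lᶜ := by
  ext u v
  refine ⟨fun h => ?_, fun h => le_joinGraph L R h⟩
  exact (h.2.resolve_left u.2).resolve_left v.2

theorem IsModel.ncard_setOf_inter_nonempty_le [Finite V] {H : SimpleGraph U}
    {G : SimpleGraph V} {B : U → Set V} (hB : IsModel H G B) (L : Set V) :
    {v | (B v ∩ L).Nonempty}.ncard ≤ L.ncard := by
  classical
  have hpick : ∀ v, ∃ l, (B v ∩ L).Nonempty → l ∈ B v ∩ L := fun v => by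
    obtain ⟨x, -⟩ := hB.nonempty v
    by_cases hv : (B v ∩ L).Nonempty
    · exact ⟨hv.some, fun _ => hv.some_mem⟩
    · exact ⟨x, fun h => absurd h hv⟩
  choose f hf using hpick
  refine ncard_le_ncard_of_injOn f (fun v hv => (hf v hv).2) ?_ (toFinite _)
  intro v hv w hw hvw
  by_contra hne
  exact Set.disjoint_left.mp (hB.disjoint v w hne) (hf v hv).1 (hvw ▸ (hf w hw).1)

/-- At most `|L|` branch sets meet `L`; conversely a vertex of `L` can serve as the branch set of
any vertex of `H`. -/
theorem minorOf_joinGraph_iff [Finite U] [Finite V] {H : SimpleGraph U} {L : Set V}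
    {R : SimpleGraph V} (hcard : L.ncard ≤ Nat.card U) :
    MinorOf H (joinGraph L R) ↔
      ∃ S : Set U, S.ncard + L.ncard = Nat.card U ∧ MinorOf (H.induce S) (R.induce Lᶜ) := by
  constructor
  · rintro ⟨B, hB⟩
    have hmeet := hB.ncard_setOf_inter_nonempty_le L
    have hcompl := ncard_add_ncard_compl {v | (B v ∩ L).Nonempty}
    obtain ⟨S, hS, hScard⟩ := exists_subset_card_eq (s := {v | (B v ∩ L).Nonempty}ᶜ)
      (n := Nat.card U - L.ncard) (by omega)
    refine ⟨S, by omega, ?_⟩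
    rw [← induce_compl_joinGraph, minorOf_induce_iff]
    exact ⟨_, hB.comp (Embedding.induce S).toHom Subtype.val_injective,
      fun v x hx hxL => hS v.2 ⟨x, hx, hxL⟩⟩
  · rintro ⟨S, hS, hM⟩
    obtain ⟨B, hB, hBL⟩ := minorOf_induce_iff.mp hM
    have hcompl := ncard_add_ncard_compl S
    obtain ⟨e⟩ : Nonempty ((Sᶜ : Set U) ≃ L) := Finite.card_eq.mp (by
      rw [Nat.card_coe_set_eq, Nat.card_coe_set_eq]; omega)
    have heL : ∀ v w, (e w).1 ∉ B v := fun v w h => hBL v h (e w).2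
    have he : Function.Injective fun v => (e v).1 := Subtype.val_injective.comp e.injective
    refine MinorOf.of_induce_compl (hB.mono le_rfl (le_joinGraph L R))
      (IsModel.singleton he fun v w hvw => ⟨he.ne hvw.ne, Or.inl (e v).2⟩)
      (fun v w => disjoint_singleton_right.mpr (heL v w)) fun v w => ?_
    obtain ⟨x, hx⟩ := hB.nonempty v
    exact ⟨x, hx, _, rfl, fun h => heL v w (h ▸ hx), Or.inr (Or.inl (e w).2)⟩

end Join

end GraphMinor

/-! ### Star minors -/

namespace GraphMinor

open Finset SimpleGraph

section Stars

variable {V : Type*}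

/-- `G` has the star `K_{1,t}` as a minor, in the form: some connected set of vertices has at least
`t` neighbours outside it. -/
def HasStarMinor (G : SimpleGraph V) (t : ℕ) : Prop :=
  ∃ (S : Set V) (Λ : Finset V), (G.induce S).Connected ∧ t ≤ #Λ ∧
    ∀ u ∈ Λ, u ∉ S ∧ ∃ s ∈ S, G.Adj s u

theorem HasStarMinor.mono {G : SimpleGraph V} {s t : ℕ} (h : HasStarMinor G t) (hst : s ≤ t) :
    HasStarMinor G s := by
  obtain ⟨S, Λ, hS, hcard, hΛ⟩ := h
  exact ⟨S, Λ, hS, hst.trans hcard, hΛ⟩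

theorem HasStarMinor.of_le {G G' : SimpleGraph V} {t : ℕ} (h : HasStarMinor G t) (hG : G ≤ G') :
    HasStarMinor G' t := by
  obtain ⟨S, Λ, hS, hcard, hΛ⟩ := h
  refine ⟨S, Λ, connected_induce_mono hG hS, hcard, fun u hu => ?_⟩
  obtain ⟨huS, s, hs, hsu⟩ := hΛ u hu
  exact ⟨huS, s, hs, hG hsu⟩

theorem HasStarMinor.of_embedding {W : Type*} {G : SimpleGraph V} {G' : SimpleGraph W} {t : ℕ}
    (h : HasStarMinor G t) (f : G ↪g G') : HasStarMinor G' t := by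
  obtain ⟨S, Λ, hS, hcard, hΛ⟩ := h
  refine ⟨f '' S, Λ.map f.toEmbedding, (connected_induce_image_iff f).mpr hS,
    by rwa [card_map], ?_⟩
  intro _ hmem
  obtain ⟨u, hu, rfl⟩ := mem_map.mp hmem
  obtain ⟨huS, s, hs, hsu⟩ := hΛ u hu
  exact ⟨fun h => huS (f.injective.mem_set_image.mp h), f s, ⟨s, hs, rfl⟩, f.map_adj_iff.mpr hsu⟩

theorem hasStarMinor_degree [Fintype V] (G : SimpleGraph V) [DecidableRel G.Adj] (v : V) :
    HasStarMinor G (G.degree v) := by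
  refine ⟨{v}, G.neighborFinset v, connected_induce_singleton G v, le_rfl, fun u hu => ?_⟩
  rw [mem_neighborFinset] at hu
  exact ⟨hu.ne', v, rfl, hu⟩

end Stars

section Leaves

variable {V : Type*} [Fintype V] {T : SimpleGraph V} [DecidableRel T.Adj]

theorem card_add_two_le_card_leaves (hT : T.IsTree) {X : Finset V} (hne : X.Nonempty)
    (hX : ∀ w ∈ X, 3 ≤ T.degree w) : #X + 2 ≤ #{v | T.degree v = 1} := by
  classical
  obtain ⟨w, hw⟩ := hne
  have hnontrivial : Nontrivial V := by
    obtain ⟨u, hu⟩ := card_pos.mp (lt_of_lt_of_le (by norm_num) (hX w hw))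
    exact ⟨w, u, ((mem_neighborFinset _ _ _).mp hu).ne⟩
  have hsum : ∑ v, (T.degree v : ℤ) = 2 * Fintype.card V - 2 := by
    have hedges := hT.card_edgeFinset
    have hdegrees : ∑ v, (T.degree v : ℤ) = 2 * (#T.edgeFinset : ℤ) := by
      exact_mod_cast T.sum_degrees_eq_twice_card_edges
    omega
  have hbound : ∀ v, (if v ∈ X then (1 : ℤ) else 0) -
      (if v ∈ ({v | T.degree v = 1} : Finset V) then 1 else 0) ≤ (T.degree v : ℤ) - 2 := by
    intro v
    have hpos := hT.1.preconnected.degree_pos_of_nontrivial v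
    simp only [mem_filter_univ]
    by_cases hv : v ∈ X
    · have := hX v hv
      split_ifs <;> omega
    · split_ifs <;> omega
  have hcount := sum_le_sum fun v (_ : v ∈ univ) => hbound v
  simp only [sum_sub_distrib, sum_ite_mem, univ_inter, sum_const, hsum, card_univ, nsmul_eq_mul,
    mul_one] at hcount
  omega

theorem mem_of_preconnected {V : Type*} {G : SimpleGraph V} (hG : G.Preconnected) {S : Set V}
    {x y : V} (hx : x ∈ S) (hS : ∀ a ∈ S, ∀ b, G.Adj a b → b ∈ S) : y ∈ S := by
  obtain ⟨p⟩ := hG x y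
  induction p with
  | nil => exact hx
  | cons hadj _ ih => exact ih (hS _ hx _ hadj)

theorem degree_ne_one_of_adj_of_degree_eq_one (hT : T.Preconnected) {w : V}
    (hw : T.degree w ≠ 1) {u s : V} (hu : T.degree u = 1) (hus : T.Adj u s) : T.degree s ≠ 1 := by
  intro hs
  obtain ⟨s', -, hs'⟩ := (T.degree_eq_one_iff_existsUnique_adj).mp hu
  obtain ⟨u', -, hu'⟩ := (T.degree_eq_one_iff_existsUnique_adj).mp hs
  have hmem : w ∈ ({u, s} : Set V) := by
    refine mem_of_preconnected hT (x := u) (by simp) ?_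
    rintro a (rfl | rfl) b hab
    · exact Or.inr ((hs' b hab).trans (hs' s hus).symm)
    · exact Or.inl ((hu' b hab).trans (hu' u hus.symm).symm)
  rcases hmem with rfl | rfl
  exacts [hw hu, hw hs]

theorem hasStarMinor_card_leaves (hT : T.Preconnected) {w : V} (hw : T.degree w ≠ 1) :
    HasStarMinor T #{v | T.degree v = 1} := by
  refine ⟨{v | T.degree v ≠ 1}, _, ?_, le_rfl, fun u hu => ?_⟩
  · refine (connected_iff _).mpr ⟨hT.induce_of_degree_eq_one fun v hv => ?_, ⟨⟨w, hw⟩⟩⟩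
    obtain ⟨s, -, hs⟩ := (T.degree_eq_one_iff_existsUnique_adj).mp (not_not.mp hv)
    exact fun c hc d hd => (hs c hc).trans (hs d hd).symm
  · have hu : T.degree u = 1 := by simpa using hu
    obtain ⟨s, hus, -⟩ := (T.degree_eq_one_iff_existsUnique_adj).mp hu
    exact ⟨not_not.mpr hu, s, degree_ne_one_of_adj_of_degree_eq_one hT hw hu hus, hus.symm⟩

end Leaves

section Branching

variable {V : Type*}

theorem isAcyclic_of_forall_adj_subsingleton {G : SimpleGraph V}
    (h : ∀ a b, G.Adj a b → (G.neighborSet a).Subsingleton ∨ (G.neighborSet b).Subsingleton) :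
    G.IsAcyclic := by
  classical
  have hcycle : ∀ (v : V) (p : G.Walk v v), p.IsCycle → ¬ (G.neighborSet v).Subsingleton :=
    fun v p hp hs =>
      hp.snd_ne_penultimate (hs (p.adj_snd hp.not_nil) (p.adj_penultimate hp.not_nil).symm)
  intro v p hp
  rcases h _ _ (p.adj_snd hp.not_nil) with hs | hs
  · exact hcycle v p hp hs
  · exact hcycle _ _ (hp.rotate (p.getVert_mem_support 1)) hs

/-- The subgraph of `G` formed by the edges with an end in `X`. -/
def edgesAt (G : SimpleGraph V) (X : Set V) : SimpleGraph V where
  Adj a b := G.Adj a b ∧ (a ∈ X ∨ b ∈ X)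
  symm := ⟨fun _ _ h => ⟨h.1.symm, h.2.symm⟩⟩
  loopless := ⟨fun _ h => h.1.ne rfl⟩

variable [Fintype V] [DecidableEq V] (G : SimpleGraph V) [DecidableRel G.Adj]

/-- The closed neighbourhood of a vertex. -/
def closedNbhd (v : V) : Finset V := insert v (G.neighborFinset v)

variable {G}

theorem mem_closedNbhd {v w : V} : w ∈ closedNbhd G v ↔ w = v ∨ G.Adj v w := by
  simp only [closedNbhd, mem_insert, mem_neighborFinset]

theorem card_closedNbhd_le {t : ℕ} (ht : ¬ HasStarMinor G t) (v : V) : #(closedNbhd G v) ≤ t :=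
  (card_insert_le _ _).trans (not_le.mp fun h => ht ((hasStarMinor_degree G v).mono h))

theorem isAcyclic_edgesAt {X : Finset V}
    (hX : (X : Set V).PairwiseDisjoint (closedNbhd G)) : (edgesAt G X).IsAcyclic := by
  have heq : ∀ {a c u : V}, a ∈ X → c ∈ X → u ∈ closedNbhd G a → u ∈ closedNbhd G c → c = a :=
    fun ha hc hua huc => by
      by_contra hne
      exact disjoint_left.mp (hX hc ha hne) huc hua
  have hleaf : ∀ a b, a ∈ X → G.Adj a b → ((edgesAt G X).neighborSet b).Subsingleton := by
    intro a b ha hab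
    have hb : b ∉ X := fun hb => hab.ne'
      (heq ha hb (mem_closedNbhd.mpr (Or.inr hab)) (mem_closedNbhd.mpr (Or.inl rfl)))
    have hcenter : ∀ c, (edgesAt G X).Adj b c → c = a := fun c hbc =>
      heq ha (hbc.2.resolve_left hb) (mem_closedNbhd.mpr (Or.inr hab))
        (mem_closedNbhd.mpr (Or.inr hbc.1.symm))
    exact fun c hc d hd => (hcenter c hc).trans (hcenter d hd).symm
  refine isAcyclic_of_forall_adj_subsingleton ?_
  rintro a b ⟨hab, ha | hb⟩
  exacts [Or.inr (hleaf a b ha hab), Or.inl (hleaf b a hb hab.symm)]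

/-- A spanning tree that contains the disjoint stars around the vertices of `X` has more than `|X|`
leaves, and its other vertices induce a connected graph. -/
theorem hasStarMinor_of_pairwiseDisjoint_closedNbhd (hG : G.Connected) {X : Finset V}
    (hdeg : ∀ w ∈ X, 3 ≤ G.degree w) (hX : (X : Set V).PairwiseDisjoint (closedNbhd G)) :
    HasStarMinor G #X := by
  classical
  rcases X.eq_empty_or_nonempty with rfl | ⟨w, hw⟩
  · obtain ⟨v⟩ := hG.nonempty
    exact (hasStarMinor_degree G v).mono (Nat.zero_le _)
  have hstars : edgesAt G X ≤ G := fun _ _ h => h.1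
  obtain ⟨T, hKT, hTG, hT⟩ :=
    hG.exists_isTree_le_of_le_of_isAcyclic hstars (isAcyclic_edgesAt hX)
  have hdegT : ∀ w ∈ X, 3 ≤ T.degree w := fun w hw =>
    (hdeg w hw).trans <| card_le_card fun u hu =>
      (mem_neighborFinset _ _ _).mpr (hKT ⟨(mem_neighborFinset _ _ _).mp hu, Or.inl hw⟩)
  have hw1 : T.degree w ≠ 1 := by
    have := hdegT w hw
    omega
  have hleaves := card_add_two_le_card_leaves hT ⟨w, hw⟩ hdegT
  exact ((hasStarMinor_card_leaves hT.1.preconnected hw1).mono (by omega)).of_le hTG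

theorem exists_pairwiseDisjoint_closedNbhd_cover (Y : Finset V) :
    ∃ X ⊆ Y, (X : Set V).PairwiseDisjoint (closedNbhd G) ∧
      Y ⊆ X.biUnion fun w => (closedNbhd G w).biUnion (closedNbhd G) := by
  classical
  obtain ⟨X, hXmem, hmax⟩ := exists_max_image
    (Y.powerset.filter fun X : Finset V => (X : Set V).PairwiseDisjoint (closedNbhd G)) card
    ⟨∅, by simp⟩
  obtain ⟨hXY, hX⟩ := mem_filter.mp hXmem
  rw [mem_powerset] at hXY
  refine ⟨X, hXY, hX, fun v hv => ?_⟩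
  by_contra hcover
  simp only [mem_biUnion, not_exists, not_and] at hcover
  have hvX : v ∉ X := fun h =>
    hcover v h v (mem_closedNbhd.mpr (Or.inl rfl)) (mem_closedNbhd.mpr (Or.inl rfl))
  have hdisj : ∀ w ∈ X, Disjoint (closedNbhd G v) (closedNbhd G w) := fun w hw =>
    disjoint_left.mpr fun u huv huw => hcover w hw u huw <| mem_closedNbhd.mpr <|
      (mem_closedNbhd.mp huv).imp Eq.symm Adj.symm
  have hle := hmax (insert v X) <| mem_filter.mpr ⟨mem_powerset.mpr (insert_subset hv hXY), by
    rw [coe_insert]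
    exact hX.insert fun w hw _ => hdisj w hw⟩
  rw [card_insert_of_notMem hvX] at hle
  omega

end Branching

theorem card_filter_three_le_degree_le {V : Type*} [Fintype V] {G : SimpleGraph V}
    [DecidableRel G.Adj] (hG : G.Connected) {t : ℕ}
    (ht : ¬ HasStarMinor G t) : #{v | 3 ≤ G.degree v} ≤ t * (t * t) := by
  classical
  obtain ⟨X, hXY, hX, hcover⟩ := exists_pairwiseDisjoint_closedNbhd_cover (G := G)
    {v | 3 ≤ G.degree v}
  have hXt : #X ≤ t := by
    by_contra! hlt
    exact ht <| (hasStarMinor_of_pairwiseDisjoint_closedNbhd hG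
      (fun w hw => (mem_filter.mp (hXY hw)).2) hX).mono hlt.le
  calc #{v | 3 ≤ G.degree v}
      ≤ #(X.biUnion fun w => (closedNbhd G w).biUnion (closedNbhd G)) := card_le_card hcover
    _ ≤ #X * (t * t) := card_biUnion_le_card_mul _ _ _ fun w _ =>
        (card_biUnion_le_card_mul _ _ t fun u _ => card_closedNbhd_le ht u).trans
          (Nat.mul_le_mul_right _ (card_closedNbhd_le ht w))
    _ ≤ t * (t * t) := Nat.mul_le_mul_right _ hXt

end GraphMinor

/-! ### Path covers -/

namespace GraphMinor

open Set SimpleGraph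

section Paths

variable {V : Type*}

/-- `q 0, …, q l` is a path all of whose vertices lie in `U`. The values of `q` beyond `l` are
irrelevant. -/
structure IsPathIn (G : SimpleGraph V) (U : Set V) (q : ℕ → V) (l : ℕ) : Prop where
  mem : ∀ j ≤ l, q j ∈ U
  inj : ∀ i ≤ l, ∀ j ≤ l, q i = q j → i = j
  chain : ∀ j < l, G.Adj (q j) (q (j + 1))

variable {G : SimpleGraph V} {U X : Set V} {q : ℕ → V} {l : ℕ}

theorem IsPathIn.snoc (hq : IsPathIn G U q l) {w : V} (hw : w ∈ U) (hadj : G.Adj (q l) w)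
    (hnew : ∀ j ≤ l, q j ≠ w) : IsPathIn G U (Function.update q (l + 1) w) (l + 1) := by
  have hold : ∀ j ≤ l, Function.update q (l + 1) w j = q j := fun j hj =>
    Function.update_of_ne (by omega) _ _
  have hlast : Function.update q (l + 1) w (l + 1) = w := Function.update_self _ _ _
  refine ⟨fun j hj => ?_, fun i hi j hj hij => ?_, fun j hj => ?_⟩
  · rcases Nat.le_add_one_iff.mp hj with hj | rfl
    · exact hold j hj ▸ hq.mem j hj
    · exact hlast.symm ▸ hw
  · rcases Nat.le_add_one_iff.mp hi with hi | rfl <;>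
      rcases Nat.le_add_one_iff.mp hj with hj | rfl
    · exact hq.inj i hi j hj (hold i hi ▸ hold j hj ▸ hij)
    · rw [hold i hi, hlast] at hij
      exact absurd hij (hnew i hi)
    · rw [hold j hj, hlast] at hij
      exact absurd hij.symm (hnew j hj)
    · rfl
  · rcases Nat.lt_succ_iff_lt_or_eq.mp hj with hj | rfl
    · rw [hold j hj.le, hold (j + 1) hj]
      exact hq.chain j hj
    · rwa [hold j le_rfl, hlast]

theorem IsPathIn.length_lt [Finite V] (hq : IsPathIn G U q l) : l < Nat.card V := by
  have hcard : (q '' Iic l).ncard = l + 1 := by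
    have hinj : InjOn q (Iic l) := fun i hi j hj => hq.inj i hi j hj
    rw [hinj.ncard_image, ← Nat.card_coe_set_eq]
    simp
  have := ncard_le_card (q '' Iic l)
  omega

theorem exists_maximal_isPathIn [Finite V] (G : SimpleGraph V) {v : V} (hv : v ∈ U) :
    ∃ (l : ℕ) (q : ℕ → V), IsPathIn G U q l ∧ q 0 = v ∧
      ∀ w ∈ U, G.Adj (q l) w → ∃ j ≤ l, q j = w := by
  have hfin : {l | ∃ q, IsPathIn G U q l ∧ q 0 = v}.Finite :=
    (finite_lt_nat (Nat.card V)).subset fun l ⟨_, hq, _⟩ => hq.length_lt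
  obtain ⟨l, ⟨q, hq, hq0⟩, hmax⟩ := hfin.exists_maximal
    ⟨0, fun _ => v, ⟨fun _ _ => hv, fun i hi j hj _ => by omega, by simp⟩, rfl⟩
  refine ⟨l, q, hq, hq0, fun w hw hlw => ?_⟩
  by_contra! hnew
  have hle : l + 1 ≤ l := hmax
    ⟨_, hq.snoc hw hlw hnew, by rw [Function.update_of_ne (by omega), hq0]⟩ (Nat.le_succ l)
  omega

theorem IsPathIn.eq_of_adj_of_lt (hq : IsPathIn G U q l)
    (hdeg : ∀ u ∈ U, ∀ a b c, G.Adj u a → G.Adj u b → G.Adj u c → a = b ∨ a = c ∨ b = c)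
    {x : V} (hx : x ∉ U) (hxq : G.Adj x (q 0)) {j : ℕ} (hj : j < l) {w : V}
    (hw : G.Adj (q j) w) : w = q (j + 1) ∨ (∃ i, j = i + 1 ∧ w = q i) ∨ j = 0 ∧ w = x := by
  have hnext := hq.chain j hj
  rcases j with - | i
  · rcases hdeg _ (hq.mem 0 hj.le) _ _ _ hw hnext hxq.symm with h | h | h
    · exact Or.inl h
    · exact Or.inr (Or.inr ⟨rfl, h⟩)
    · exact absurd (h ▸ hq.mem _ hj) hx
  · have hprev := (hq.chain i (by omega)).symm
    rcases hdeg _ (hq.mem _ hj.le) _ _ _ hw hnext hprev with h | h | h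
    · exact Or.inl h
    · exact Or.inr (Or.inl ⟨i, rfl, h⟩)
    · have := hq.inj _ hj _ (by omega) h
      omega

theorem IsPathIn.consecutive_of_adj (hq : IsPathIn G U q l)
    (hdeg : ∀ u ∈ U, ∀ a b c, G.Adj u a → G.Adj u b → G.Adj u c → a = b ∨ a = c ∨ b = c)
    (hmax : ∀ w ∈ U, G.Adj (q l) w → ∃ j ≤ l, q j = w) {x : V} (hx : x ∉ U)
    (hxq : G.Adj x (q 0)) {j : ℕ} (hj : j ≤ l) {w : V} (hwU : w ∈ U) (hw : G.Adj (q j) w) :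
    ∃ i ≤ l, q i = w ∧ (i = j + 1 ∨ j = i + 1) := by
  have hinner : ∀ j < l, ∀ w ∈ U, G.Adj (q j) w →
      ∃ i ≤ l, q i = w ∧ (i = j + 1 ∨ j = i + 1) := by
    intro j hj w hwU hw
    rcases hq.eq_of_adj_of_lt hdeg hx hxq hj hw with rfl | ⟨i, rfl, rfl⟩ | ⟨-, rfl⟩
    · exact ⟨j + 1, hj, rfl, Or.inl rfl⟩
    · exact ⟨i, by omega, rfl, Or.inr rfl⟩
    · exact absurd hwU hx
  rcases hj.lt_or_eq with hlt | rfl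
  · exact hinner j hlt w hwU hw
  · obtain ⟨i, hi, rfl⟩ := hmax w hwU hw
    have hij : i ≠ j := fun h => hw.ne (h ▸ rfl)
    obtain ⟨k, hk, hkj, hik⟩ := hinner i (by omega) _ (hq.mem j le_rfl) hw.symm
    exact ⟨i, hi, rfl, hq.inj k hk j le_rfl hkj ▸ hik.symm⟩

end Paths

section PathCovers

variable {V ι κ : Type*}

/-- A partition of `U` into the paths `p a 0, …, p a (len a)`, which start next to `X`, are attached
to `X` only at their ends and have no further edges between each other. -/
structure IsPathCover (G : SimpleGraph V) (X U : Set V) (p : κ → ℕ → V) (len : κ → ℕ) :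
    Prop where
  mem : ∀ a, ∀ j ≤ len a, p a j ∈ U
  inj : ∀ a a', ∀ j ≤ len a, ∀ j' ≤ len a', p a j = p a' j' → a = a' ∧ j = j'
  cover : ∀ v ∈ U, ∃ a, ∃ j ≤ len a, p a j = v
  chain : ∀ a, ∀ j < len a, G.Adj (p a j) (p a (j + 1))
  head : ∀ a, ∃ x ∈ X, G.Adj x (p a 0)
  ends : ∀ x ∈ X, ∀ a, ∀ j ≤ len a, G.Adj x (p a j) → j = 0 ∨ j = len a
  consecutive : ∀ a a', ∀ j ≤ len a, ∀ j' ≤ len a', G.Adj (p a j) (p a' j') →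
    a = a' ∧ (j' = j + 1 ∨ j = j' + 1)

variable {G : SimpleGraph V} {X U : Set V}

theorem IsPathCover.append {m m' : ℕ} {U' : Set V} {p : Fin m → ℕ → V} {p' : Fin m' → ℕ → V}
    {len : Fin m → ℕ} {len' : Fin m' → ℕ} (hp : IsPathCover G X U p len)
    (hp' : IsPathCover G X U' p' len') (hdisj : Disjoint U U')
    (hadj : ∀ u ∈ U, ∀ v ∈ U', ¬ G.Adj u v) :
    IsPathCover G X (U ∪ U') (Fin.append p p') (Fin.append len len') := by
  have hne : ∀ a, ∀ j ≤ len a, ∀ a', ∀ j' ≤ len' a', p a j ≠ p' a' j' :=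
    fun a j hj a' j' hj' => hdisj.ne_of_mem (hp.mem a j hj) (hp'.mem a' j' hj')
  have hnadj : ∀ a, ∀ j ≤ len a, ∀ a', ∀ j' ≤ len' a', ¬ G.Adj (p a j) (p' a' j') :=
    fun a j hj a' j' hj' => hadj _ (hp.mem a j hj) _ (hp'.mem a' j' hj')
  constructor
  · refine Fin.addCases (fun a => ?_) fun a => ?_
    · simpa using fun j hj => Or.inl (hp.mem a j hj)
    · simpa using fun j hj => Or.inr (hp'.mem a j hj)
  · refine Fin.addCases (fun a => ?_) (fun a => ?_) <;>
      refine Fin.addCases (fun a' => ?_) fun a' => ?_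
    · simpa using hp.inj a a'
    · simpa using fun j hj j' hj' h => absurd h (hne a j hj a' j' hj')
    · simpa using fun j hj j' hj' h => absurd h.symm (hne a' j' hj' a j hj)
    · simpa using hp'.inj a a'
  · rintro v (hv | hv)
    · obtain ⟨a, j, hj, h⟩ := hp.cover v hv
      exact ⟨a.castAdd m', j, by simpa using hj, by simpa using h⟩
    · obtain ⟨a, j, hj, h⟩ := hp'.cover v hv
      exact ⟨a.natAdd m, j, by simpa using hj, by simpa using h⟩
  · exact Fin.addCases (fun a => by simpa using hp.chain a) fun a => by simpa using hp'.chain a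
  · exact Fin.addCases (fun a => by simpa using hp.head a) fun a => by simpa using hp'.head a
  · exact fun x hx => Fin.addCases (fun a => by simpa using hp.ends x hx a)
      fun a => by simpa using hp'.ends x hx a
  · refine Fin.addCases (fun a => ?_) (fun a => ?_) <;>
      refine Fin.addCases (fun a' => ?_) fun a' => ?_
    · simpa using hp.consecutive a a'
    · simpa using fun j hj j' hj' h => absurd h (hnadj a j hj a' j' hj')
    · simpa using fun j hj j' hj' h => absurd h.symm (hnadj a' j' hj' a j hj)
    · simpa using hp'.consecutive a a'

theorem exists_isPathCover_single [Finite V] (hUX : Disjoint U X)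
    (hdeg : ∀ u ∈ U, ∀ a b c, G.Adj u a → G.Adj u b → G.Adj u c → a = b ∨ a = c ∨ b = c)
    {x v : V} (hx : x ∈ X) (hv : v ∈ U) (hxv : G.Adj x v) :
    ∃ Q ⊆ U, v ∈ Q ∧ (∀ u ∈ Q, ∀ w ∈ U, G.Adj u w → w ∈ Q) ∧
      ∃ (p : Fin 1 → ℕ → V) (len : Fin 1 → ℕ), IsPathCover G X Q p len := by
  obtain ⟨l, q, hq, rfl, hmax⟩ := exists_maximal_isPathIn G hv
  have hxU : x ∉ U := fun h => disjoint_left.mp hUX h hx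
  refine ⟨q '' Iic l, image_subset_iff.mpr hq.mem, ⟨0, Nat.zero_le l, rfl⟩, ?_,
    fun _ => q, fun _ => l, fun _ j hj => ⟨j, hj, rfl⟩,
    fun a a' j hj j' hj' h => ⟨Subsingleton.elim a a', hq.inj j hj j' hj' h⟩,
    fun v ⟨j, hj, h⟩ => ⟨0, j, hj, h⟩, fun _ => hq.chain, fun _ => ⟨x, hx, hxv⟩, ?_, ?_⟩
  · rintro _ ⟨j, hj, rfl⟩ w hwU hw
    obtain ⟨i, hi, rfl, -⟩ := hq.consecutive_of_adj hdeg hmax hxU hxv hj hwU hw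
    exact ⟨i, hi, rfl⟩
  · intro y hy _ j hj hyj
    by_contra! hinner
    have hyU : y ∉ U := fun h => disjoint_left.mp hUX h hy
    rcases hq.eq_of_adj_of_lt hdeg hxU hxv (lt_of_le_of_ne hj hinner.2) hyj.symm with
      rfl | ⟨i, rfl, rfl⟩ | ⟨h, -⟩
    · exact hyU (hq.mem _ (lt_of_le_of_ne hj hinner.2))
    · exact hyU (hq.mem i (by omega))
    · exact hinner.1 h
  · intro a a' j hj j' hj' h
    obtain ⟨i, hi, hij', hij⟩ :=
      hq.consecutive_of_adj hdeg hmax hxU hxv hj (hq.mem j' hj') h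
    exact ⟨Subsingleton.elim a a', hq.inj i hi j' hj' hij' ▸ hij⟩

theorem exists_isPathCover [Finite V] (hG : G.Preconnected) (hX : X.Nonempty) (U : Set V)
    (hUX : Disjoint U X) (hcl : ∀ u ∈ U, ∀ v, G.Adj u v → v ∈ U ∨ v ∈ X)
    (hdeg : ∀ u ∈ U, ∀ a b c, G.Adj u a → G.Adj u b → G.Adj u c → a = b ∨ a = c ∨ b = c) :
    ∃ (m : ℕ) (p : Fin m → ℕ → V) (len : Fin m → ℕ), IsPathCover G X U p len := by
  induction U using WellFoundedLT.induction with
  | ind U ih =>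
    rcases U.eq_empty_or_nonempty with rfl | ⟨u₀, hu₀⟩
    · exact ⟨0, Fin.elim0, Fin.elim0, by constructor <;> first | exact fun a => a.elim0 | simp⟩
    obtain ⟨v, hv, x, hx, hxv⟩ : ∃ v ∈ U, ∃ x ∈ X, G.Adj x v := by
      by_contra! hcon
      obtain ⟨x, hx⟩ := hX
      have hxU : x ∈ U := mem_of_preconnected hG hu₀ fun a ha b hab =>
        (hcl a ha b hab).resolve_right fun hb => hcon a ha b hb hab.symm
      exact disjoint_left.mp hUX hxU hx
    obtain ⟨Q, hQU, hvQ, hQ, p, len, hp⟩ := exists_isPathCover_single hUX hdeg hx hv hxv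
    obtain ⟨m, p', len', hp'⟩ := ih (U \ Q) ⟨sdiff_subset, fun h => (h hv).2 hvQ⟩
      (hUX.mono_left sdiff_subset)
      (fun u hu w huw => (hcl u hu.1 w huw).imp_left fun hw =>
        ⟨hw, fun hwQ => hu.2 (hQ w hwQ u hu.1 huw.symm)⟩)
      fun u hu => hdeg u hu.1
    rw [← union_sdiff_cancel hQU]
    exact ⟨_, _, _, hp.append hp' disjoint_sdiff_right fun u hu w hw h => hw.2 (hQ u hu w hw.1 h)⟩

end PathCovers

section Contraction

variable {V W ι κ : Type*}

theorem connected_induce_image_Icc {G : SimpleGraph V} {q : ℕ → V} {i j : ℕ} (hij : i ≤ j)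
    (h : ∀ a, i ≤ a → a < j → G.Adj (q a) (q (a + 1))) :
    (G.induce (q '' Icc i j)).Connected := by
  induction j, hij using Nat.le_induction with
  | base =>
    rw [Icc_self, image_singleton]
    exact connected_induce_singleton G (q i)
  | succ j hij ih =>
    have hsucc : q '' Icc i j ∪ {q (j + 1)} = q '' Icc i (j + 1) := by
      rw [union_singleton, ← image_insert_eq, ← Order.succ_eq_add_one,
        insert_Icc_right_eq_Icc_succ (hij.trans (Order.le_succ j))]
    rw [← hsucc]
    exact connected_induce_union (ih fun a ha haj => h a ha (by omega)).preconnected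
      (connected_induce_singleton G (q (j + 1))).preconnected
      ⟨j, ⟨hij, le_rfl⟩, rfl⟩ rfl (h j hij (by omega))

/-- The branch set of the `j`-th vertex when the path `q 0, …, q l'` is contracted to a path with
vertices `0, …, l`, where `l ≤ l'`: the part beyond `q l` is contracted to the last vertex. -/
def pathBranch (q : ℕ → V) (l l' j : ℕ) : Set V := q '' {k | k ≤ l' ∧ min k l = j}

theorem connected_pathBranch {G : SimpleGraph V} {q : ℕ → V} {l l' j : ℕ} (hl : l ≤ l')
    (hq : ∀ k < l', G.Adj (q k) (q (k + 1))) (hj : j ≤ l) :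
    (G.induce (pathBranch q l l' j)).Connected := by
  rcases hj.lt_or_eq with hlt | rfl
  · have hIcc : {k | k ≤ l' ∧ min k l = j} = Icc j j := by
      ext k
      simp only [mem_ofPred_eq, mem_Icc]
      omega
    rw [pathBranch, hIcc]
    exact connected_induce_image_Icc le_rfl fun k _ hk => hq k (by omega)
  · have hIcc : {k | k ≤ l' ∧ min k j = j} = Icc j l' := by
      ext k
      simp only [mem_ofPred_eq, mem_Icc]
      omega
    rw [pathBranch, hIcc]
    exact connected_induce_image_Icc hl fun k _ hk => hq k hk

theorem IsPathCover.disjoint_pathBranch {G : SimpleGraph V} {L U : Set V} {p : κ → ℕ → V}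
    {l len : κ → ℕ} (hp : IsPathCover G L U p len) {x y : Σ a, Fin (l a + 1)} (hne : x ≠ y) :
    Disjoint (pathBranch (p x.1) (l x.1) (len x.1) x.2)
      (pathBranch (p y.1) (l y.1) (len y.1) y.2) := by
  obtain ⟨a, j⟩ := x
  obtain ⟨a', j'⟩ := y
  refine disjoint_left.mpr ?_
  rintro _ ⟨k, ⟨hk, hj⟩, rfl⟩ ⟨k', ⟨hk', hj'⟩, h⟩
  obtain ⟨rfl, rfl⟩ := hp.inj _ _ _ hk' _ hk h
  exact hne (congrArg (Sigma.mk _) (Fin.ext (hj.symm.trans hj')))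

theorem exists_adj_pathBranch_succ {G : SimpleGraph V} {q : ℕ → V} {l l' j : ℕ} (hl : l ≤ l')
    (hq : ∀ k < l', G.Adj (q k) (q (k + 1))) (hj : j < l) :
    ∃ x ∈ pathBranch q l l' j, ∃ y ∈ pathBranch q l l' (j + 1), G.Adj x y :=
  ⟨q j, ⟨j, ⟨by omega, by omega⟩, rfl⟩, q (j + 1), ⟨j + 1, ⟨by omega, by omega⟩, rfl⟩,
    hq j (by omega)⟩

theorem IsPathCover.bijective_sumElim {G : SimpleGraph V} {f : ι → V} {p : κ → ℕ → V}
    {len : κ → ℕ} (hf : Function.Injective f) (hp : IsPathCover G (range f) (range f)ᶜ p len) :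
    Function.Bijective (Sum.elim f fun x : Σ a, Fin (len a + 1) => p x.1 x.2) := by
  refine ⟨hf.sumElim ?_ ?_, fun v => ?_⟩
  · rintro ⟨a, j, hj⟩ ⟨a', j', hj'⟩ h
    obtain ⟨rfl, rfl⟩ := hp.inj a a' j (by omega) j' (by omega) h
    rfl
  · rintro i ⟨a, j⟩ h
    exact hp.mem a j (by omega) ⟨i, h⟩
  · by_cases hv : v ∈ range f
    · obtain ⟨i, rfl⟩ := hv
      exact ⟨Sum.inl i, rfl⟩
    · obtain ⟨a, j, hj, rfl⟩ := hp.cover v hv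
      exact ⟨Sum.inr ⟨a, j, by omega⟩, rfl⟩

theorem IsPathCover.minorOf {G : SimpleGraph V} {G' : SimpleGraph W} {f : ι → V}
    {f' : ι → W} {p : κ → ℕ → V} {p' : κ → ℕ → W} {len len' : κ → ℕ}
    (hf : Function.Injective f) (hf' : Function.Injective f')
    (hp : IsPathCover G (range f) (range f)ᶜ p len)
    (hp' : IsPathCover G' (range f') (range f')ᶜ p' len')
    (h₁ : ∀ i j, G.Adj (f i) (f j) → G'.Adj (f' i) (f' j))
    (h₂ : ∀ i a, G.Adj (f i) (p a 0) → G'.Adj (f' i) (p' a 0))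
    (h₃ : ∀ i a, G.Adj (f i) (p a (len a)) → G'.Adj (f' i) (p' a (len' a)))
    (hlen : len ≤ len') : MinorOf G G' := by
  let e := Equiv.ofBijective _ (hp.bijective_sumElim hf)
  have hG : MinorOf G (G.comap e) :=
    MinorOf.of_injective e.symm e.symm.injective fun v w h => by simpa using h
  let C : ι ⊕ (Σ a, Fin (len a + 1)) → Set W :=
    Sum.elim (fun i => {f' i}) fun x => pathBranch (p' x.1) (len x.1) (len' x.1) x.2
  have hdisj : ∀ i x, Disjoint (C (Sum.inl i)) (C (Sum.inr x)) := fun i x =>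
    disjoint_singleton_left.mpr fun ⟨k, hk, h⟩ => hp'.mem x.1 k hk.1 ⟨i, h.symm⟩
  have hattach : ∀ i a (j : Fin (len a + 1)), G.Adj (f i) (p a j) →
      ∃ x ∈ C (Sum.inl i), ∃ y ∈ C (Sum.inr ⟨a, j⟩), G'.Adj x y := by
    rintro i a ⟨j, hj⟩ hadj
    have hle : len a ≤ len' a := hlen a
    rcases hp.ends _ ⟨i, rfl⟩ a j (by omega) hadj with rfl | rfl
    · exact ⟨_, rfl, _, ⟨0, ⟨by omega, by simp⟩, rfl⟩, h₂ i a hadj⟩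
    · exact ⟨_, rfl, _, ⟨len' a, ⟨le_rfl, by simp [hle]⟩, rfl⟩, h₃ i a hadj⟩
  refine hG.trans ⟨C, ?_, ?_, ?_⟩
  · rintro (i | ⟨a, j⟩)
    · exact connected_induce_singleton _ _
    · exact connected_pathBranch (hlen a) (hp'.chain a) (Nat.le_of_lt_succ j.2)
  · rintro (i | x) (i' | x') hne
    · exact disjoint_singleton.mpr fun h => hne (congrArg Sum.inl (hf' h))
    · exact hdisj i x'
    · exact (hdisj i' x).symm
    · exact hp'.disjoint_pathBranch (l := len) fun h => hne (congrArg Sum.inr h)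
  · rintro (i | ⟨a, j, hj⟩) (i' | ⟨a', j', hj'⟩) hadj
    · exact ⟨_, rfl, _, rfl, h₁ _ _ hadj⟩
    · exact hattach i a' _ hadj
    · obtain ⟨x, hx, y, hy, hxy⟩ := hattach i' a _ hadj.symm
      exact ⟨y, hy, x, hx, hxy.symm⟩
    · obtain ⟨rfl, rfl | rfl⟩ := hp.consecutive a a' j (by omega) j' (by omega) hadj
      · exact exists_adj_pathBranch_succ (hlen a) (hp'.chain a) (Nat.lt_of_succ_lt_succ hj')
      · obtain ⟨x, hx, y, hy, hxy⟩ :=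
          exists_adj_pathBranch_succ (hlen a) (hp'.chain a) (Nat.lt_of_succ_lt_succ hj)
        exact ⟨y, hy, x, hx, hxy.symm⟩

end Contraction

section Assembly

variable {V W : Type*}

/-- A connected graph without large star minors consists of boundedly many vertices and paths: the
vertices of degree at least three together with their neighbours. -/
theorem exists_isPathCover_of_not_hasStarMinor [Finite V] {G : SimpleGraph V}
    (hG : G.Connected) {t : ℕ} (ht : ¬ HasStarMinor G t) :
    ∃ b ≤ t * (t * t) + 1, ∃ m ≤ (t * (t * t) + 1) * t, ∃ (f : Fin b → V) (p : Fin m → ℕ → V)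
      (len : Fin m → ℕ), Function.Injective f ∧ IsPathCover G (range f) (range f)ᶜ p len := by
  classical
  have := Fintype.ofFinite V
  obtain ⟨v₀⟩ := hG.nonempty
  set X : Finset V := insert v₀ (Finset.univ.filter fun v => 3 ≤ G.degree v)
  have hXcard : X.card ≤ t * (t * t) + 1 := (Finset.card_insert_le _ _).trans
    (Nat.succ_le_succ (card_filter_three_le_degree_le hG ht))
  have hdeg : ∀ u ∈ (X : Set V)ᶜ, ∀ a b c, G.Adj u a → G.Adj u b → G.Adj u c →
      a = b ∨ a = c ∨ b = c := by
    intro u hu a b c ha hb hc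
    by_contra! hne
    refine hu (Finset.mem_insert_of_mem (Finset.mem_filter.mpr ⟨Finset.mem_univ _, ?_⟩))
    exact Finset.two_lt_card_iff.mpr
      ⟨a, b, c, by simpa using ha, by simpa using hb, by simpa using hc, hne⟩
  obtain ⟨m, p, len, hp⟩ := exists_isPathCover hG.preconnected (X := (X : Set V))
    ⟨v₀, Finset.mem_insert_self _ _⟩ (X : Set V)ᶜ disjoint_compl_left
    (fun _ _ v _ => (em (v ∈ (X : Set V))).symm) hdeg
  let f : Fin X.card → V := fun i => X.equivFin.symm i
  have hf : Function.Injective f := Subtype.val_injective.comp X.equivFin.symm.injective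
  have hrange : range f = X := by
    rw [show f = Subtype.val ∘ X.equivFin.symm from rfl, X.equivFin.symm.surjective.range_comp]
    exact Subtype.range_coe
  refine ⟨X.card, hXcard, m, ?_, f, p, len, hf, hrange ▸ hp⟩
  have hheads : (Finset.univ : Finset (Fin m)).card ≤
      (X.biUnion fun x => G.neighborFinset x).card := by
    refine Finset.card_le_card_of_injOn (fun a => p a 0) (fun a _ => ?_) fun a _ a' _ h =>
      (hp.inj a a' 0 (Nat.zero_le _) 0 (Nat.zero_le _) h).1
    obtain ⟨x, hx, hxa⟩ := hp.head a
    exact Finset.mem_coe.mpr (Finset.mem_biUnion.mpr ⟨x, hx, (mem_neighborFinset _ _ _).mpr hxa⟩)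
  have hdegree : ∀ x ∈ X, (G.neighborFinset x).card ≤ t := fun x _ => by
    by_contra! hlt
    exact ht ((hasStarMinor_degree G x).mono hlt.le)
  rw [Finset.card_univ, Fintype.card_fin] at hheads
  exact hheads.trans ((Finset.card_biUnion_le_card_mul _ _ t hdegree).trans
    (Nat.mul_le_mul_right _ hXcard))

theorem MinorOf.of_components {G : SimpleGraph V} {G' : SimpleGraph W}
    (φ : G.ConnectedComponent → G'.ConnectedComponent) (hφ : Function.Injective φ)
    (h : ∀ c, MinorOf (G.induce c.supp) (G'.induce (φ c).supp)) : MinorOf G G' := by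
  choose B hB hBs using fun c => minorOf_induce_iff.mp (h c)
  let C : V → Set W := fun v => B (G.connectedComponentMk v) ⟨v, rfl⟩
  have hC : ∀ c v (hv : v ∈ c.supp), C v = B c ⟨v, hv⟩ := by
    rintro _ v rfl
    rfl
  refine ⟨C, fun v => (hB _).connected _, fun v w hvw => ?_, fun v w hvw => ?_⟩
  · by_cases hc : G.connectedComponentMk w = G.connectedComponentMk v
    · rw [hC _ v rfl, hC _ w hc]
      exact (hB _).disjoint _ _ fun h => hvw (congrArg Subtype.val h)
    · refine Set.disjoint_left.mpr fun x hxv hxw => hc (hφ ?_)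
      exact (mem_ofPred.mp (hBs _ _ hxw)).symm.trans (mem_ofPred.mp (hBs _ _ hxv))
  · rw [hC _ v rfl, hC _ w (ConnectedComponent.sound hvw.symm.reachable)]
    exact (hB _).adj _ _ hvw

end Assembly

end GraphMinor

/-! ### Well-quasi-ordering -/

namespace FinGraph

open Set SimpleGraph GraphMinor

theorem isMinor_iff {H G : FinGraph} : H.IsMinor G ↔ MinorOf H.graph G.graph :=
  ⟨fun ⟨B, h₁, h₂, h₃⟩ => ⟨B, h₁, h₂, h₃⟩, fun ⟨B, h⟩ => ⟨B, h.connected, h.disjoint, h.adj⟩⟩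

instance isPreorder_isMinor : IsPreorder FinGraph IsMinor where
  refl _ := isMinor_iff.mpr (MinorOf.refl _)
  trans _ _ _ h₁ h₂ := isMinor_iff.mpr ((isMinor_iff.mp h₁).trans (isMinor_iff.mp h₂))

theorem partiallyWellOrderedOn_isPathCover (b m : ℕ) :
    {G : FinGraph | ∃ (f : Fin b → G.V) (p : Fin m → ℕ → G.V) (len : Fin m → ℕ),
      Function.Injective f ∧ IsPathCover G.graph (range f) (range f)ᶜ p len}.PartiallyWellOrderedOn
      IsMinor := by
  rw [partiallyWellOrderedOn_iff_exists_lt]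
  intro g hg
  choose f p len hf hp using hg
  -- Up to the lengths of the paths, only finitely many graphs occur; Dickson's lemma does the rest.
  let shape : ℕ → (Fin b → Fin b → Prop) × (Fin b → Fin m → Prop) × (Fin b → Fin m → Prop) :=
    fun n => (fun i j => (g n).graph.Adj (f n i) (f n j),
      fun i a => (g n).graph.Adj (f n i) (p n a 0),
      fun i a => (g n).graph.Adj (f n i) (p n a (len n a)))
  obtain ⟨i, j, hij, hshape, hlen⟩ := ((Finite.wellQuasiOrdered (α := (Fin b → Fin b → Prop) ×
    (Fin b → Fin m → Prop) × (Fin b → Fin m → Prop)) (· = ·)).prod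
    (wellQuasiOrdered_le (α := Fin m → ℕ))) fun n => (shape n, len n)
  refine ⟨i, j, hij, isMinor_iff.mpr <| (hp i).minorOf (hf i) (hf j) (hp j)
    (fun a c => (congrFun₂ (congrArg Prod.fst hshape) a c).mp)
    (fun a c => (congrFun₂ (congrArg (fun q => q.2.1) hshape) a c).mp)
    (fun a c => (congrFun₂ (congrArg (fun q => q.2.2) hshape) a c).mp) hlen⟩

theorem partiallyWellOrderedOn_connected (t : ℕ) :
    {G : FinGraph | G.graph.Connected ∧ ¬ HasStarMinor G.graph t}.PartiallyWellOrderedOn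
      IsMinor := by
  have hcover := (Finset.range (t * (t * t) + 2) ×ˢ
    Finset.range ((t * (t * t) + 1) * t + 1)).partiallyWellOrderedOn_bUnion.mpr
      fun q _ => partiallyWellOrderedOn_isPathCover q.1 q.2
  refine hcover.mono ?_
  rintro G ⟨hG, hs⟩
  obtain ⟨b, hb, m, hm, hex⟩ := exists_isPathCover_of_not_hasStarMinor hG hs
  exact mem_biUnion (x := (b, m))
    (by simp only [Finset.coe_product, mem_prod, Finset.coe_range, mem_Iio]; omega) hex

theorem isMinor_of_sublistForall₂_components {G G' : FinGraph} [Fintype G.graph.ConnectedComponent]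
    [Fintype G'.graph.ConnectedComponent]
    (h : List.SublistForall₂ IsMinor
      (Finset.univ.toList.map fun c : G.graph.ConnectedComponent => G.induce c.supp)
      (Finset.univ.toList.map fun c : G'.graph.ConnectedComponent => G'.induce c.supp)) :
    G.IsMinor G' := by
  classical
  obtain ⟨_, hminor, hsub⟩ := List.sublistForall₂_iff.mp h
  obtain ⟨l, hl, rfl⟩ := List.sublist_map_iff.mp hsub
  rw [List.forall₂_map_left_iff, List.forall₂_map_right_iff, List.forall₂_iff_get] at hminor
  obtain ⟨hlen, hminor⟩ := hminor
  have hnodup : l.Nodup := hl.nodup (Finset.nodup_toList _)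
  have hmem (c : G.graph.ConnectedComponent) : c ∈ Finset.univ.toList :=
    Finset.mem_toList.mpr (Finset.mem_univ c)
  have hidx (c : G.graph.ConnectedComponent) :
      Finset.univ.toList.idxOf c < Finset.univ.toList.length :=
    List.idxOf_lt_length_iff.mpr (hmem c)
  refine isMinor_iff.mpr <| MinorOf.of_components
    (fun c => l.get ⟨Finset.univ.toList.idxOf c, hlen ▸ hidx c⟩) (fun c c' hcc => ?_) fun c => ?_
  · exact (List.idxOf_inj (hmem c)).mp (Fin.mk.inj (List.nodup_iff_injective_get.mp hnodup hcc))
  · have hc : Finset.univ.toList.get ⟨Finset.univ.toList.idxOf c, hidx c⟩ = c := by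
      simp only [List.get_eq_getElem, List.getElem_idxOf]
    have := isMinor_iff.mp (hminor _ (hidx c) (hlen ▸ hidx c))
    rwa [hc] at this

/-- Higman's lemma reduces the statement to connected graphs. -/
theorem partiallyWellOrderedOn_not_hasStarMinor (t : ℕ) :
    {G : FinGraph | ¬ HasStarMinor G.graph t}.PartiallyWellOrderedOn IsMinor := by
  have higman := PartiallyWellOrderedOn.partiallyWellOrderedOn_sublistForall₂ IsMinor
    (partiallyWellOrderedOn_connected t)
  rw [partiallyWellOrderedOn_iff_exists_lt] at higman ⊢
  intro g hg
  let _ : ∀ n, Fintype (g n).graph.ConnectedComponent := fun n =>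
    have := Finite.of_surjective (g n).graph.connectedComponentMk Quot.mk_surjective
    Fintype.ofFinite _
  obtain ⟨i, j, hij, h⟩ := higman (fun n => Finset.univ.toList.map
    fun c : (g n).graph.ConnectedComponent => (g n).induce c.supp) fun n x hx => by
      obtain ⟨c, -, rfl⟩ := List.mem_map.mp hx
      exact ⟨c.connected_toSimpleGraph, fun hs => hg n (hs.of_embedding (Embedding.induce _))⟩
  exact ⟨i, j, hij, isMinor_of_sublistForall₂_components h⟩

end FinGraph

/-! ### Minors of joins and `γ_H` -/

namespace FinGraph

open Set SimpleGraph GraphMinor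

section Gamma

variable {H : FinGraph} {F : Set FinGraph}

theorem ncard_le_alpha {S : Set H.V} (hS : ∀ v ∈ S, ∀ w ∈ S, ¬ H.graph.Adj v w) :
    S.ncard ≤ H.alpha := by
  classical
  rw [ncard_eq_toFinset_card S (toFinite S)]
  refine IsIndepSet.card_le_indepNum fun v hv w hw _ => ?_
  rw [Finite.coe_toFinset] at hv hw
  exact hS v hv w hw

theorem exists_indepSet_card_eq_alpha (H : FinGraph) :
    ∃ I : Finset H.V, I.card = H.alpha ∧ ∀ v ∈ I, ∀ w ∈ I, ¬ H.graph.Adj v w := by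
  classical
  obtain ⟨I, hind, hcard⟩ := exists_isNIndepSet_indepNum (G := H.graph)
  exact ⟨I, hcard, fun v hv w hw h => hind hv hw h.ne h⟩

theorem isStar_of_center {c : H.V} (hc : ∀ v, v ≠ c → H.graph.Adj c v)
    (hind : ∀ v, v ≠ c → ∀ w, w ≠ c → ¬ H.graph.Adj v w) : H.IsStar := by
  classical
  let e := (Finite.equivFin {v // v ≠ c}).symm
  let φ : Fin 1 ⊕ Fin _ ≃ H.V :=
    (Equiv.sumCongr (Equiv.ofUnique _ {v // v = c}) e).trans (Equiv.sumCompl (· = c))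
  have hinl : ∀ i, φ (Sum.inl i) = c := fun i => (Equiv.ofUnique _ {v // v = c} i).2
  have hinr : ∀ i, φ (Sum.inr i) ≠ c := fun i => (e i).2
  refine ⟨_, ⟨RelIso.symm ⟨φ, ?_⟩⟩⟩
  rintro (i | i) (j | j)
  · simp [hinl]
  · simpa [hinl] using hc _ (hinr j)
  · simpa [hinl] using (hc _ (hinr i)).symm
  · simpa using hind _ (hinr i) _ (hinr j)

theorem alpha_add_two_le_order (hd : H.MinDegreePos) (hs : ¬ H.IsStar) :
    H.alpha + 2 ≤ H.order := by
  classical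
  have := Fintype.ofFinite H.V
  obtain ⟨I, hα, hind⟩ := exists_indepSet_card_eq_alpha H
  obtain ⟨⟨v₀⟩, hdeg⟩ := hd
  by_contra! hlt
  have hcompl : I.card + Iᶜ.card = H.order := by
    rw [order, Nat.card_eq_fintype_card]
    exact Finset.card_add_card_compl I
  have hout : ∀ c ∉ I, ∀ d ∉ I, c = d := fun c hc d hd =>
    Finset.card_le_one.mp (by omega) c (Finset.mem_compl.mpr hc) d (Finset.mem_compl.mpr hd)
  obtain ⟨c, hc⟩ : ∃ c, c ∉ I := by
    obtain ⟨w, hw⟩ := hdeg v₀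
    by_contra! hall
    exact hind v₀ (hall _) w (hall _) hw
  have hmem : ∀ v, v ≠ c → v ∈ I := fun v hv => by_contra fun h => hv (hout v h c hc)
  refine hs (isStar_of_center (fun v hv => ?_)
    fun v hv w hw => hind v (hmem v hv) w (hmem w hw))
  obtain ⟨w, hw⟩ := hdeg v
  exact hout c hc w (fun h => hind v (hmem v hv) w h hw) ▸ hw.symm

theorem one_le_gamma (hd : H.MinDegreePos) (hs : ¬ H.IsStar) : 1 ≤ H.gamma := by
  have := alpha_add_two_le_order hd hs
  unfold gamma
  omega

theorem order_eq_gamma_add (hγ : 1 ≤ H.gamma) : H.order = H.gamma + H.alpha + 1 := by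
  unfold gamma at hγ ⊢
  omega

theorem familyGamma_le (hH : H ∈ F) : familyGamma F ≤ H.gamma :=
  Nat.sInf_le ⟨H, hH, rfl⟩

theorem familyGamma_le_order (hH : H ∈ F) : familyGamma F ≤ H.order := by
  have := familyGamma_le hH
  unfold gamma at this
  omega

theorem exists_gamma_eq_familyGamma (hF : F.Nonempty) : ∃ H ∈ F, H.gamma = familyGamma F :=
  Nat.sInf_mem (hF.image gamma)

end Gamma

section Joins

variable {V : Type} [Finite V] {H : FinGraph} {L : Set V} {R : SimpleGraph V}

theorem not_minorOf_joinGraph_bot (hγ : 1 ≤ H.gamma) (hL : L.ncard ≤ H.gamma) :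
    ¬ MinorOf H.graph (joinGraph L ⊥) := by
  intro h
  have horder : Nat.card H.V = H.gamma + H.alpha + 1 := order_eq_gamma_add hγ
  obtain ⟨S, hS, B, hB⟩ := (minorOf_joinGraph_iff (by omega)).mp h
  have hα : S.ncard ≤ H.alpha := ncard_le_alpha fun v hv w hw hvw => by
    obtain ⟨x, -, y, -, hxy⟩ := hB.adj ⟨v, hv⟩ ⟨w, hw⟩ hvw
    exact hxy
  omega

/-- Deleting from `H` all but `α_H + 1` vertices, `α_H` of which are independent, leaves a subgraph
of the star `K_{1,α_H}` up to isolated vertices. -/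
theorem exists_minorOf_induce_of_hasStarMinor {W : Type*} {G : SimpleGraph W} (hγ : 1 ≤ H.gamma)
    (hG : HasStarMinor G H.alpha) :
    ∃ S : Set H.V, S.ncard = H.alpha + 1 ∧ MinorOf (H.graph.induce S) G := by
  classical
  have := Fintype.ofFinite H.V
  obtain ⟨T, Λ, hT, hΛ, hTΛ⟩ := hG
  obtain ⟨I, hI, hind⟩ := exists_indepSet_card_eq_alpha H
  have horder : Nat.card H.V = H.gamma + H.alpha + 1 := order_eq_gamma_add hγ
  obtain ⟨v, hv⟩ : ∃ v, v ∉ I := by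
    by_contra! hall
    rw [Finset.eq_univ_of_forall hall, Finset.card_univ, ← Nat.card_eq_fintype_card] at hI
    omega
  refine ⟨(insert v I : Finset H.V), ?_, ?_⟩
  · rw [ncard_coe_finset, Finset.card_insert_of_notMem hv, hI]
  obtain ⟨e⟩ : Nonempty (I ↪ Λ) :=
    Function.Embedding.nonempty_of_card_le (by simpa [hI] using hΛ)
  let c : ((insert v I : Finset H.V) : Set H.V) := ⟨v, by simp⟩
  have hmem : ∀ u : ({c}ᶜ : Set _), u.1.1 ∈ I := fun u =>
    (Finset.mem_insert.mp u.1.2).resolve_left fun h => u.2 (Subtype.ext h)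
  let leaf : ({c}ᶜ : Set _) → W := fun u => (e ⟨u.1.1, hmem u⟩).1
  have hleaf : Function.Injective leaf := fun u w h => by
    have := e.injective (Subtype.ext h)
    exact Subtype.ext (Subtype.ext (congrArg (fun x : I => x.1) this))
  refine MinorOf.of_induce_compl (S := {c}) (B := fun _ => T)
    ⟨fun _ => hT, fun u w h => absurd (Subsingleton.elim u w) h,
      fun u w h => absurd (Subsingleton.elim u w) h.ne⟩
    (IsModel.singleton hleaf fun u w h => absurd h (hind _ (hmem u) _ (hmem w)))
    (fun _ u => disjoint_singleton_right.mpr (hTΛ _ (e _).2).1) fun _ u => ?_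
  obtain ⟨s, hs, hsu⟩ := (hTΛ _ (e ⟨u.1.1, hmem u⟩).2).2
  exact ⟨s, hs, _, rfl, hsu⟩

theorem not_hasStarMinor_of_not_minorOf_joinGraph (hγ : 1 ≤ H.gamma) (hL : L.ncard = H.gamma)
    (hH : ¬ MinorOf H.graph (joinGraph L R)) : ¬ HasStarMinor (R.induce Lᶜ) H.alpha := by
  intro hstar
  obtain ⟨S, hS, hSR⟩ := exists_minorOf_induce_of_hasStarMinor hγ hstar
  have horder : Nat.card H.V = H.gamma + H.alpha + 1 := order_eq_gamma_add hγ
  exact hH ((minorOf_joinGraph_iff (by omega)).mpr ⟨S, by omega, hSR⟩)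

/-- The families may be infinite: the bound comes from the well-quasi-ordering of the graphs
without large star minors. -/
theorem exists_order_bound {F : Set FinGraph} (hF : F.Nonempty) (hγ : ∀ H ∈ F, 1 ≤ H.gamma) :
    ∃ h : ℕ, ∀ (V : Type) [Finite V] (L : Set V) (R : SimpleGraph V), L.ncard = familyGamma F →
      (∀ H ∈ F, H.order ≤ h → ¬ MinorOf H.graph (joinGraph L R)) →
      ∀ H ∈ F, ¬ MinorOf H.graph (joinGraph L R) := by
  obtain ⟨H₀, hH₀, hγ₀⟩ := exists_gamma_eq_familyGamma hF
  by_contra! hcon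
  choose V hV L R hL hfree H hH hminor using fun h => hcon (H₀.order + h)
  let g : ℕ → FinGraph := fun h => ⟨((L h)ᶜ : Set (V h)), (R h).induce (L h)ᶜ⟩
  have hle : ∀ h h', (L h).ncard ≤ Nat.card (H h').V := fun h h' =>
    (hL h).trans_le (familyGamma_le_order (hH h'))
  obtain ⟨φ, hφ⟩ :=
    (partiallyWellOrderedOn_not_hasStarMinor H₀.alpha).exists_monotone_subseq (f := g)
      fun h => not_hasStarMinor_of_not_minorOf_joinGraph (hγ _ hH₀) ((hL h).trans hγ₀.symm)
        (hfree h H₀ hH₀ (by omega))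
  have hbig : (H (φ 0)).order ≤ φ (H (φ 0)).order := φ.strictMono.id_le _
  refine hfree (φ (H (φ 0)).order) (H (φ 0)) (hH _) (by omega) ?_
  obtain ⟨S, hS, hSm⟩ := (minorOf_joinGraph_iff (hle _ _)).mp (hminor (φ 0))
  exact (minorOf_joinGraph_iff (hle _ _)).mpr
    ⟨S, by rw [hL] at hS ⊢; exact hS, hSm.trans (isMinor_iff.mp (hφ 0 _ (Nat.zero_le _)))⟩

end Joins

theorem IsoProperSubgraph.ncard_edgeSet_lt {K G : FinGraph} (h : K.IsoProperSubgraph G)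
    (hcard : K.order = G.order) : K.graph.edgeSet.ncard < G.graph.edgeSet.ncard := by
  obtain ⟨G', hG', ⟨φ⟩⟩ := h
  have hspan : G'.IsSpanning := Subgraph.isSpanning_iff.mpr <| eq_of_subset_of_ncard_le
    (subset_univ _) ((ncard_univ _).trans (hcard.symm.trans (Nat.card_congr φ.toEquiv))).le
  have hlt : G'.spanningCoe < G.graph := lt_of_le_of_ne G'.spanningCoe_le fun h => hG' <|
    Subgraph.ext (eq_univ_of_forall hspan) (congrArg SimpleGraph.Adj h)
  calc K.graph.edgeSet.ncard
      = G'.spanningCoe.edgeSet.ncard := Nat.card_congr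
        (Iso.mapEdgeSet (φ.trans (G'.spanningCoeEquivCoeOfSpanning hspan).symm))
    _ < G.graph.edgeSet.ncard := ncard_lt_ncard (edgeSet_ssubset_edgeSet.mpr hlt) (toFinite _)

theorem IsoProperSubgraph.isMinor {K G : FinGraph} (h : K.IsoProperSubgraph G) : K.IsMinor G := by
  obtain ⟨G', -, ⟨φ⟩⟩ := h
  exact isMinor_iff.mpr <| MinorOf.of_injective (G'.hom ∘ φ)
    (G'.hom_injective.comp φ.injective) fun v w hvw => G'.hom.map_adj (φ.map_adj_iff.mpr hvw)

/-- A minor of `G` with the fewest edges among the induced subgraphs of `H` of the given order is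
irreducible. -/
theorem exists_irreducibleInduced_isMinor {H G : FinGraph} {S : Set H.V}
    (hS : (H.induce S).IsMinor G) : ∃ K ∈ irreducibleInduced S.ncard H, K.IsMinor G := by
  obtain ⟨T, ⟨hT, hTG⟩, hmin⟩ := exists_min_image
    {T : Set H.V | T.ncard = S.ncard ∧ (H.induce T).IsMinor G}
    (fun T => (H.induce T).graph.edgeSet.ncard) (toFinite _) ⟨S, rfl, hS⟩
  refine ⟨H.induce T, ⟨⟨T, hT, rfl⟩, ?_⟩, hTG⟩
  rintro _ ⟨T', hT', rfl⟩ hproper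
  refine (hmin T' ⟨hT', _root_.trans hproper.isMinor hTG⟩).not_gt (hproper.ncard_edgeSet_lt ?_)
  exact (Nat.card_coe_set_eq T').trans (hT'.trans (hT.symm.trans (Nat.card_coe_set_eq T).symm))

end FinGraph

/-! ### Sparsity of minor-free graphs -/

namespace GraphMinor

open Finset SimpleGraph

section CommonNeighbors

variable {U V : Type*}

theorem MinorOf.of_common_neighbors {H : SimpleGraph U} {G : SimpleGraph V} {S : Set U}
    {B : S → Set V} (hB : IsModel (H.induce S) G B) {l w : (Sᶜ : Set U) → V}
    (hl : Function.Injective l) (hw : Function.Injective w) (hlw : ∀ u v, G.Adj (l u) (w v))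
    (hlB : ∀ u v, ∀ x ∈ B v, G.Adj (l u) x) (hwB : ∀ u v, w u ∉ B v) : MinorOf H G := by
  refine MinorOf.of_induce_compl hB (C := fun v => {l v, w v}) ⟨fun v => ?_, fun u v huv => ?_,
    fun u v _ => ⟨_, Or.inl rfl, _, Or.inr rfl, hlw u v⟩⟩ (fun v u => ?_) fun v u => ?_
  · exact induce_pair_connected_of_adj (hlw v v)
  · rw [Set.disjoint_left]
    rintro x (rfl | rfl) (h | h)
    · exact huv (hl h)
    · exact (hlw u v).ne h
    · exact (hlw v u).ne h.symm
    · exact huv (hw h)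
  · rw [Set.disjoint_left]
    rintro x hx (rfl | rfl)
    · exact (hlB u v _ hx).ne rfl
    · exact hwB u v hx
  · obtain ⟨x, hx⟩ := hB.nonempty v
    exact ⟨x, hx, l u, Or.inl rfl, (hlB u v x hx).symm⟩

theorem IsModel.cons {G : SimpleGraph V} {r : ℕ} {B : Fin r → Set V} (hB : IsModel ⊤ G B)
    {S : Set V} (hS : (G.induce S).Connected) (hdisj : ∀ i, Disjoint S (B i))
    (hadj : ∀ i, ∃ x ∈ S, ∃ y ∈ B i, G.Adj x y) :
    IsModel ⊤ G (Fin.cons S B : Fin (r + 1) → Set V) where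
  connected := Fin.cases hS hB.connected
  disjoint := by
    refine Fin.cases (Fin.cases (absurd rfl) fun i _ => hdisj i) fun i => ?_
    exact Fin.cases (fun _ => (hdisj i).symm) fun j h => hB.disjoint i j (mt (congrArg _) h)
  adj := by
    refine Fin.cases (Fin.cases (fun h => absurd rfl h.ne) fun i _ => hadj i) fun i => ?_
    refine Fin.cases (fun _ => ?_) fun j h => hB.adj i j (mt (congrArg _) h.ne)
    obtain ⟨x, hx, y, hy, hxy⟩ := hadj i
    exact ⟨y, hy, x, hx, hxy.symm⟩

end CommonNeighbors

section Mader

variable {U V : Type*} (G : SimpleGraph V) [DecidableRel G.Adj]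

/-- The sum of the degrees of `G[W]`, that is, twice the number of its edges. -/
def degSum (W : Finset V) : ℕ := ∑ v ∈ W, #{w ∈ W | G.Adj v w}

/-- The neighbourhood of the set `S` in `G[W]`. -/
def nbhdIn [DecidableEq V] (W S : Finset V) : Finset V := {v ∈ W \ S | ∃ u ∈ S, G.Adj u v}

variable {G} {W S : Finset V} {v : V}

theorem mem_nbhdIn [DecidableEq V] : v ∈ nbhdIn G W S ↔ (v ∈ W ∧ v ∉ S) ∧ ∃ u ∈ S, G.Adj u v := by
  rw [nbhdIn, mem_filter, mem_sdiff]

theorem degSum_erase [DecidableEq V] (hv : v ∈ W) :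
    degSum G (W.erase v) + 2 * #{w ∈ W | G.Adj v w} = degSum G W := by
  have hdeg : ∀ u ∈ W.erase v, #{w ∈ W | G.Adj u w} =
      #{w ∈ W.erase v | G.Adj u w} + if G.Adj u v then 1 else 0 := by
    intro u _
    rw [filter_erase]
    split_ifs with h
    · exact (card_erase_add_one (mem_filter.mpr ⟨hv, h⟩)).symm
    · simp [h]
  have hnbrs : ∑ u ∈ W.erase v, (if G.Adj u v then 1 else 0) = #{w ∈ W | G.Adj v w} := by
    rw [← card_filter]
    congr 1
    ext u
    simp only [mem_filter, mem_erase, G.adj_comm u v]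
    exact ⟨fun h => ⟨h.1.2, h.2⟩, fun h => ⟨⟨h.2.ne', h.1⟩, h.2⟩⟩
  unfold degSum
  rw [← add_sum_erase W _ hv, sum_congr rfl hdeg, sum_add_distrib, hnbrs]
  omega

theorem card_nbhdIn_insert [DecidableEq V] (hv : v ∈ nbhdIn G W S) :
    #(nbhdIn G W (insert v S)) + #{w ∈ nbhdIn G W S | G.Adj v w} + 1 =
      #(nbhdIn G W S) + #{w ∈ W \ S | G.Adj v w} := by
  have hunion : nbhdIn G W (insert v S) =
      (nbhdIn G W S).erase v ∪ {w ∈ (W \ S) \ nbhdIn G W S | G.Adj v w} := by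
    ext x
    have hne : G.Adj v x → x ≠ v := fun h => h.ne'
    simp only [mem_nbhdIn, mem_filter, mem_sdiff, mem_erase, mem_union, mem_insert,
      exists_eq_or_imp]
    by_cases hS : ∃ a ∈ S, G.Adj a x <;> simp only [hS] <;> tauto
  have hdisj : Disjoint ((nbhdIn G W S).erase v)
      {w ∈ (W \ S) \ nbhdIn G W S | G.Adj v w} := disjoint_left.mpr fun x hx hx' =>
    (mem_sdiff.mp (mem_filter.mp hx').1).2 (mem_of_mem_erase hx)
  have hsplit : #{w ∈ W \ S | G.Adj v w} =
      #{w ∈ nbhdIn G W S | G.Adj v w} + #{w ∈ (W \ S) \ nbhdIn G W S | G.Adj v w} := by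
    rw [← card_union_of_disjoint (disjoint_filter_filter disjoint_sdiff), ← filter_union,
      union_sdiff_of_subset (show nbhdIn G W S ⊆ W \ S from filter_subset _ _)]
  rw [hunion, card_union_of_disjoint hdisj, hsplit, ← card_erase_add_one hv]
  omega

/-- Contract a maximal connected set `S` such that the average degree stays at least `2 * d`: by
maximality every edge at the contracted vertex lies in at least `d` triangles. -/
theorem exists_connected_contraction [DecidableEq V] {d : ℕ} (hW : W.Nonempty)
    (hdeg : 2 * d * #W ≤ degSum G W) :
    ∃ S ⊆ W, (G.induce (S : Set V)).Connected ∧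
      2 * d * (#(W \ S) + 1) ≤ degSum G (W \ S) + 2 * #(nbhdIn G W S) ∧
      ∀ v ∈ nbhdIn G W S, d ≤ #{w ∈ nbhdIn G W S | G.Adj v w} := by
  classical
  let good : Finset (Finset V) := {S ∈ W.powerset | (G.induce (S : Set V)).Connected ∧
    2 * d * (#(W \ S) + 1) ≤ degSum G (W \ S) + 2 * #(nbhdIn G W S)}
  have hgood : good.Nonempty := by
    obtain ⟨w, hw⟩ := hW
    refine ⟨{w}, mem_filter.mpr ⟨by simpa using hw, ?_, ?_⟩⟩
    · rw [coe_singleton]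
      exact connected_induce_singleton G w
    · have hnbhd : nbhdIn G W {w} = {u ∈ W | G.Adj w u} := by
        ext v
        simp only [mem_nbhdIn, mem_filter, mem_singleton, exists_eq_left]
        exact ⟨fun h => ⟨h.1.1, h.2⟩, fun h => ⟨⟨h.1, h.2.ne'⟩, h.2⟩⟩
      rwa [hnbhd, sdiff_singleton_eq_erase, degSum_erase hw, card_erase_add_one hw]
  obtain ⟨S, hS, hmax⟩ := good.exists_max_image card hgood
  obtain ⟨hSW, hSc, hSd⟩ := mem_filter.mp hS
  refine ⟨S, mem_powerset.mp hSW, hSc, hSd, fun v hv => ?_⟩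
  obtain ⟨⟨hvW, hvS⟩, u, hu, huv⟩ := mem_nbhdIn.mp hv
  by_contra! hlt
  have hvWS : v ∈ W \ S := mem_sdiff.mpr ⟨hvW, hvS⟩
  have hconn : (G.induce ((insert v S : Finset V) : Set V)).Connected := by
    rw [coe_insert, Set.insert_eq, Set.union_comm]
    exact connected_induce_union hSc.preconnected
      (connected_induce_singleton G v).preconnected hu rfl huv
  refine (hmax (insert v S) (mem_filter.mpr ⟨mem_powerset.mpr
    (insert_subset hvW (mem_powerset.mp hSW)), hconn, ?_⟩)).not_gt (by simp [hvS])
  have hdegSum := degSum_erase (G := G) hvWS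
  have hnbhd := card_nbhdIn_insert hv
  rw [← card_erase_add_one hvWS] at hSd
  rw [sdiff_insert]
  linarith

/-- Mader's theorem. -/
theorem exists_top_model_of_le_degSum (r : ℕ) (W : Finset V) (hW : W.Nonempty)
    (hdeg : 2 ^ r * #W ≤ degSum G W) : ∃ B : Fin r → Set V, IsModel ⊤ G B ∧ ∀ i, B i ⊆ W := by
  classical
  induction r generalizing W with
  | zero =>
    exact ⟨fun i => i.elim0, ⟨fun i => i.elim0, fun i => i.elim0, fun i => i.elim0⟩,
      fun i => i.elim0⟩
  | succ r ihr =>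
    induction W using Finset.strongInduction with
    | H W ihW =>
      obtain ⟨S, hSW, hSc, hSd, hmin⟩ :=
        exists_connected_contraction hW (d := 2 ^ r) (by rwa [← pow_succ'])
      rw [← pow_succ'] at hSd
      have hSne : S.Nonempty := coe_nonempty.mp (connected_induce_iff_closed.mp hSc).1
      rcases (nbhdIn G W S).eq_empty_or_nonempty with hN | hN
      · rw [hN, card_empty, mul_zero, add_zero, mul_add] at hSd
        have hne : (W \ S).Nonempty := by
          rw [nonempty_iff_ne_empty]
          intro hempty
          simp [hempty, degSum] at hSd
        obtain ⟨B, hB, hBW⟩ := ihW _ (sdiff_ssubset hSW hSne) hne (by omega)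
        exact ⟨B, hB, fun i => (hBW i).trans (coe_subset.mpr sdiff_subset)⟩
      · obtain ⟨B, hB, hBN⟩ := ihr (nbhdIn G W S) hN (by
          rw [mul_comm, ← smul_eq_mul]
          exact card_nsmul_le_sum _ _ _ hmin)
        have hBN' : ∀ i x, x ∈ B i → (x ∈ W ∧ x ∉ S) ∧ ∃ u ∈ S, G.Adj u x := fun i x hx =>
          mem_nbhdIn.mp (hBN i hx)
        refine ⟨Fin.cons S B, hB.cons hSc (fun i => ?_) fun i => ?_, Fin.cases ?_ fun i x hx => ?_⟩
        · exact Set.disjoint_right.mpr fun x hx => (hBN' i x hx).1.2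
        · obtain ⟨y, hy⟩ := hB.nonempty i
          obtain ⟨u, hu, huy⟩ := (hBN' i y hy).2
          exact ⟨u, hu, y, hy, huy⟩
        · exact coe_subset.mpr hSW
        · exact (hBN' i x hx).1.1

theorem degSum_le_of_not_minorOf [Finite U] {H : SimpleGraph U} (h : ¬ MinorOf H G)
    (W : Finset V) : degSum G W ≤ 2 ^ Nat.card U * #W := by
  by_contra! hlt
  have hW : W.Nonempty := by
    rw [nonempty_iff_ne_empty]
    rintro rfl
    simp [degSum] at hlt
  obtain ⟨B, hB, -⟩ := exists_top_model_of_le_degSum (Nat.card U) W hW hlt.le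
  let e := Finite.equivFin U
  exact h (.trans (.of_injective e e.injective fun _ _ hvw => e.injective.ne hvw.ne) ⟨B, hB⟩)

end Mader

end GraphMinor

namespace FinGraph

open Set SimpleGraph GraphMinor

theorem card_common_neighbors_lt {V : Type*} [Fintype V] {G : SimpleGraph V} [DecidableRel G.Adj]
    {H : FinGraph} (hγ : 1 ≤ H.gamma) (hH : ¬ MinorOf H.graph G) {X : Finset V}
    (hX : X.card = H.gamma + 1) :
    (Finset.univ.filter fun v => ∀ x ∈ X, G.Adj x v).card < H.order := by
  by_contra! hle
  set Y := Finset.univ.filter fun v => ∀ x ∈ X, G.Adj x v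
  classical
  have hXY : ∀ x : X, ∀ y : Y, G.Adj x y := fun x y => by
    have hy := y.2
    simp only [Y, Finset.mem_filter, Finset.mem_univ, true_and] at hy
    exact hy x x.2
  have := Fintype.ofFinite H.V
  obtain ⟨I, hI, hind⟩ := exists_indepSet_card_eq_alpha H
  obtain ⟨e⟩ : Nonempty (H.V ↪ Y) := Function.Embedding.nonempty_of_card_le (by
    rw [Fintype.card_coe, ← Nat.card_eq_fintype_card]
    exact hle)
  have he : Function.Injective fun v => (e v : V) := Subtype.val_injective.comp e.injective
  obtain ⟨τ⟩ : Nonempty (((I : Set H.V)ᶜ : Set H.V) ≃ X) := Finite.card_eq.mp (by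
    have hcompl := ncard_add_ncard_compl (I : Set H.V)
    have horder : Nat.card H.V = H.gamma + H.alpha + 1 := order_eq_gamma_add hγ
    rw [ncard_coe_finset] at hcompl
    rw [Nat.card_coe_set_eq, Nat.card_eq_fintype_card, Fintype.card_coe]
    omega)
  refine hH (MinorOf.of_common_neighbors (S := (I : Set H.V)) (l := fun v => τ v)
    (w := fun v => e v) (B := fun v => {(e v : V)})
    (IsModel.singleton (he.comp Subtype.val_injective)
      fun v w hvw => absurd hvw (hind v v.2 w w.2))
    (Subtype.val_injective.comp τ.injective) (he.comp Subtype.val_injective)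
    (fun u v => hXY _ _) ?_ fun u v h => ?_)
  · rintro u v x rfl
    exact hXY _ _
  · exact u.2 (he (mem_singleton_iff.mp h) ▸ v.2)

end FinGraph

/-! ### The Perron vector -/

namespace GraphSpectrum

open Set SimpleGraph Matrix

section QuadForm

variable {V : Type*} [Fintype V] (G : SimpleGraph V) [DecidableRel G.Adj]

/-- The quadratic form of the adjacency matrix. -/
def quadForm (y : V → ℝ) : ℝ :=
  ∑ u, ∑ v, if G.Adj u v then y u * y v else 0

theorem dotProduct_adjMatrix_mulVec_eq_quadForm (y : V → ℝ) :
    y ⬝ᵥ (G.adjMatrix ℝ *ᵥ y) = quadForm G y :=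
  dotProduct_mulVec_adjMatrix y y

theorem quadForm_nonneg {y : V → ℝ} (hy : ∀ v, 0 ≤ y v) : 0 ≤ quadForm G y :=
  Finset.sum_nonneg fun u _ => Finset.sum_nonneg fun v _ => by
    split_ifs
    exacts [mul_nonneg (hy u) (hy v), le_rfl]

theorem abs_quadForm_le (y : V → ℝ) : |quadForm G y| ≤ quadForm G fun v => |y v| := by
  refine (Finset.abs_sum_le_sum_abs _ _).trans (Finset.sum_le_sum fun u _ => ?_)
  refine (Finset.abs_sum_le_sum_abs _ _).trans (Finset.sum_le_sum fun v _ => ?_)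
  split_ifs <;> simp [abs_mul]

theorem quadForm_smul (c : ℝ) (y : V → ℝ) : quadForm G (c • y) = c ^ 2 * quadForm G y := by
  rw [← dotProduct_adjMatrix_mulVec_eq_quadForm, ← dotProduct_adjMatrix_mulVec_eq_quadForm,
    mulVec_smul, smul_dotProduct, dotProduct_smul, smul_eq_mul, smul_eq_mul]
  ring

theorem continuous_quadForm : Continuous (quadForm G) := by
  unfold quadForm
  refine continuous_finsetSum _ fun u _ => continuous_finsetSum _ fun v _ => ?_
  split_ifs <;> fun_prop

theorem isCompact_setOf_sum_sq_eq (V : Type*) [Fintype V] (c : ℝ) :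
    IsCompact {y : V → ℝ | ∑ v, y v ^ 2 = c} := by
  refine IsCompact.of_isClosed_subset (isCompact_univ_pi fun _ : V => isCompact_Icc (a := -√c)
    (b := √c)) (isClosed_eq (by fun_prop) continuous_const) fun y hy v _ => abs_le.mp ?_
  refine Real.abs_le_sqrt ?_
  rw [← mem_ofPred.mp hy]
  exact Finset.single_le_sum (f := fun v => y v ^ 2) (fun v _ => sq_nonneg _) (Finset.mem_univ v)

theorem exists_nonneg_max_quadForm [Nonempty V] :
    ∃ x : V → ℝ, (∀ v, 0 ≤ x v) ∧ ∑ v, x v ^ 2 = 1 ∧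
      ∀ y : V → ℝ, quadForm G y ≤ quadForm G x * ∑ v, y v ^ 2 := by
  classical
  have hne : {y : V → ℝ | ∑ v, y v ^ 2 = 1}.Nonempty := by
    obtain ⟨v⟩ := ‹Nonempty V›
    exact ⟨Pi.single v 1, by simp [Pi.single_apply]⟩
  obtain ⟨x, hx, hmax⟩ :=
    (isCompact_setOf_sum_sq_eq V 1).exists_isMaxOn hne (continuous_quadForm G).continuousOn
  have hmax' : ∀ y : V → ℝ, ∑ v, y v ^ 2 = 1 → quadForm G y ≤ quadForm G fun v => |x v| :=
    fun y hy => (hmax hy).trans ((le_abs_self _).trans (abs_quadForm_le G x))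
  refine ⟨fun v => |x v|, fun v => abs_nonneg _, by simpa using hx, fun y => ?_⟩
  rcases (Finset.sum_nonneg fun v (_ : v ∈ Finset.univ) => sq_nonneg (y v)).eq_or_lt with h0 | hpos
  · have hy : y = 0 := by
      ext v
      simpa using (Finset.sum_eq_zero_iff_of_nonneg fun v _ => sq_nonneg (y v)).mp h0.symm v
    simp [quadForm, hy]
  · set s := ∑ v, y v ^ 2
    have hsq : (√s)⁻¹ ^ 2 = s⁻¹ := by rw [inv_pow, Real.sq_sqrt hpos.le]
    have hnorm : ∑ v, ((√s)⁻¹ • y) v ^ 2 = 1 := by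
      simp only [Pi.smul_apply, smul_eq_mul, mul_pow, ← Finset.mul_sum, hsq]
      exact inv_mul_cancel₀ hpos.ne'
    have hle := hmax' _ hnorm
    rwa [quadForm_smul, hsq, inv_mul_le_iff₀ hpos, mul_comm] at hle

end QuadForm

section Perron

variable {V : Type*} [Fintype V] {G : SimpleGraph V} [DecidableRel G.Adj] {r : ℝ}

theorem sum_sq_eq_dotProduct (y : V → ℝ) : ∑ v, y v ^ 2 = y ⬝ᵥ y := by
  simp [dotProduct, sq]

/-- The matrix `r - A` is positive semidefinite, so `x` is in its kernel. -/
theorem adjMatrix_mulVec_eq_smul_of_isMax (hmax : ∀ y, quadForm G y ≤ r * ∑ v, y v ^ 2)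
    {x : V → ℝ} (hx : quadForm G x = r * ∑ v, x v ^ 2) : G.adjMatrix ℝ *ᵥ x = r • x := by
  classical
  have hval : ∀ y : V → ℝ, y ⬝ᵥ ((r • (1 : Matrix V V ℝ) - G.adjMatrix ℝ) *ᵥ y) =
      r * ∑ v, y v ^ 2 - quadForm G y := fun y => by
    rw [sub_mulVec, dotProduct_sub, smul_mulVec, one_mulVec, dotProduct_smul,
      sum_sq_eq_dotProduct, dotProduct_adjMatrix_mulVec_eq_quadForm, smul_eq_mul]
  have hpsd : (r • (1 : Matrix V V ℝ) - G.adjMatrix ℝ).PosSemidef := by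
    refine PosSemidef.of_dotProduct_mulVec_nonneg ?_ fun y => ?_
    · refine IsHermitian.sub ?_ (isHermitian_adjMatrix ℝ G)
      rw [IsHermitian, conjTranspose_smul, conjTranspose_one, star_trivial]
    · rw [star_trivial, hval]
      linarith [hmax y]
  have hker := (hpsd.dotProduct_mulVec_zero_iff x).mp (by rw [star_trivial, hval, hx, sub_self])
  rw [sub_mulVec, smul_mulVec, one_mulVec, sub_eq_zero] at hker
  exact hker.symm

theorem mem_spectrum_iff_exists_mulVec_eq [DecidableEq V] {A : Matrix V V ℝ} {c : ℝ} :
    c ∈ spectrum ℝ A ↔ ∃ y : V → ℝ, y ≠ 0 ∧ A *ᵥ y = c • y := by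
  rw [← spectrum_toLin', ← Module.End.hasEigenvalue_iff_mem_spectrum]
  constructor
  · intro h
    obtain ⟨y, hy⟩ := h.exists_hasEigenvector
    exact ⟨y, hy.2, hy.apply_eq_smul⟩
  · rintro ⟨y, hy, h⟩
    exact Module.End.hasEigenvalue_of_hasEigenvector ⟨Module.End.mem_eigenspace_iff.mpr h, hy⟩

theorem abs_le_of_mem_spectrum [DecidableEq V] (hmax : ∀ y, quadForm G y ≤ r * ∑ v, y v ^ 2)
    {c : ℝ} (hc : c ∈ spectrum ℝ (G.adjMatrix ℝ)) : |c| ≤ r := by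
  obtain ⟨y, hy, hyc⟩ := mem_spectrum_iff_exists_mulVec_eq.mp hc
  have hpos : 0 < ∑ v, y v ^ 2 :=
    (Finset.sum_nonneg fun v _ => sq_nonneg (y v)).lt_of_ne fun h =>
      hy (dotProduct_self_eq_zero.mp ((sum_sq_eq_dotProduct y).symm.trans h.symm))
  have hval : quadForm G y = c * ∑ v, y v ^ 2 := by
    rw [← dotProduct_adjMatrix_mulVec_eq_quadForm, hyc, dotProduct_smul, sum_sq_eq_dotProduct,
      smul_eq_mul]
  refine le_of_mul_le_mul_right ?_ hpos
  calc |c| * ∑ v, y v ^ 2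
      = |quadForm G y| := by rw [hval, abs_mul, abs_of_pos hpos]
    _ ≤ r * ∑ v, |y v| ^ 2 := (abs_quadForm_le G y).trans (hmax _)
    _ = r * ∑ v, y v ^ 2 := by simp only [sq_abs]

theorem exists_nonneg_eigenvector (G : SimpleGraph V) [DecidableRel G.Adj] [Nonempty V]
    [DecidableEq V] :
    ∃ r : ℝ, 0 ≤ r ∧ spectralRadius ℝ (G.adjMatrix ℝ) = ENNReal.ofReal r ∧
      (∀ y : V → ℝ, quadForm G y ≤ r * ∑ v, y v ^ 2) ∧
      ∃ x : V → ℝ, (∀ v, 0 ≤ x v) ∧ (∃ v, x v ≠ 0) ∧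
        ∀ u, ∑ v ∈ G.neighborFinset u, x v = r * x u := by
  obtain ⟨x, hx, hx1, hmax⟩ := exists_nonneg_max_quadForm G
  have heig := adjMatrix_mulVec_eq_smul_of_isMax hmax (by rw [hx1, mul_one])
  have hx0 : ∃ v, x v ≠ 0 := by
    by_contra! h
    simp [h] at hx1
  have hr : 0 ≤ quadForm G x := quadForm_nonneg G hx
  have hnorm : ∀ c : ℝ, (‖c‖₊ : ENNReal) = ENNReal.ofReal |c| := fun c => by
    rw [← enorm_eq_nnnorm, ← ofReal_norm, Real.norm_eq_abs]
  refine ⟨_, hr, le_antisymm (iSup₂_le fun c hc => ?_) ?_, hmax, x, hx, hx0, fun u => ?_⟩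
  · rw [hnorm]
    exact ENNReal.ofReal_le_ofReal (abs_le_of_mem_spectrum hmax hc)
  · have hmem : quadForm G x ∈ spectrum ℝ (G.adjMatrix ℝ) :=
      mem_spectrum_iff_exists_mulVec_eq.mpr ⟨x, Function.ne_iff.mpr hx0, heig⟩
    have hle := le_iSup₂ (f := fun (c : ℝ) (_ : c ∈ spectrum ℝ (G.adjMatrix ℝ)) =>
      (‖c‖₊ : ENNReal)) _ hmem
    rwa [hnorm, abs_of_nonneg hr] at hle
  · rw [← adjMatrix_mulVec_apply, heig, Pi.smul_apply, smul_eq_mul]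

theorem quadForm_eq_of_eigen {x : V → ℝ}
    (h : ∀ u, ∑ v ∈ G.neighborFinset u, x v = r * x u) :
    quadForm G x = r * ∑ v, x v ^ 2 := by
  rw [quadForm, Finset.mul_sum]
  refine Finset.sum_congr rfl fun u _ => ?_
  rw [← Finset.sum_filter, ← Finset.mul_sum, ← G.neighborFinset_eq_filter, h]
  ring

end Perron

end GraphSpectrum

namespace FinGraph

open SimpleGraph GraphSpectrum

theorem exists_nonneg_eigenvector (G : FinGraph) [Fintype G.V] [DecidableRel G.graph.Adj]
    [Nonempty G.V] :
    ∃ r : ℝ, 0 ≤ r ∧ G.rho = ENNReal.ofReal r ∧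
      (∀ y : G.V → ℝ, quadForm G.graph y ≤ r * ∑ v, y v ^ 2) ∧
      ∃ x : G.V → ℝ, (∀ v, 0 ≤ x v) ∧ (∃ v, x v ≠ 0) ∧
        ∀ u, ∑ v ∈ G.graph.neighborFinset u, x v = r * x u := by
  classical
  have hrho : G.rho = spectralRadius ℝ (G.graph.adjMatrix ℝ) := by
    unfold rho
    congr!
  rw [hrho]
  exact GraphSpectrum.exists_nonneg_eigenvector G.graph

end FinGraph

/-! ### Dominant vertices -/

namespace GraphSpectrum

open Finset SimpleGraph GraphMinor Filter Topology

section Common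

variable {V : Type*} [Fintype V] [DecidableEq V] {G : SimpleGraph V} [DecidableRel G.Adj]
  {k M : ℕ}

theorem card_filter_lt_card_inter_le
    (hM : ∀ X : Finset V, #X = k + 1 → #{v | ∀ y ∈ X, G.Adj y v} < M) (L : Finset V) :
    #{v | k < #(G.neighborFinset v ∩ L)} ≤ 2 ^ #L * M := by
  have hsub : ({v | k < #(G.neighborFinset v ∩ L)} : Finset V) ⊆
      (L.powersetCard (k + 1)).biUnion fun X => {v | ∀ y ∈ X, G.Adj y v} := by
    intro v hv
    obtain ⟨X, hX, hXc⟩ := exists_subset_card_eq (Nat.succ_le_of_lt (mem_filter.mp hv).2)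
    refine mem_biUnion.mpr ⟨X, mem_powersetCard.mpr ⟨hX.trans inter_subset_right, hXc⟩,
      mem_filter.mpr ⟨mem_univ _, fun y hy => ?_⟩⟩
    exact ((mem_neighborFinset _ _ _).mp (mem_inter.mp (hX hy)).1).symm
  calc #{v | k < #(G.neighborFinset v ∩ L)}
      ≤ #(L.powersetCard (k + 1)) * M := (card_le_card hsub).trans
        (card_biUnion_le_card_mul _ _ M fun X hX => (hM X (mem_powersetCard.mp hX).2).le)
    _ ≤ 2 ^ #L * M := by
        rw [card_powersetCard]
        exact Nat.mul_le_mul_right _ (Nat.choose_le_two_pow _ _)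

theorem sum_card_inter_le_of_forall_card_common_lt
    (hM : ∀ X : Finset V, #X = k + 1 → #{v | ∀ y ∈ X, G.Adj y v} < M) (L : Finset V) (u : V) :
    ∑ v ∈ G.neighborFinset u, #(G.neighborFinset v ∩ L) ≤ k * G.degree u + 2 ^ #L * M * #L := by
  set Q : Finset V := {v | k < #(G.neighborFinset v ∩ L)} with hQ
  have hv : ∀ v, #(G.neighborFinset v ∩ L) ≤ k + if v ∈ Q then #L else 0 := by
    intro v
    by_cases hv : v ∈ Q
    · rw [if_pos hv]
      exact (card_le_card inter_subset_right).trans (Nat.le_add_left _ _)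
    · rw [if_neg hv]
      simpa [hQ] using hv
  refine (sum_le_sum fun v _ => hv v).trans ?_
  rw [sum_add_distrib, sum_const, card_neighborFinset_eq_degree, smul_eq_mul, sum_ite_mem,
    sum_const, smul_eq_mul, mul_comm k]
  gcongr
  exact (card_le_card inter_subset_right).trans (card_filter_lt_card_inter_le hM L)

theorem card_sub_le_card_common {X : Finset V} {d : ℝ}
    (hX : ∀ y ∈ X, (Fintype.card V : ℝ) - G.degree y ≤ d) :
    (Fintype.card V : ℝ) - #X * d ≤ #{v | ∀ y ∈ X, G.Adj y v} := by
  have hcover : (univ : Finset V) ⊆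
      ({v | ∀ y ∈ X, G.Adj y v} : Finset V) ∪ X.biUnion fun y => (G.neighborFinset y)ᶜ := by
    intro v _
    by_cases hv : ∀ y ∈ X, G.Adj y v
    · exact mem_union_left _ (mem_filter.mpr ⟨mem_univ _, hv⟩)
    · push Not at hv
      obtain ⟨y, hy, hyv⟩ := hv
      exact mem_union_right _ (mem_biUnion.mpr ⟨y, hy, by simpa using hyv⟩)
  have hcard : (Fintype.card V : ℝ) ≤
      #{v | ∀ y ∈ X, G.Adj y v} + ∑ y ∈ X, (#(G.neighborFinset y)ᶜ : ℝ) := by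
    exact_mod_cast (card_le_card hcover).trans ((card_union_le _ _).trans
      (Nat.add_le_add_left card_biUnion_le _))
  have hcompl : ∑ y ∈ X, (#(G.neighborFinset y)ᶜ : ℝ) ≤ #X * d := by
    rw [← nsmul_eq_mul]
    refine sum_le_card_nsmul _ _ _ fun y hy => ?_
    rw [card_compl, card_neighborFinset_eq_degree, Nat.cast_sub (G.degree_lt_card_verts y).le]
    exact hX y hy
  linarith

theorem card_le_of_forall_degree
    (hM : ∀ X : Finset V, #X = k + 1 → #{v | ∀ y ∈ X, G.Adj y v} < M) {S : Finset V} {d : ℝ}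
    (hS : ∀ y ∈ S, (Fintype.card V : ℝ) - G.degree y ≤ d)
    (hd : M + (k + 1) * d ≤ Fintype.card V) : #S ≤ k := by
  by_contra! hlt
  obtain ⟨X, hX, hXc⟩ := exists_subset_card_eq (Nat.succ_le_of_lt hlt)
  have hle := card_sub_le_card_common fun y hy => hS y (hX hy)
  have hcommon : (#{v | ∀ y ∈ X, G.Adj y v} : ℝ) < M := mod_cast hM X hXc
  rw [hXc] at hle
  push_cast at hle
  linarith

end Common

/-- A nonnegative eigenvector `x`, with entries at most one and eigenvalue `r`, of a graph in which
the average degree of every induced subgraph is at most `C`. -/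
structure SparseEigen {V : Type*} [Fintype V] [DecidableEq V] (G : SimpleGraph V)
    [DecidableRel G.Adj] (C : ℕ) (r : ℝ) (x : V → ℝ) : Prop where
  sparse : ∀ W : Finset V, degSum G W ≤ C * #W
  r_nonneg : 0 ≤ r
  nonneg : ∀ v, 0 ≤ x v
  le_one : ∀ v, x v ≤ 1
  eigen : ∀ u, ∑ v ∈ G.neighborFinset u, x v = r * x u

namespace SparseEigen

variable {V : Type*} [Fintype V] [DecidableEq V] {G : SimpleGraph V} [DecidableRel G.Adj]
  {C : ℕ} {r : ℝ} {x : V → ℝ}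

theorem sum_degree_le (h : SparseEigen G C r x) :
    ∑ v, (G.degree v : ℝ) ≤ C * Fintype.card V := by
  have hle := h.sparse univ
  simp only [degSum, card_univ, ← neighborFinset_eq_filter, card_neighborFinset_eq_degree] at hle
  exact_mod_cast hle

theorem sum_card_inter_le (h : SparseEigen G C r x) (u : V) (L : Finset V) :
    ∑ v ∈ G.neighborFinset u, (#(G.neighborFinset v ∩ L) : ℝ) ≤ C * (G.degree u + #L) := by
  have hsum : ∑ v ∈ G.neighborFinset u, #(G.neighborFinset v ∩ L) ≤
      degSum G (G.neighborFinset u ∪ L) := by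
    refine (sum_le_sum_of_subset subset_union_left).trans
      (sum_le_sum fun v _ => card_le_card fun w hw => ?_)
    rw [mem_inter, mem_neighborFinset] at hw
    exact mem_filter.mpr ⟨mem_union_right _ hw.2, hw.1⟩
  have hcard : #(G.neighborFinset u ∪ L) ≤ G.degree u + #L := card_union_le _ _
  exact_mod_cast hsum.trans ((h.sparse _).trans (Nat.mul_le_mul_left C hcard))

/-- The left-hand side is the weight of the walks of length two from `u`. -/
theorem sq_mul_le (h : SparseEigen G C r x) {L : Finset V} {ε : ℝ} (hε : 0 ≤ ε)
    (hL : ∀ w ∉ L, x w ≤ ε) (u : V) :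
    r ^ 2 * x u ≤ ∑ v ∈ G.neighborFinset u, ∑ w ∈ G.neighborFinset v ∩ L, x w +
      ε * (C * Fintype.card V) := by
  have hwalk : r ^ 2 * x u = ∑ v ∈ G.neighborFinset u, ∑ w ∈ G.neighborFinset v, x w := by
    simp only [h.eigen, ← mul_sum]
    ring
  have hoff : ∀ v, ∑ w ∈ G.neighborFinset v, x w ≤
      ∑ w ∈ G.neighborFinset v ∩ L, x w + ε * G.degree v := by
    intro v
    rw [← sum_inter_add_sum_sdiff (G.neighborFinset v) L]
    gcongr
    refine (sum_le_card_nsmul _ _ ε fun w hw => hL w (mem_sdiff.mp hw).2).trans ?_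
    rw [nsmul_eq_mul, mul_comm]
    gcongr
    exact card_le_card sdiff_subset
  rw [hwalk]
  refine (sum_le_sum fun v _ => hoff v).trans ?_
  rw [sum_add_distrib, ← mul_sum]
  gcongr
  exact (sum_le_sum_of_subset_of_nonneg (subset_univ _) fun v _ _ => by positivity).trans
    h.sum_degree_le

theorem sq_mul_le_card (h : SparseEigen G C r x) {L : Finset V} {ε : ℝ} (hε : 0 ≤ ε)
    (hL : ∀ w ∉ L, x w ≤ ε) (u : V) :
    r ^ 2 * x u ≤ ∑ v ∈ G.neighborFinset u, (#(G.neighborFinset v ∩ L) : ℝ) +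
      ε * (C * Fintype.card V) := by
  refine (h.sq_mul_le hε hL u).trans ?_
  gcongr with v _
  exact (sum_le_card_nsmul _ _ 1 fun w _ => h.le_one w).trans (by simp)

theorem card_filter_lt_mul_le (h : SparseEigen G C r x) (ε : ℝ) :
    (#{v | ε < x v} : ℝ) * ε * r ≤ C * Fintype.card V := by
  have hcard : (#{v | ε < x v} : ℝ) * ε ≤ ∑ v, x v := by
    rw [← nsmul_eq_mul]
    refine (card_nsmul_le_sum _ _ ε fun v hv => (mem_filter.mp hv).2.le).trans ?_
    exact sum_le_sum_of_subset_of_nonneg (subset_univ _) fun v _ _ => h.nonneg v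
  calc (#{v | ε < x v} : ℝ) * ε * r
      ≤ (∑ v, x v) * r := mul_le_mul_of_nonneg_right hcard h.r_nonneg
    _ = ∑ v, ∑ w ∈ G.neighborFinset v, x w := by
        simp only [h.eigen, ← mul_sum]
        ring
    _ ≤ ∑ v, (G.degree v : ℝ) := sum_le_sum fun v _ =>
        (sum_le_card_nsmul _ _ 1 fun w _ => h.le_one w).trans (by simp)
    _ ≤ C * Fintype.card V := h.sum_degree_le

/-- Entries below `η / (8 * C)` contribute at most a quarter of `r ^ 2 * x u`, and the remaining
ones sit on few vertices, so the walks of length two from `u` force a large degree. -/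
theorem mul_card_le_mul_degree (h : SparseEigen G C r x) (hC : 1 ≤ C) {η : ℝ} (hη : 0 < η)
    (hr : (Fintype.card V : ℝ) / 2 ≤ r ^ 2)
    (hn : 2 * C ^ 2 / (η / (8 * C)) ^ 4 ≤ (Fintype.card V : ℝ)) {u : V} (hu : η < x u) :
    η * Fintype.card V / 4 ≤ C * G.degree u := by
  set n : ℝ := (Fintype.card V : ℝ)
  have : (0 : ℝ) < C := by exact_mod_cast hC
  set ε : ℝ := η / (8 * C) with hε
  have hε0 : 0 < ε := by positivity
  have hrε : C / ε ^ 2 ≤ r := by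
    refine le_of_sq_le_sq (le_trans ?_ hr) h.r_nonneg
    rw [div_le_iff₀ (by positivity)] at hn
    rw [div_pow, ← pow_mul, div_le_iff₀ (by positivity)]
    linarith
  have hr0 : 0 < r := lt_of_lt_of_le (by positivity) hrε
  have hlarge : (#{v | ε < x v} : ℝ) ≤ ε * n := by
    rw [div_le_iff₀ (by positivity)] at hrε
    refine le_of_mul_le_mul_right ?_ (mul_pos hε0 hr0)
    calc (#{v | ε < x v} : ℝ) * (ε * r)
        = #{v | ε < x v} * ε * r := by ring
      _ ≤ C * n := h.card_filter_lt_mul_le ε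
      _ ≤ (r * ε ^ 2) * n := by gcongr
      _ = ε * n * (ε * r) := by ring
  have hwalk := h.sq_mul_le_card hε0.le (L := {v | ε < x v}) (fun w hw => by simpa using hw) u
  have hinter := h.sum_card_inter_le u {v | ε < x v}
  have hru : n / 2 * η ≤ r ^ 2 * x u := by gcongr
  have hClarge : (C : ℝ) * #{v | ε < x v} ≤ C * (ε * n) := by gcongr
  have hCε : C * (ε * n) = η * n / 8 := by
    rw [hε]
    field_simp
  linarith

theorem card_filter_lt_le (h : SparseEigen G C r x) (hC : 1 ≤ C) {η : ℝ} (hη : 0 < η)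
    (hr : (Fintype.card V : ℝ) / 2 ≤ r ^ 2)
    (hn : 2 * C ^ 2 / (η / (8 * C)) ^ 4 ≤ (Fintype.card V : ℝ)) :
    (#{v | η < x v} : ℝ) ≤ 4 * C ^ 2 / η := by
  have : (0 : ℝ) < C := by exact_mod_cast hC
  have hn0 : (0 : ℝ) < Fintype.card V := lt_of_lt_of_le (by positivity) hn
  have hcount : (#{v | η < x v} : ℝ) * (η * Fintype.card V / 4) ≤ C * (C * Fintype.card V) := by
    rw [← nsmul_eq_mul]
    refine (card_nsmul_le_sum _ (fun u => (C : ℝ) * G.degree u) _ fun v hv =>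
      h.mul_card_le_mul_degree hC hη hr hn (mem_filter.mp hv).2).trans ?_
    rw [← mul_sum]
    gcongr
    exact (sum_le_sum_of_subset_of_nonneg (subset_univ _) fun v _ _ => by positivity).trans
      h.sum_degree_le
  rw [le_div_iff₀ hη]
  refine le_of_mul_le_mul_right ?_ hn0
  linarith

section Dominant

variable {k : ℕ} {η : ℝ} {L : Finset V}

theorem mul_sub_le_degree (h : SparseEigen G C r x) (hk : 1 ≤ k) (hη : 0 ≤ η)
    (hL : ∀ w ∉ L, x w ≤ η)
    (hsum : ∀ u, ∑ v ∈ G.neighborFinset u, (#(G.neighborFinset v ∩ L) : ℝ) ≤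
      k * G.degree u + (C * η * Fintype.card V - k ^ 2))
    (hr : (k : ℝ) * (Fintype.card V - k) ≤ r ^ 2) (u : V) :
    Fintype.card V * (x u - 2 * (C * η)) ≤ G.degree u := by
  have hk' : (1 : ℝ) ≤ k := by exact_mod_cast hk
  set n : ℝ := (Fintype.card V : ℝ)
  have hwalk := (h.sq_mul_le_card hη hL u).trans (add_le_add_left (hsum u) _)
  have hru : (k : ℝ) * (n - k) * x u ≤ r ^ 2 * x u := mul_le_mul_of_nonneg_right hr (h.nonneg u)
  have hku : (k : ℝ) ^ 2 * x u ≤ k ^ 2 := mul_le_of_le_one_right (by positivity) (h.le_one u)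
  have herr : C * η * n ≤ k * (C * η * n) := le_mul_of_one_le_left (by positivity) hk'
  refine le_of_mul_le_mul_left (a := (k : ℝ)) ?_ (by linarith)
  calc (k : ℝ) * (n * (x u - 2 * (C * η)))
      = k * (n - k) * x u + k ^ 2 * x u - 2 * (k * (C * η * n)) := by ring
    _ ≤ k * G.degree u := by linarith

theorem card_inter_mul_le (h : SparseEigen G C r x) (hη : 0 ≤ η) (hL : ∀ w ∉ L, x w ≤ η)
    (hsum : ∀ u, ∑ v ∈ G.neighborFinset u, (#(G.neighborFinset v ∩ L) : ℝ) ≤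
      k * G.degree u + (C * η * Fintype.card V - k ^ 2))
    (hr : (k : ℝ) * (Fintype.card V - k) ≤ r ^ 2) {z w : V} (hz : x z = 1) (hw : w ∈ L) :
    (#(G.neighborFinset z ∩ G.neighborFinset w) : ℝ) * (1 - x w) ≤
      2 * (C * η) * Fintype.card V := by
  have hone : ∀ w, 0 ≤ 1 - x w := fun w => sub_nonneg.mpr (h.le_one w)
  have hterm : ∀ v ∈ G.neighborFinset z, (if v ∈ G.neighborFinset w then 1 - x w else 0) ≤
      ∑ w ∈ G.neighborFinset v ∩ L, (1 - x w) := by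
    intro v _
    split_ifs with hv
    · refine single_le_sum (f := fun w => 1 - x w) (fun w _ => hone w) (mem_inter.mpr ⟨?_, hw⟩)
      rw [mem_neighborFinset] at hv ⊢
      exact hv.symm
    · exact sum_nonneg fun w _ => hone w
  calc (#(G.neighborFinset z ∩ G.neighborFinset w) : ℝ) * (1 - x w)
      = ∑ v ∈ G.neighborFinset z, if v ∈ G.neighborFinset w then 1 - x w else 0 := by
        rw [sum_ite_mem, sum_const, nsmul_eq_mul]
    _ ≤ ∑ v ∈ G.neighborFinset z, ∑ w ∈ G.neighborFinset v ∩ L, (1 - x w) := sum_le_sum hterm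
    _ ≤ 2 * (C * η) * Fintype.card V := by
        have hwalk := h.sq_mul_le hη hL z
        have hdeg : (k : ℝ) * G.degree z ≤ k * Fintype.card V :=
          mul_le_mul_of_nonneg_left (mod_cast (G.degree_lt_card_verts z).le) (by positivity)
        simp only [sum_sub_distrib, sum_const, nsmul_eq_mul, mul_one]
        rw [hz] at hwalk
        linarith [hsum z]

theorem entry_gap (h : SparseEigen G C r x) (hk : 1 ≤ k) (hη : 0 ≤ η) (hL : ∀ w ∉ L, x w ≤ η)
    (hsum : ∀ u, ∑ v ∈ G.neighborFinset u, (#(G.neighborFinset v ∩ L) : ℝ) ≤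
      k * G.degree u + (C * η * Fintype.card V - k ^ 2))
    (hr : (k : ℝ) * (Fintype.card V - k) ≤ r ^ 2) {z w : V} (hz : x z = 1) (hw : w ∈ L) :
    (x w - 4 * (C * η)) * (1 - x w) ≤ 2 * (C * η) := by
  have hn : (0 : ℝ) < Fintype.card V := mod_cast Fintype.card_pos_iff.mpr ⟨z⟩
  have hcommon : Fintype.card V * (x w - 4 * (C * η)) ≤
      (#(G.neighborFinset z ∩ G.neighborFinset w) : ℝ) := by
    have hzdeg := h.mul_sub_le_degree hk hη hL hsum hr z
    have hwdeg := h.mul_sub_le_degree hk hη hL hsum hr w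
    have hunion : (G.degree z : ℝ) + G.degree w ≤
        Fintype.card V + #(G.neighborFinset z ∩ G.neighborFinset w) := by
      rw [← card_neighborFinset_eq_degree, ← card_neighborFinset_eq_degree]
      norm_cast
      rw [← card_union_add_card_inter]
      exact Nat.add_le_add_right (card_le_univ _) _
    rw [hz] at hzdeg
    linarith
  have hle := (mul_le_mul_of_nonneg_right hcommon (sub_nonneg.mpr (h.le_one w))).trans
    (h.card_inter_mul_le hη hL hsum hr hz hw)
  refine le_of_mul_le_mul_left ?_ hn
  linarith

theorem le_card_of_forall_notMem_le (h : SparseEigen G C r x) {θ : ℝ} (hθ : 0 ≤ θ)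
    (hr : (k : ℝ) * (Fintype.card V - k) ≤ r ^ 2) {z : V} (hz : x z = 1) {S : Finset V}
    (hS : ∀ w ∉ S, x w ≤ θ) (hn : (k : ℝ) ^ 2 + θ * C * Fintype.card V < Fintype.card V) :
    k ≤ #S := by
  by_contra! hlt
  have hcard : (#S : ℝ) + 1 ≤ k := mod_cast hlt
  have hwalk := h.sq_mul_le_card hθ hS z
  have hinter : ∑ v ∈ G.neighborFinset z, (#(G.neighborFinset v ∩ S) : ℝ) ≤
      Fintype.card V * #S := by
    refine (sum_le_card_nsmul _ _ (#S : ℝ) fun v _ =>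
      mod_cast card_le_card inter_subset_right).trans ?_
    rw [nsmul_eq_mul, card_neighborFinset_eq_degree]
    exact mul_le_mul_of_nonneg_right (mod_cast (G.degree_lt_card_verts z).le) (by positivity)
  have hS' : (Fintype.card V : ℝ) * #S + Fintype.card V ≤ Fintype.card V * k := by
    rw [← mul_add_one]
    gcongr
  rw [hz] at hwalk
  linarith

end Dominant

end SparseEigen

theorem one_sub_le_of_gap {θ t : ℝ} (hθ : 0 < θ) (hθ1 : θ ≤ 1) (ht : t ≤ 1) (hle : θ ≤ t)
    (h : (t - 4 * (θ ^ 2 / 8)) * (1 - t) ≤ 2 * (θ ^ 2 / 8)) : 1 - θ ≤ t := by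
  have hsq : θ ^ 2 ≤ θ := by nlinarith
  have hle' : θ / 2 * (1 - t) ≤ θ / 2 * θ := by
    have hmul : θ / 2 * (1 - t) ≤ (t - 4 * (θ ^ 2 / 8)) * (1 - t) := by
      gcongr
      linarith
    nlinarith
  linarith [le_of_mul_le_mul_left hle' (by linarith)]

theorem exists_pos_forall_mul_le {ι : Type*} [Finite ι] (a : ι → ℝ) {b : ι → ℝ}
    (hb : ∀ i, 0 < b i) : ∃ θ : ℝ, 0 < θ ∧ ∀ i, a i * θ ≤ b i := by
  have hlim : ∀ i, ∀ᶠ θ : ℝ in 𝓝[>] 0, a i * θ ≤ b i := fun i => by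
    have ht : Tendsto (fun θ : ℝ => a i * θ) (𝓝[>] 0) (𝓝 (a i * 0)) :=
      (tendsto_id.const_mul (a i)).mono_left nhdsWithin_le_nhds
    exact ht.eventually_le_const (by simpa using hb i)
  exact (eventually_mem_nhdsWithin.and (eventually_all.mpr hlim)).exists

theorem SparseEigen.exists_dominant_of_threshold {V : Type*} [Fintype V] [DecidableEq V]
    {G : SimpleGraph V} [DecidableRel G.Adj] {k C M : ℕ} {r η θ : ℝ} {x : V → ℝ} {L : Finset V}
    (h : SparseEigen G C r x) (hk : 1 ≤ k) (hC : 1 ≤ C)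
    (hM : ∀ X : Finset V, #X = k + 1 → #{v | ∀ y ∈ X, G.Adj y v} < M)
    (hr : (k : ℝ) * (Fintype.card V - k) ≤ r ^ 2) {z : V} (hz : x z = 1)
    (hθ : 0 < θ) (hθk : 2 * (k + 1) * θ ≤ 1 / 2) (hθC : C * θ ≤ 1 / 4) (hη : C * η = θ ^ 2 / 8)
    (hL : ∀ w, w ∈ L ↔ η < x w)
    (hsum : ∀ u, ∑ v ∈ G.neighborFinset u, (#(G.neighborFinset v ∩ L) : ℝ) ≤
      k * G.degree u + (C * η * Fintype.card V - k ^ 2))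
    (hnM : 2 * (M : ℝ) ≤ Fintype.card V) (hnk : 4 * (k : ℝ) ^ 2 ≤ Fintype.card V) :
    ∃ S : Finset V, #S = k ∧
      (∀ v ∈ S, 1 - θ ≤ x v ∧ (1 - 2 * θ) * Fintype.card V ≤ G.degree v) ∧ ∀ v ∉ S, x v ≤ θ := by
  set n : ℝ := (Fintype.card V : ℝ)
  have hn0 : 0 < n := Nat.cast_pos.mpr (Fintype.card_pos_iff.mpr ⟨z⟩)
  have hC' : (1 : ℝ) ≤ C := mod_cast hC
  have hk' : (1 : ℝ) ≤ k := mod_cast hk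
  have hθ8 : θ ≤ 1 / 8 := by nlinarith
  have hη0 : 0 ≤ η := by
    by_contra! hneg
    nlinarith
  have hηθ : η < θ := by nlinarith
  have hLη : ∀ w ∉ L, x w ≤ η := fun w hw => not_lt.mp (mt (hL w).mpr hw)
  have hentry : ∀ w, θ ≤ x w → 1 - θ ≤ x w := fun w hw =>
    one_sub_le_of_gap hθ (by linarith) (h.le_one w) hw
      (hη ▸ h.entry_gap hk hη0 hLη hsum hr hz ((hL w).mpr (hηθ.trans_le hw)))
  have hdeg : ∀ w, θ ≤ x w → (1 - 2 * θ) * n ≤ G.degree w := fun w hw => by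
    refine le_trans ?_ (h.mul_sub_le_degree hk hη0 hLη hsum hr w)
    rw [mul_comm, hη]
    exact mul_le_mul_of_nonneg_left (by nlinarith [hentry w hw]) hn0.le
  have hmem : ∀ v, v ∈ ({v | θ ≤ x v} : Finset V) ↔ θ ≤ x v := fun v => by simp
  refine ⟨({v | θ ≤ x v} : Finset V), le_antisymm ?_ ?_, fun v hv => ?_, fun v hv => ?_⟩
  · refine card_le_of_forall_degree hM (d := 2 * θ * n) (fun y hy => ?_) ?_
    · linarith [hdeg y ((hmem y).mp hy)]
    · linarith [mul_le_mul_of_nonneg_right hθk hn0.le]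
  · refine h.le_card_of_forall_notMem_le hθ.le hr hz (fun w hw => ?_) ?_
    · exact (not_le.mp (mt (hmem w).mpr hw)).le
    · linarith [mul_le_mul_of_nonneg_right hθC hn0.le]
  · rw [hmem] at hv
    exact ⟨hentry v hv, hdeg v hv⟩
  · exact (not_le.mp (mt (hmem v).mpr hv)).le

/-- All large entries are close to the maximum, because the vertices with an entry above `η` have
many common neighbours; the exclusion of `K_{k+1,M}` and the size of `r` then make their number
exactly `k`. -/
theorem exists_dominant_set {k C : ℕ} (hk : 1 ≤ k) (hC : 1 ≤ C) (M : ℕ) {δ : ℝ} (hδ : 0 < δ) :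
    ∃ N : ℕ, ∀ {V : Type} [Fintype V] [DecidableEq V] (G : SimpleGraph V) [DecidableRel G.Adj]
      (r : ℝ) (x : V → ℝ) (z : V), N ≤ Fintype.card V → SparseEigen G C r x →
      (∀ X : Finset V, #X = k + 1 → #{v | ∀ y ∈ X, G.Adj y v} < M) →
      (k : ℝ) * (Fintype.card V - k) ≤ r ^ 2 → x z = 1 →
      ∃ L : Finset V, #L = k ∧
        (∀ v ∈ L, 1 - δ ≤ x v ∧ (1 - δ) * Fintype.card V ≤ G.degree v) ∧ ∀ v ∉ L, x v ≤ δ := by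
  have hk' : (1 : ℝ) ≤ k := mod_cast hk
  have : (0 : ℝ) < C := mod_cast hC
  obtain ⟨θ, hθ, hθ'⟩ := exists_pos_forall_mul_le ![2, 2 * (k + 1 : ℝ), C]
    (b := ![δ, 1 / 2, 1 / 4]) (by simp [Fin.forall_fin_succ, hδ])
  obtain ⟨hθδ, hθk, hθC⟩ : 2 * θ ≤ δ ∧ 2 * (k + 1) * θ ≤ 1 / 2 ∧ C * θ ≤ 1 / 4 := by
    simpa [Fin.forall_fin_succ] using hθ'
  set η : ℝ := θ ^ 2 / (8 * C) with hη
  have hη0 : 0 < η := by positivity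
  have hCη : C * η = θ ^ 2 / 8 := by
    rw [hη]
    field_simp
  set K : ℕ := ⌊4 * (C : ℝ) ^ 2 / η⌋₊
  set c : ℕ := 2 ^ K * M * K
  obtain ⟨N, hN⟩ := (tendsto_natCast_atTop_atTop.eventually
    (((eventually_ge_atTop (2 * C ^ 2 / (η / (8 * C)) ^ 4)).and
      (eventually_ge_atTop ((c + k ^ 2) / (C * η)))).and ((eventually_ge_atTop (2 * (M : ℝ))).and
      (eventually_ge_atTop (4 * (k : ℝ) ^ 2))))).exists_forall_of_atTop
  refine ⟨N, fun {V} _ _ G _ r x z hNV h hM hr hz => ?_⟩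
  obtain ⟨⟨hnC, hnc⟩, hnM, hnk⟩ := hN _ hNV
  set n : ℝ := (Fintype.card V : ℝ)
  rw [div_le_iff₀ (by positivity)] at hnc
  have hr2 : n / 2 ≤ r ^ 2 := by nlinarith
  set L : Finset V := {v | η < x v} with hL
  have hLK : #L ≤ K := Nat.le_floor (h.card_filter_lt_le hC hη0 hr2 hnC)
  have hsum : ∀ u, ∑ v ∈ G.neighborFinset u, (#(G.neighborFinset v ∩ L) : ℝ) ≤
      k * G.degree u + (C * η * n - k ^ 2) := fun u => by
    have hle : ∑ v ∈ G.neighborFinset u, #(G.neighborFinset v ∩ L) ≤ k * G.degree u + c :=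
      (sum_card_inter_le_of_forall_card_common_lt hM L u).trans (Nat.add_le_add_left
        (show 2 ^ #L * M * #L ≤ 2 ^ K * M * K by gcongr; norm_num) _)
    have hle' : ∑ v ∈ G.neighborFinset u, (#(G.neighborFinset v ∩ L) : ℝ) ≤
        k * G.degree u + c := mod_cast hle
    linarith
  obtain ⟨S, hS, hSin, hSout⟩ :=
    h.exists_dominant_of_threshold hk hC hM hr hz hθ hθk hθC hCη (by simp [hL]) hsum hnM hnk
  refine ⟨S, hS, fun v hv => ⟨by linarith [hSin v hv], le_trans ?_ (hSin v hv).2⟩,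
    fun v hv => by linarith [hSout v hv]⟩
  gcongr

end GraphSpectrum

namespace GraphMinor

open Set SimpleGraph

section Relocate

variable {U V : Type*}

/-- A branch set of a model in `R` that is not contained in `P` is an isolated vertex of `R`, so
it can be replaced by any vertex. -/
theorem IsModel.relocate {K : SimpleGraph U} {G R : SimpleGraph V} {P : Set V} {B : U → Set V}
    (hB : IsModel K R B) (hRG : R ≤ G) (hR : ∀ u v, R.Adj u v → u ∈ P ∧ v ∈ P) {e : U → V}
    (he : Function.Injective e) (heP : ∀ s, e s ∉ P) :
    ∃ B' : U → Set V, IsModel K G B' ∧ ∀ s, B' s ⊆ insert (e s) P := by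
  classical
  have hclosed : ∀ s, ∀ a ∈ B s, a ∈ P → B s ⊆ P := fun s a ha haP =>
    (connected_induce_iff_closed.mp (hB.connected s)).2 P ⟨a, ha, haP⟩
      fun x _ _ y _ hxy => (hR x y hxy).2
  refine ⟨fun s => if B s ⊆ P then B s else {e s}, ⟨fun s => ?_, fun s t hst => ?_,
    fun s t hst => ?_⟩, fun s => ?_⟩
  · by_cases hs : B s ⊆ P
    · rw [if_pos hs]
      exact connected_induce_mono hRG (hB.connected s)
    · rw [if_neg hs]
      exact connected_induce_singleton G _
  · split_ifs with hs ht ht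
    · exact hB.disjoint s t hst
    · exact disjoint_singleton_right.mpr fun h => heP t (hs h)
    · exact disjoint_singleton_left.mpr fun h => heP s (ht h)
    · exact disjoint_singleton.mpr (he.ne hst)
  · obtain ⟨x, hx, y, hy, hxy⟩ := hB.adj s t hst
    obtain ⟨hxP, hyP⟩ := hR x y hxy
    rw [if_pos (hclosed s x hx hxP), if_pos (hclosed t y hy hyP)]
    exact ⟨x, hx, y, hy, hRG hxy⟩
  · beta_reduce
    split_ifs with hs
    exacts [hs.trans (subset_insert _ _), singleton_subset_iff.mpr (mem_insert _ _)]

theorem MinorOf.of_joinGraph_of_le [Finite U] [Finite V] {H : SimpleGraph U} {G R : SimpleGraph V}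
    {L P : Set V} {W : Finset V} (hL : L.ncard ≤ Nat.card U) (hW : Nat.card U ≤ W.card)
    (hRG : R ≤ G) (hR : ∀ u v, R.Adj u v → u ∈ P ∧ v ∈ P) (hWP : ∀ v ∈ W, v ∉ P)
    (hLP : ∀ l ∈ L, ∀ v ∈ P, G.Adj l v) (hLW : ∀ l ∈ L, ∀ v ∈ W, G.Adj l v)
    (h : MinorOf H (joinGraph L R)) : MinorOf H G := by
  obtain ⟨S, hS, hM⟩ := (minorOf_joinGraph_iff hL).mp h
  obtain ⟨B, hB, -⟩ := minorOf_induce_iff.mp hM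
  have hScompl := ncard_add_ncard_compl S
  obtain ⟨τ⟩ : Nonempty ((Sᶜ : Set U) ≃ L) := Finite.card_eq.mp (by
    rw [Nat.card_coe_set_eq, Nat.card_coe_set_eq]
    omega)
  have := Fintype.ofFinite U
  obtain ⟨e⟩ : Nonempty (U ↪ W) := Function.Embedding.nonempty_of_card_le (by
    rwa [Fintype.card_coe, ← Nat.card_eq_fintype_card])
  have he : Function.Injective fun u => (e u : V) := Subtype.val_injective.comp e.injective
  obtain ⟨B', hB', hB'P⟩ := hB.relocate hRG hR (he.comp Subtype.val_injective)
    fun s => hWP _ (e s).2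
  refine MinorOf.of_common_neighbors hB' (l := fun v => τ v) (w := fun v => e v)
    (Subtype.val_injective.comp τ.injective) (he.comp Subtype.val_injective)
    (fun u v => hLW _ (τ u).2 _ (e v).2) (fun u v a ha => ?_) fun u v ha => ?_
  · rcases hB'P v ha with rfl | haP
    exacts [hLW _ (τ u).2 _ (e v).2, hLP _ (τ u).2 _ haP]
  · rcases hB'P v ha with huv | haP
    exacts [u.2 (he huv ▸ v.2), hWP _ (e u).2 haP]

end Relocate

end GraphMinor

namespace GraphSpectrum

open Finset SimpleGraph GraphMinor

section EdgeSum

variable {V : Type*} (G : SimpleGraph V) [DecidableRel G.Adj]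

/-- The bilinear form of the adjacency matrix, restricted to the rows in `S` and the columns
in `T`. -/
def edgeSum (S T : Finset V) (x y : V → ℝ) : ℝ :=
  ∑ u ∈ S, ∑ v ∈ T, if G.Adj u v then x u * y v else 0

variable {G} {S S' T T' : Finset V} {x y : V → ℝ}

theorem edgeSum_comm : edgeSum G S T x y = edgeSum G T S y x := by
  rw [edgeSum, sum_comm]
  simp only [edgeSum, G.adj_comm, mul_comm]

theorem ite_adj_mul_nonneg (hx : ∀ v, 0 ≤ x v) (hy : ∀ v, 0 ≤ y v) (u v : V) :
    0 ≤ if G.Adj u v then x u * y v else 0 := by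
  split_ifs
  exacts [mul_nonneg (hx u) (hy v), le_rfl]

theorem edgeSum_mono {G' : SimpleGraph V} [DecidableRel G'.Adj] (hx : ∀ v, 0 ≤ x v)
    (hy : ∀ v, 0 ≤ y v) (hS : S ⊆ S') (hT : T ⊆ T')
    (h : ∀ u ∈ S, ∀ v ∈ T, G.Adj u v → G'.Adj u v) : edgeSum G S T x y ≤ edgeSum G' S' T' x y := by
  have hnn := ite_adj_mul_nonneg (G := G') hx hy
  calc edgeSum G S T x y
      ≤ edgeSum G' S T x y := sum_le_sum fun u hu => sum_le_sum fun v hv => by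
        by_cases huv : G.Adj u v
        · rw [if_pos huv, if_pos (h u hu v hv huv)]
        · rw [if_neg huv]
          exact hnn u v
    _ ≤ edgeSum G' S T' x y := sum_le_sum fun u _ =>
        sum_le_sum_of_subset_of_nonneg hT fun v _ _ => hnn u v
    _ ≤ edgeSum G' S' T' x y :=
        sum_le_sum_of_subset_of_nonneg hS fun u _ _ => sum_nonneg fun v _ => hnn u v

theorem edgeSum_nonneg (hx : ∀ v, 0 ≤ x v) (hy : ∀ v, 0 ≤ y v) : 0 ≤ edgeSum G S T x y :=
  sum_nonneg fun u _ => sum_nonneg fun v _ => ite_adj_mul_nonneg hx hy u v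

theorem mul_le_edgeSum (hx : ∀ v, 0 ≤ x v) (hy : ∀ v, 0 ≤ y v) {u v : V} (hu : u ∈ S) (hv : v ∈ T)
    (huv : G.Adj u v) : x u * y v ≤ edgeSum G S T x y := by
  refine le_trans ?_ (edgeSum_mono (G := G) hx hy (singleton_subset_iff.mpr hu)
    (singleton_subset_iff.mpr hv) fun _ _ _ _ h => h)
  simp [edgeSum, huv]


theorem edgeSum_le_of_card_filter_le {M : ℕ} {δ : ℝ} (hx : ∀ v, 0 ≤ x v) (hδ : 0 ≤ δ)
    (hM : ∀ u ∈ S, #{v ∈ T | G.Adj u v} ≤ M) (hT : ∀ v ∈ T, x v ≤ δ) :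
    edgeSum G S T x x ≤ M * δ * ∑ u ∈ S, x u := by
  rw [edgeSum, mul_sum]
  refine sum_le_sum fun u hu => ?_
  rw [← sum_filter, ← mul_sum, mul_comm]
  refine mul_le_mul_of_nonneg_right ?_ (hx u)
  calc ∑ v ∈ T with G.Adj u v, x v
      ≤ #{v ∈ T | G.Adj u v} • δ := sum_le_card_nsmul _ _ _ fun v hv => hT v (mem_filter.mp hv).1
    _ ≤ M * δ := by
        rw [nsmul_eq_mul]
        gcongr
        exact hM u hu

theorem edgeSum_union_right [DecidableEq V] (hT : Disjoint T T') :
    edgeSum G S (T ∪ T') x y = edgeSum G S T x y + edgeSum G S T' x y := by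
  simp only [edgeSum, sum_union hT, sum_add_distrib]

theorem edgeSum_union_self [DecidableEq V] (h : Disjoint S T) :
    edgeSum G (S ∪ T) (S ∪ T) x x = edgeSum G S S x x + 2 * edgeSum G S T x x +
      edgeSum G T T x x := by
  rw [edgeSum_union_right h, edgeSum_comm, edgeSum_comm (T := T), edgeSum_union_right h,
    edgeSum_union_right h, edgeSum_comm (S := T) (T := S)]
  ring

/-- A vertex of `A` of degree at most `C` in `G[A]` is removed in each step. -/
theorem edgeSum_self_le_of_degSum_le {C : ℕ} (hC : ∀ W : Finset V, degSum G W ≤ C * #W) {δ : ℝ}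
    (hx : ∀ v, 0 ≤ x v) (A : Finset V) (hA : ∀ v ∈ A, x v ≤ δ) :
    edgeSum G A A x x ≤ 2 * C * δ * ∑ v ∈ A, x v := by
  classical
  induction A using Finset.strongInduction with
  | H A ih =>
    rcases A.eq_empty_or_nonempty with rfl | hne
    · simp [edgeSum]
    obtain ⟨a, ha, hdeg⟩ : ∃ a ∈ A, #{v ∈ A | G.Adj a v} ≤ C := by
      refine exists_le_of_sum_le hne ?_
      rw [sum_const, smul_eq_mul, mul_comm]
      exact hC A
    have herase : ∀ v ∈ A.erase a, x v ≤ δ := fun v hv => hA v (mem_of_mem_erase hv)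
    have hrow : edgeSum G {a} (A.erase a) x x ≤ C * δ * ∑ v ∈ {a}, x v := by
      refine edgeSum_le_of_card_filter_le hx ((hx a).trans (hA a ha)) (fun u hu => ?_) herase
      rw [mem_singleton.mp hu]
      exact (card_le_card (filter_subset_filter _ (erase_subset a A))).trans hdeg
    have hloop : edgeSum G {a} {a} x x = 0 := by simp [edgeSum]
    calc edgeSum G A A x x
        = 2 * edgeSum G {a} (A.erase a) x x + edgeSum G (A.erase a) (A.erase a) x x := by
          rw [← insert_erase ha, insert_eq,
            edgeSum_union_self (disjoint_singleton_left.mpr (notMem_erase a A)), ← insert_eq,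
            insert_erase ha, hloop, zero_add]
      _ ≤ 2 * (C * δ * ∑ v ∈ {a}, x v) + 2 * C * δ * ∑ v ∈ A.erase a, x v := by
          gcongr
          exact ih _ (erase_ssubset ha) herase
      _ = 2 * C * δ * ∑ v ∈ A, x v := by
          rw [sum_singleton, ← add_sum_erase A x ha]
          ring

end EdgeSum

/-- The gain from raising an entry below `1 / (2 * r)` to this value. -/
theorem one_div_le_of_raise {r : ℝ} (hr : 0 < r) (x : ℝ) :
    1 / (16 * r) ≤ x + max 0 (1 / (2 * r) - x) - 2 * r * x * max 0 (1 / (2 * r) - x) -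
      r * max 0 (1 / (2 * r) - x) ^ 2 := by
  obtain ⟨i, hi, rfl⟩ : ∃ i : ℝ, 0 < i ∧ r = 1 / i := ⟨1 / r, by positivity, by simp⟩
  have hi16 : 1 / (16 * (1 / i)) = i / 16 := by field_simp
  have hi2 : 1 / (2 * (1 / i)) = i / 2 := by field_simp
  rw [hi16, hi2]
  rcases le_total (i / 2) x with h | h
  · rw [max_eq_left (by linarith)]
    linarith
  · rw [max_eq_right (by linarith)]
    have hsq : x + (i / 2 - x) - 2 * (1 / i) * x * (i / 2 - x) - 1 / i * (i / 2 - x) ^ 2 =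
        i / 4 + x ^ 2 / i := by
      field_simp
      ring
    rw [hsq]
    have : 0 ≤ x ^ 2 / i := by positivity
    linarith

end GraphSpectrum

/-! ### Exchanging edges -/

namespace GraphMinor

open Finset SimpleGraph

section Exchange

variable {V : Type*} (G : SimpleGraph V)

/-- The graph obtained from `G` by making the vertices of `L` dominating and deleting all other
edges that are not inside `S`. -/
def exchange (L S : Finset V) : SimpleGraph V :=
  joinGraph (L : Set V) (G.induce (S : Set V)).spanningCoe

variable {G}

theorem adj_spanningCoe_induce {P : Set V} {u v : V} :
    (G.induce P).spanningCoe.Adj u v ↔ G.Adj u v ∧ u ∈ P ∧ v ∈ P := by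
  simp only [map_adj, comap_adj, Function.Embedding.subtype_apply, Subtype.exists, exists_prop]
  grind

theorem exchange_adj {L S : Finset V} {u v : V} :
    (exchange G L S).Adj u v ↔
      u ≠ v ∧ (u ∈ L ∨ v ∈ L ∨ G.Adj u v ∧ u ∈ S ∧ v ∈ S) := by
  rw [← mem_coe (s := S), ← mem_coe (s := S), ← adj_spanningCoe_induce]
  rfl

variable [DecidableEq V]

variable (G) in
/-- `B` is the set of common neighbours of `L`, and `W` is a subset of `B` all of whose neighbours
lie in `L ∪ B`. The vertices of `W` are kept in reserve: they become isolated outside `L` when `G`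
is replaced by `exchange G L (B \ W)`, so that their edges to `L` can replace the edges added at
the vertices of `(L ∪ B)ᶜ`. -/
structure IsReserve (L B W : Finset V) : Prop where
  mem_iff : ∀ v, v ∈ B ↔ ∀ l ∈ L, G.Adj l v
  subset : W ⊆ B
  mem_of_adj : ∀ w ∈ W, ∀ v, G.Adj w v → v ∈ L ∪ B

namespace IsReserve

variable {L B W : Finset V}

theorem disjoint (h : IsReserve G L B W) : Disjoint L B :=
  disjoint_left.mpr fun v hvL hvB => ((h.mem_iff v).mp hvB v hvL).ne rfl

theorem exists_not_adj [Fintype V] (h : IsReserve G L B W) {v : V} (hv : v ∈ (L ∪ B)ᶜ) :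
    ∃ l ∈ L, ¬ G.Adj v l := by
  rw [mem_compl, mem_union, not_or, h.mem_iff, not_forall₂] at hv
  obtain ⟨-, l, hl, hlv⟩ := hv
  exact ⟨l, hl, fun hvl => hlv hvl.symm⟩

end IsReserve

end Exchange

end GraphMinor

namespace GraphSpectrum

open Finset SimpleGraph GraphMinor

section EdgeSum

variable {V : Type*} {G K : SimpleGraph V} [DecidableRel G.Adj]
  [DecidableRel K.Adj] {S T : Finset V} {x y : V → ℝ}

theorem edgeSum_add_edgeSum_compl [DecidableEq V] (h : ∀ u ∈ S, ∀ v ∈ T, u ≠ v → K.Adj u v) :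
    edgeSum G S T x y + edgeSum Gᶜ S T x y = edgeSum K S T x y := by
  simp only [edgeSum, ← sum_add_distrib]
  refine sum_congr rfl fun u hu => sum_congr rfl fun v hv => ?_
  rcases eq_or_ne u v with rfl | huv
  · simp
  · by_cases hG : G.Adj u v <;> simp [hG, huv, h u hu v hv huv]

theorem mul_sum_le_edgeSum {c : ℝ} (hx : ∀ v, 0 ≤ x v) (hy : ∀ v, 0 ≤ y v)
    (h : ∀ u ∈ S, ∃ v ∈ T, G.Adj u v ∧ c ≤ y v) : c * ∑ u ∈ S, x u ≤ edgeSum G S T x y := by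
  rw [mul_sum]
  refine sum_le_sum fun u hu => ?_
  obtain ⟨v, hv, huv, hc⟩ := h u hu
  calc c * x u
      ≤ if G.Adj u v then x u * y v else 0 := by
        rw [if_pos huv, mul_comm]
        exact mul_le_mul_of_nonneg_left hc (hx u)
    _ ≤ _ := single_le_sum (f := fun v => if G.Adj u v then x u * y v else 0)
        (fun v _ => ite_adj_mul_nonneg hx hy u v) hv

theorem edgeSum_self_le_add_of_subset [DecidableEq V] {B W : Finset V} (hW : W ⊆ B)
    (hK : ∀ u ∈ B \ W, ∀ v ∈ B \ W, G.Adj u v → K.Adj u v) (hx : ∀ v, 0 ≤ x v) :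
    edgeSum G B B x x ≤ edgeSum K B B x x + 2 * edgeSum G W B x x := by
  have hdisj : Disjoint W (B \ W) := disjoint_sdiff
  have hself : edgeSum G B B x x = edgeSum G W W x x + 2 * edgeSum G W (B \ W) x x +
      edgeSum G (B \ W) (B \ W) x x := by
    rw [← edgeSum_union_self hdisj, union_sdiff_of_subset hW]
  have hcross : edgeSum G W B x x = edgeSum G W W x x + edgeSum G W (B \ W) x x := by
    rw [← edgeSum_union_right hdisj, union_sdiff_of_subset hW]
  have hmono : edgeSum G (B \ W) (B \ W) x x ≤ edgeSum K B B x x :=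
    edgeSum_mono hx hx sdiff_subset sdiff_subset hK
  have hWW : 0 ≤ edgeSum G W W x x := edgeSum_nonneg hx hx
  linarith

variable [Fintype V]

theorem quadForm_add (x z : V → ℝ) :
    quadForm G (x + z) = quadForm G x + 2 * edgeSum G univ univ z x + quadForm G z := by
  have hsymm : edgeSum G univ univ z x = edgeSum G univ univ x z := edgeSum_comm
  rw [two_mul]
  nth_rw 2 [hsymm]
  simp only [quadForm, edgeSum, ← sum_add_distrib]
  refine sum_congr rfl fun u _ => sum_congr rfl fun v _ => ?_
  split_ifs
  · simp only [Pi.add_apply]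
    ring
  · simp

theorem quadForm_eq_edgeSum [DecidableEq V] (L B : Finset V) (h : Disjoint L B) (x : V → ℝ) :
    quadForm G x = edgeSum G L L x x + 2 * edgeSum G (L ∪ B)ᶜ L x x + 2 * edgeSum G B L x x +
      edgeSum G (L ∪ B)ᶜ (L ∪ B)ᶜ x x + 2 * edgeSum G (L ∪ B)ᶜ B x x + edgeSum G B B x x := by
  have hA : Disjoint (L ∪ B)ᶜ (L ∪ B) := disjoint_compl_left
  calc quadForm G x
      = edgeSum G ((L ∪ B)ᶜ ∪ (L ∪ B)) ((L ∪ B)ᶜ ∪ (L ∪ B)) x x := by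
        rw [union_comm, union_compl]
        rfl
    _ = _ := by
        rw [edgeSum_union_self hA, edgeSum_union_self h, edgeSum_union_right h,
          edgeSum_comm (S := L) (T := B)]
        ring

theorem quadForm_add_le_quadForm [DecidableEq V] {L B W : Finset V} (hLB : Disjoint L B)
    (hW : W ⊆ B) (hKL : ∀ u, ∀ v ∈ L, u ≠ v → K.Adj u v)
    (hKB : ∀ u ∈ B \ W, ∀ v ∈ B \ W, G.Adj u v → K.Adj u v) (hx : ∀ v, 0 ≤ x v) :
    quadForm G x + 2 * edgeSum Gᶜ (L ∪ B)ᶜ L x x + edgeSum Gᶜ L L x x ≤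
      quadForm K x + edgeSum G (L ∪ B)ᶜ (L ∪ B)ᶜ x x + 2 * edgeSum G (L ∪ B)ᶜ B x x +
        2 * edgeSum G W B x x := by
  have hLL : edgeSum G L L x x + edgeSum Gᶜ L L x x = edgeSum K L L x x :=
    edgeSum_add_edgeSum_compl fun u _ => hKL u
  have hAL : edgeSum G (L ∪ B)ᶜ L x x + edgeSum Gᶜ (L ∪ B)ᶜ L x x = edgeSum K (L ∪ B)ᶜ L x x :=
    edgeSum_add_edgeSum_compl fun u _ => hKL u
  have hBL : edgeSum G B L x x ≤ edgeSum K B L x x :=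
    edgeSum_mono hx hx subset_rfl subset_rfl fun u _ v hv huv => hKL u v hv huv.ne
  have hBB := edgeSum_self_le_add_of_subset hW hKB hx
  have hAA : 0 ≤ edgeSum K (L ∪ B)ᶜ (L ∪ B)ᶜ x x := edgeSum_nonneg hx hx
  have hAB : 0 ≤ edgeSum K (L ∪ B)ᶜ B x x := edgeSum_nonneg hx hx
  rw [quadForm_eq_edgeSum (G := G) L B hLB, quadForm_eq_edgeSum (G := K) L B hLB]
  linarith

/-- If every vertex of `A` has a neighbour with a large entry, the entries on `A` can be raised to
`1 / (2 * r)` at a small cost. -/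
theorem exists_quadForm_raise {r : ℝ} (hr : 0 < r) (hx : ∀ v, 0 ≤ x v) {A : Finset V}
    (hA : ∀ u ∈ A, ∃ v, G.Adj u v ∧ 1 / 2 ≤ x v) :
    ∃ y : V → ℝ, #A * (1 / (16 * r)) + quadForm G x - r * ∑ v, x v ^ 2 ≤
      ∑ u ∈ A, x u + quadForm G y - r * ∑ v, y v ^ 2 := by
  classical
  let z : V → ℝ := fun v => if v ∈ A then max 0 (1 / (2 * r) - x v) else 0
  have hz : ∀ v, 0 ≤ z v := fun v => by
    simp only [z]
    split_ifs
    exacts [le_max_left _ _, le_rfl]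
  have hcross : 1 / 2 * ∑ u ∈ A, z u ≤ edgeSum G univ univ z x :=
    (mul_sum_le_edgeSum (T := univ) hz hx fun u hu => by simpa using hA u hu).trans
      (edgeSum_mono hz hx (subset_univ A) subset_rfl fun _ _ _ _ huv => huv)
  have hsq : ∑ v, (x + z) v ^ 2 = ∑ v, x v ^ 2 + ∑ u ∈ A, (2 * x u * z u + z u ^ 2) := by
    have hterm : ∀ v, (x + z) v ^ 2 =
        x v ^ 2 + if v ∈ A then 2 * x v * z v + z v ^ 2 else 0 := fun v => by
      by_cases hv : v ∈ A
      · rw [if_pos hv, Pi.add_apply]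
        ring
      · simp [z, hv]
    simp only [hterm, sum_add_distrib, sum_ite_mem, univ_inter]
  have hgain : #A * (1 / (16 * r)) ≤
      ∑ u ∈ A, x u + ∑ u ∈ A, z u - r * ∑ u ∈ A, (2 * x u * z u + z u ^ 2) := by
    rw [mul_sum, ← sum_add_distrib, ← sum_sub_distrib, ← nsmul_eq_mul]
    refine card_nsmul_le_sum _ _ _ fun u hu => (one_div_le_of_raise hr (x u)).trans_eq ?_
    simp only [z, hu, if_true]
    ring
  refine ⟨x + z, ?_⟩
  rw [quadForm_add, hsq, mul_add]
  linarith [quadForm_nonneg G hz]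

end EdgeSum

section Exchange

variable {V : Type*} [Fintype V] [DecidableEq V] {G : SimpleGraph V} [DecidableRel G.Adj]
  {L B W : Finset V} {C M : ℕ} {r δ : ℝ} {x : V → ℝ}

theorem SparseEigen.entry_reserve_le (hx : SparseEigen G C r x) (h : IsReserve G L B W)
    (hr : 0 < r) (hδ : 0 ≤ δ) (hxL : ∀ v ∉ L, x v ≤ δ) (hM : ∀ v ∉ L, #{u ∈ B | G.Adj v u} ≤ M)
    (hMδ : M * δ ≤ 1) {w : V} (hw : w ∈ W) : x w ≤ (#L + 1) / r := by
  have hBL : ∀ v ∈ B, v ∉ L := fun v hv hvL => disjoint_left.mp h.disjoint hvL hv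
  have hsub : G.neighborFinset w ⊆ L ∪ {u ∈ B | G.Adj w u} := fun v hv => by
    have hwv := (G.mem_neighborFinset w v).mp hv
    have := h.mem_of_adj w hw v hwv
    simp only [mem_union, mem_filter] at this ⊢
    tauto
  rw [le_div_iff₀ hr, mul_comm, ← hx.eigen]
  calc ∑ v ∈ G.neighborFinset w, x v
      ≤ ∑ v ∈ L ∪ {u ∈ B | G.Adj w u}, x v :=
        sum_le_sum_of_subset_of_nonneg hsub fun v _ _ => hx.nonneg v
    _ ≤ ∑ v ∈ L, x v + ∑ v ∈ B with G.Adj w v, x v := by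
        rw [← sum_union_inter]
        exact le_add_of_nonneg_right (sum_nonneg fun v _ => hx.nonneg v)
    _ ≤ #L • 1 + #{u ∈ B | G.Adj w u} • δ :=
        add_le_add (sum_le_card_nsmul _ _ _ fun v _ => hx.le_one v)
          (sum_le_card_nsmul _ _ _ fun v hv => hxL v (hBL v (mem_filter.mp hv).1))
    _ ≤ #L + 1 := by
        rw [nsmul_one, nsmul_eq_mul]
        have : (#{u ∈ B | G.Adj w u} : ℝ) ≤ M := mod_cast hM w (hBL w (h.subset hw))
        linarith [mul_le_mul_of_nonneg_right this hδ]

variable [DecidableRel (exchange G L (B \ W)).Adj]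

/-- Each vertex outside `L ∪ B` misses a vertex of `L`, where the entries are close to one; all
other changes are smaller by a factor `δ`. -/
theorem SparseEigen.sum_add_le_quadForm_exchange (hx : SparseEigen G C r x)
    (h : IsReserve G L B W) (hr : 0 < r) (hδ : 0 ≤ δ) (hxL : ∀ v ∈ L, 1 - δ ≤ x v)
    (hxR : ∀ v ∉ L, x v ≤ δ) (hM : ∀ v ∉ L, #{u ∈ B | G.Adj v u} ≤ M)
    (hδ₁ : δ * (1 + C + M) ≤ 1 / 2) :
    ∑ u ∈ (L ∪ B)ᶜ, x u + edgeSum Gᶜ L L x x + r * ∑ v, x v ^ 2 ≤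
      quadForm (exchange G L (B \ W)) x + 2 * (M * δ * (#W * (#L + 1))) / r := by
  have hCδ : 0 ≤ δ * C := by positivity
  have : 0 ≤ δ * M := by positivity
  have hBL : ∀ v ∈ B, v ∉ L := fun v hv hvL => disjoint_left.mp h.disjoint hvL hv
  have hAL : ∀ v ∈ (L ∪ B)ᶜ, v ∉ L := fun v hv hvL => mem_compl.mp hv (mem_union_left B hvL)
  have hmissing : (1 - δ) * ∑ u ∈ (L ∪ B)ᶜ, x u ≤ edgeSum Gᶜ (L ∪ B)ᶜ L x x :=
    mul_sum_le_edgeSum hx.nonneg hx.nonneg fun u hu => by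
      obtain ⟨l, hl, hul⟩ := h.exists_not_adj hu
      exact ⟨l, hl, ⟨ne_of_mem_of_not_mem hl (hAL u hu) |>.symm, hul⟩, hxL l hl⟩
  have hAA : edgeSum G (L ∪ B)ᶜ (L ∪ B)ᶜ x x ≤ 2 * C * δ * ∑ u ∈ (L ∪ B)ᶜ, x u :=
    edgeSum_self_le_of_degSum_le hx.sparse hx.nonneg _ fun v hv => hxR v (hAL v hv)
  have hAB : edgeSum G (L ∪ B)ᶜ B x x ≤ M * δ * ∑ u ∈ (L ∪ B)ᶜ, x u :=
    edgeSum_le_of_card_filter_le hx.nonneg hδ (fun u hu => hM u (hAL u hu))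
      fun v hv => hxR v (hBL v hv)
  have hWB : edgeSum G W B x x ≤ M * δ * (#W * (#L + 1)) / r := by
    calc edgeSum G W B x x
        ≤ M * δ * ∑ w ∈ W, x w :=
          edgeSum_le_of_card_filter_le hx.nonneg hδ (fun u hu => hM u (hBL u (h.subset hu)))
            fun v hv => hxR v (hBL v hv)
      _ ≤ M * δ * (#W • ((#L + 1) / r)) := by
          gcongr
          exact sum_le_card_nsmul _ _ _ fun w hw =>
            hx.entry_reserve_le h hr hδ hxR hM (by linarith) hw
      _ = M * δ * (#W * (#L + 1)) / r := by
          rw [nsmul_eq_mul]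
          ring
  have hhalf : δ * (1 + C + M) * ∑ u ∈ (L ∪ B)ᶜ, x u ≤ 1 / 2 * ∑ u ∈ (L ∪ B)ᶜ, x u :=
    mul_le_mul_of_nonneg_right hδ₁ (sum_nonneg fun u _ => hx.nonneg u)
  have hexchange := quadForm_add_le_quadForm (K := exchange G L (B \ W)) h.disjoint h.subset
    (fun u v hv huv => exchange_adj.mpr ⟨huv, Or.inr (Or.inl hv)⟩)
    (fun u hu v hv huv => exchange_adj.mpr ⟨huv.ne, Or.inr (Or.inr ⟨huv, hu, hv⟩)⟩) hx.nonneg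
  rw [quadForm_eq_of_eigen hx.eigen] at hexchange
  rw [mul_div_assoc]
  linarith

theorem SparseEigen.exists_lt_quadForm_exchange (hx : SparseEigen G C r x)
    (h : IsReserve G L B W) (hr : 1 ≤ r) (hδ : 0 ≤ δ) (hL : L.Nonempty)
    (hxL : ∀ v ∈ L, 1 - δ ≤ x v) (hxR : ∀ v ∉ L, x v ≤ δ)
    (hM : ∀ v ∉ L, #{u ∈ B | G.Adj v u} ≤ M) (hδ₁ : δ * (1 + C + M) ≤ 1 / 2)
    (hδ₂ : 2 * (M * δ * (#W * (#L + 1))) < 1 / 16)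
    (hne : (L ∪ B)ᶜ.Nonempty ∨ ∃ u ∈ L, ∃ v ∈ L, Gᶜ.Adj u v) :
    ∃ y : V → ℝ, r * ∑ v, y v ^ 2 < quadForm (exchange G L (B \ W)) y := by
  have hr0 : 0 < r := by linarith
  have hhalf : ∀ v ∈ L, 1 / 2 ≤ x v := fun v hv => by
    have hCM : 0 ≤ δ * (C + M) := by positivity
    linarith [hxL v hv]
  have hexchange := hx.sum_add_le_quadForm_exchange h hr0 hδ hxL hxR hM hδ₁
  obtain ⟨y, hy⟩ := exists_quadForm_raise (G := exchange G L (B \ W)) (A := (L ∪ B)ᶜ) hr0 hx.nonneg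
    fun u hu => by
      obtain ⟨l, hl⟩ := hL
      refine ⟨l, exchange_adj.mpr ⟨?_, Or.inr (Or.inl hl)⟩, hhalf l hl⟩
      rintro rfl
      exact mem_compl.mp hu (mem_union_left B hl)
  refine ⟨y, ?_⟩
  have hcost : 2 * (M * δ * (#W * (#L + 1))) / r < 1 / (16 * r) := by
    rw [← div_div]
    exact div_lt_div_of_pos_right hδ₂ hr0
  suffices 1 / (16 * r) ≤ #(L ∪ B)ᶜ * (1 / (16 * r)) + edgeSum Gᶜ L L x x by linarith
  rcases hne with hA | ⟨u, hu, v, hv, huv⟩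
  · have hcard : (1 : ℝ) ≤ #(L ∪ B)ᶜ := mod_cast hA.card_pos
    have hLL : 0 ≤ edgeSum Gᶜ L L x x := edgeSum_nonneg hx.nonneg hx.nonneg
    linarith [mul_le_mul_of_nonneg_right hcard (by positivity : 0 ≤ 1 / (16 * r))]
  · have hLL : 1 / 2 * (1 / 2) ≤ edgeSum Gᶜ L L x x :=
      (mul_le_mul (hhalf u hu) (hhalf v hv) (by norm_num) (hx.nonneg u)).trans
        (mul_le_edgeSum hx.nonneg hx.nonneg hu hv huv)
    have hle : 1 / (16 * r) ≤ 1 / 16 := by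
      rw [← div_div]
      exact div_le_self (by norm_num) hr
    have : 0 ≤ #(L ∪ B)ᶜ * (1 / (16 * r)) := by positivity
    linarith

end Exchange

end GraphSpectrum

/-! ### Dominating vertices of extremal graphs -/

namespace GraphMinor

open Finset SimpleGraph

section Reserve

variable {V : Type*}

theorem exists_isReserve [Fintype V] [DecidableEq V] (G : SimpleGraph V) [DecidableRel G.Adj]
    {L B : Finset V} {M w : ℕ} (hB : ∀ v, v ∈ B ↔ ∀ l ∈ L, G.Adj l v)
    (hM : ∀ v ∉ L, #{u ∈ B | G.Adj v u} ≤ M) (hw : w + M * #Bᶜ ≤ #B) :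
    ∃ W : Finset V, #W = w ∧ IsReserve G L B W := by
  set D : Finset V := (L ∪ B)ᶜ.biUnion fun a => {u ∈ B | G.Adj a u}
  have hDcard : #D ≤ M * #Bᶜ := by
    refine (card_biUnion_le_card_mul _ _ M fun a ha => hM a ?_).trans ?_
    · exact fun haL => mem_compl.mp ha (mem_union_left B haL)
    · rw [mul_comm]
      exact Nat.mul_le_mul_left _ (card_le_card (compl_subset_compl.mpr subset_union_right))
  obtain ⟨W, hW, hWw⟩ := exists_subset_card_eq (s := B \ D) (n := w) (by
    have := le_card_sdiff D B
    omega)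
  refine ⟨W, hWw, hB, hW.trans sdiff_subset, fun w hw v hwv => ?_⟩
  obtain ⟨hwB, hwD⟩ := mem_sdiff.mp (hW hw)
  by_contra hv
  exact hwD (mem_biUnion.mpr ⟨v, mem_compl.mpr hv, mem_filter.mpr ⟨hwB, hwv.symm⟩⟩)

theorem IsReserve.minorOf_of_exchange [Finite V] [DecidableEq V] {U : Type*} [Finite U]
    {H : SimpleGraph U} {G : SimpleGraph V} {L B W : Finset V} (h : IsReserve G L B W)
    (hL : #L ≤ Nat.card U) (hW : Nat.card U ≤ #W) (hH : MinorOf H (exchange G L (B \ W))) :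
    MinorOf H G := by
  have hadj : ∀ l ∈ L, ∀ v ∈ B, G.Adj l v := fun l hl v hv => (h.mem_iff v).mp hv l hl
  refine hH.of_joinGraph_of_le (P := ((B \ W : Finset V) : Set V)) (by rwa [Set.ncard_coe_finset])
    hW (spanningCoe_induce_le _ _) (fun u v huv => (adj_spanningCoe_induce.mp huv).2)
    (fun v hv hvP => (mem_sdiff.mp hvP).2 hv) (fun l hl v hv => ?_)
    fun l hl v hv => hadj l hl v (h.subset hv)
  exact hadj l hl v (mem_sdiff.mp hv).1

end Reserve

end GraphMinor

namespace GraphSpectrum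

open Finset SimpleGraph GraphMinor

section JoinBot

variable {V : Type*} [Fintype V] [DecidableEq V] (L : Finset V)
  [DecidableRel (joinGraph (L : Set V) ⊥).Adj]

theorem le_quadForm_joinGraph_bot {a b : ℝ} (ha : 0 ≤ a) (hb : 0 ≤ b) :
    2 * (#L * #Lᶜ * (a * b)) ≤
      quadForm (joinGraph (L : Set V) ⊥) fun v => if v ∈ L then a else b := by
  set y : V → ℝ := fun v => if v ∈ L then a else b with hy
  have hy0 : ∀ v, 0 ≤ y v := fun v => by
    simp only [hy]
    split_ifs <;> assumption
  have hcross : #L * #Lᶜ * (a * b) = edgeSum (joinGraph (L : Set V) ⊥) L Lᶜ y y := by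
    have hterm : ∀ u ∈ L, ∀ v ∈ Lᶜ,
        (if (joinGraph (L : Set V) ⊥).Adj u v then y u * y v else 0) = a * b := fun u hu v hv => by
      rw [mem_compl] at hv
      rw [if_pos ⟨ne_of_mem_of_not_mem hu hv, Or.inl hu⟩]
      simp only [hy, if_pos hu, if_neg hv]
    rw [edgeSum, sum_congr rfl fun u hu => sum_congr rfl (hterm u hu)]
    simp only [sum_const, nsmul_eq_mul, mul_assoc]
  have hquad : quadForm (joinGraph (L : Set V) ⊥) y =
      edgeSum (joinGraph (L : Set V) ⊥) (L ∪ Lᶜ) (L ∪ Lᶜ) y y := by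
    rw [union_compl]
    rfl
  rw [hquad, edgeSum_union_self disjoint_compl_right, hcross]
  have hLL : 0 ≤ edgeSum (joinGraph (L : Set V) ⊥) L L y y := edgeSum_nonneg hy0 hy0
  have hcompl : 0 ≤ edgeSum (joinGraph (L : Set V) ⊥) Lᶜ Lᶜ y y := edgeSum_nonneg hy0 hy0
  linarith

/-- The test vector takes the value `√(n - k)` on `L` and `√k` outside, where `k = #L`. -/
theorem card_mul_card_compl_le_sq {r : ℝ}
    (h : ∀ y, quadForm (joinGraph (L : Set V) ⊥) y ≤ r * ∑ v, y v ^ 2) :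
    (#L * #Lᶜ : ℝ) ≤ r ^ 2 := by
  have hk : (0 : ℝ) ≤ #L := Nat.cast_nonneg _
  have hm : (0 : ℝ) ≤ #Lᶜ := Nat.cast_nonneg _
  have hquad := (le_quadForm_joinGraph_bot L (Real.sqrt_nonneg #Lᶜ) (Real.sqrt_nonneg #L)).trans
    (h _)
  have hsq : ∑ v, (if v ∈ L then √(#Lᶜ : ℝ) else √(#L : ℝ)) ^ 2 = 2 * (#L * #Lᶜ : ℝ) := by
    have hterm : ∀ v, (if v ∈ L then √(#Lᶜ : ℝ) else √(#L : ℝ)) ^ 2 =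
        if v ∈ L then (#Lᶜ : ℝ) else #L := fun v => by
      split_ifs <;> exact Real.sq_sqrt (Nat.cast_nonneg _)
    rw [sum_congr rfl fun v _ => hterm v, sum_ite, sum_const, sum_const]
    simp only [filter_mem_eq_inter, univ_inter, filter_notMem_eq_sdiff, ← compl_eq_univ_sdiff,
      nsmul_eq_mul]
    ring
  rw [hsq] at hquad
  rcases (mul_nonneg hk hm).eq_or_lt with hzero | hpos
  · rw [← hzero]
    positivity
  have hr : √(#Lᶜ : ℝ) * √(#L : ℝ) ≤ r := le_of_mul_le_mul_left (by linarith) (mul_pos two_pos hpos)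
  calc (#L * #Lᶜ : ℝ) = (√(#Lᶜ : ℝ) * √(#L : ℝ)) ^ 2 := by
        rw [mul_pow, Real.sq_sqrt hk, Real.sq_sqrt hm, mul_comm]
    _ ≤ r ^ 2 := by gcongr

end JoinBot

end GraphSpectrum

namespace FinGraph

open Finset SimpleGraph GraphMinor GraphSpectrum

section Spex

variable {n : ℕ} {F : Set FinGraph} {G : FinGraph}

theorem not_minorOf_of_mem_SPEX (hG : G ∈ SPEX n F) {H : FinGraph} (hH : H ∈ F) :
    ¬ MinorOf H.graph G.graph :=
  fun h => hG.2.1 H hH (isMinor_iff.mpr h)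

theorem quadForm_le_of_mem_SPEX (hG : G ∈ SPEX n F) [Fintype G.V] [Nonempty G.V] {r : ℝ}
    (hr : 0 ≤ r) (hrho : G.rho = ENNReal.ofReal r) {J : SimpleGraph G.V} [DecidableRel J.Adj]
    (hJ : ∀ H ∈ F, ¬ MinorOf H.graph J) (y : G.V → ℝ) : quadForm J y ≤ r * ∑ v, y v ^ 2 := by
  have hle := hG.2.2 ⟨G.V, J⟩ hG.1 fun H hH h => hJ H hH (isMinor_iff.mp h)
  obtain ⟨s, -, hs, hmax, -⟩ := exists_nonneg_eigenvector ⟨G.V, J⟩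
  rw [hs, hrho, ENNReal.ofReal_le_ofReal_iff hr] at hle
  exact (hmax y).trans (mul_le_mul_of_nonneg_right hle (sum_nonneg fun v _ => sq_nonneg _))

theorem exists_sparseEigen [Fintype G.V] [DecidableEq G.V] [DecidableRel G.graph.Adj]
    [Nonempty G.V] {H : FinGraph} (hH : ¬ MinorOf H.graph G.graph) :
    ∃ (r : ℝ) (x : G.V → ℝ) (z : G.V), G.rho = ENNReal.ofReal r ∧
      SparseEigen G.graph (2 ^ H.order) r x ∧ x z = 1 := by
  obtain ⟨r, hr, hrho, -, x, hx, ⟨v, hv⟩, heig⟩ := exists_nonneg_eigenvector G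
  obtain ⟨z, -, hz⟩ := exists_max_image univ x ⟨v, mem_univ v⟩
  have hzpos : 0 < x z := ((hx v).lt_of_ne' hv).trans_le (hz v (mem_univ v))
  refine ⟨r, fun u => x u / x z, z, hrho, ⟨degSum_le_of_not_minorOf hH, hr, fun u => ?_,
    fun u => ?_, fun u => ?_⟩, div_self hzpos.ne'⟩
  · exact div_nonneg (hx u) hzpos.le
  · exact (div_le_one hzpos).mpr (hz u (mem_univ u))
  · rw [← sum_div, heig, mul_div_assoc]

theorem familyGamma_mul_le_sq_of_mem_SPEX (hG : G ∈ SPEX n F) (hγ : ∀ H ∈ F, 1 ≤ H.gamma)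
    [Fintype G.V] [Nonempty G.V] {r : ℝ} (hr : 0 ≤ r) (hrho : G.rho = ENNReal.ofReal r)
    (hn : familyGamma F ≤ Fintype.card G.V) :
    (familyGamma F : ℝ) * (Fintype.card G.V - familyGamma F) ≤ r ^ 2 := by
  classical
  obtain ⟨L, -, hL⟩ := exists_subset_card_eq (s := (univ : Finset G.V)) hn
  have hcompl : (#Lᶜ : ℝ) = Fintype.card G.V - familyGamma F := by
    rw [card_compl, hL, Nat.cast_sub hn]
  rw [← hcompl, ← hL]
  refine card_mul_card_compl_le_sq L (quadForm_le_of_mem_SPEX hG hr hrho fun H hH => ?_)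
  exact not_minorOf_joinGraph_bot (hγ H hH) (by
    rw [Set.ncard_coe_finset, hL]
    exact familyGamma_le hH)

theorem exists_reserve_parameter (C M w k : ℕ) :
    ∃ δ : ℝ, 0 < δ ∧ δ * (1 + C + M) ≤ 1 / 2 ∧ 2 * (M * δ * (w * (k + 1))) < 1 / 16 ∧
      k * δ * (M + 1) ≤ 1 / 2 := by
  obtain ⟨δ, hδ, hle⟩ := exists_pos_forall_mul_le
    ![(1 + C + M : ℝ), 2 * M * (w * (k + 1)), k * (M + 1)] (b := ![1 / 2, 1 / 32, 1 / 2])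
    (by simp [Fin.forall_fin_succ])
  obtain ⟨h₁, h₂, h₃⟩ : (1 + C + M) * δ ≤ 1 / 2 ∧ 2 * M * (w * (k + 1)) * δ ≤ 1 / 32 ∧
      k * (M + 1) * δ ≤ 1 / 2 := by
    simpa [Fin.forall_fin_succ] using hle
  exact ⟨δ, hδ, by linarith, by linarith, by linarith⟩

theorem add_mul_card_compl_le {V : Type*} [Fintype V] [DecidableEq V] {B : Finset V} {M w k : ℕ}
    {δ : ℝ} (hw : 2 * w ≤ Fintype.card V)
    (hB : (Fintype.card V : ℝ) - k * (δ * Fintype.card V) ≤ #B) (hδ : k * δ * (M + 1) ≤ 1 / 2) :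
    w + M * #Bᶜ ≤ #B := by
  have hw' : (2 : ℝ) * w ≤ Fintype.card V := mod_cast hw
  have hcompl : (#Bᶜ : ℝ) = Fintype.card V - #B := by
    rw [card_compl, Nat.cast_sub (card_le_univ B)]
  have hδn := mul_le_mul_of_nonneg_right hδ (Nat.cast_nonneg (α := ℝ) (Fintype.card V))
  have hBM := mul_le_mul_of_nonneg_left hB (by positivity : (0 : ℝ) ≤ (M : ℝ) + 1)
  have hreal : (w : ℝ) + M * #Bᶜ ≤ #B := by
    rw [hcompl]
    linarith
  exact_mod_cast hreal

/-- Unless the vertices of `L` are dominating, exchanging edges increases the spectral radius. -/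
theorem isUniversal_of_isReserve (hG : G ∈ SPEX n F) [Fintype G.V] [DecidableEq G.V]
    [DecidableRel G.graph.Adj] {L B W : Finset G.V} {C M : ℕ} {r δ : ℝ} {x : G.V → ℝ}
    (hx : SparseEigen G.graph C r x) (hrho : G.rho = ENNReal.ofReal r)
    (h : IsReserve G.graph L B W) (hJ : ∀ H ∈ F, ¬ MinorOf H.graph (exchange G.graph L (B \ W)))
    (hr : 1 ≤ r) (hδ : 0 ≤ δ) (hxL : ∀ v ∈ L, 1 - δ ≤ x v) (hxR : ∀ v ∉ L, x v ≤ δ)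
    (hM : ∀ v ∉ L, #{u ∈ B | G.graph.Adj v u} ≤ M) (hδ₁ : δ * (1 + C + M) ≤ 1 / 2)
    (hδ₂ : 2 * (M * δ * (#W * (#L + 1))) < 1 / 16) {l : G.V} (hl : l ∈ L) :
    G.graph.IsUniversal l := by
  classical
  have : Nonempty G.V := ⟨l⟩
  have hne : ¬ ((L ∪ B)ᶜ.Nonempty ∨ ∃ u ∈ L, ∃ v ∈ L, G.graphᶜ.Adj u v) := fun hne => by
    obtain ⟨y, hy⟩ := hx.exists_lt_quadForm_exchange h hr hδ ⟨l, hl⟩ hxL hxR hM hδ₁ hδ₂ hne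
    exact hy.not_ge (quadForm_le_of_mem_SPEX hG hx.r_nonneg hrho hJ y)
  rw [not_or, not_nonempty_iff_eq_empty, compl_eq_empty_iff] at hne
  obtain ⟨hcover, hclique⟩ := hne
  intro v hlv
  rcases mem_union.mp (hcover ▸ mem_univ v) with hv | hv
  · by_contra hadj
    exact hclique ⟨l, hl, v, hv, hlv, hadj⟩
  · exact (h.mem_iff v).mp hv l hl

theorem isUniversal_of_dominant (hG : G ∈ SPEX n F) [Fintype G.V] [DecidableEq G.V]
    [DecidableRel G.graph.Adj] {C M h : ℕ} {r δ : ℝ} {x : G.V → ℝ}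
    {L : Finset G.V} (hx : SparseEigen G.graph C r x) (hrho : G.rho = ENNReal.ofReal r)
    (hr : 1 ≤ r) (hδ : 0 ≤ δ) (hLk : #L = familyGamma F)
    (hh : ∀ R : SimpleGraph G.V,
      (∀ H ∈ F, H.order ≤ h → ¬ MinorOf H.graph (joinGraph (L : Set G.V) R)) →
        ∀ H ∈ F, ¬ MinorOf H.graph (joinGraph (L : Set G.V) R))
    (hn : 2 * h ≤ Fintype.card G.V)
    (hL : ∀ v ∈ L, 1 - δ ≤ x v ∧ (1 - δ) * Fintype.card G.V ≤ G.graph.degree v)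
    (hxR : ∀ v ∉ L, x v ≤ δ)
    (hM : ∀ v ∉ L, #{u | ∀ y ∈ insert v L, G.graph.Adj y u} ≤ M)
    (hδ₁ : δ * (1 + C + M) ≤ 1 / 2) (hδ₂ : 2 * (M * δ * (h * (#L + 1))) < 1 / 16)
    (hδ₃ : #L * δ * (M + 1) ≤ 1 / 2) {l : G.V} (hl : l ∈ L) : G.graph.IsUniversal l := by
  set B : Finset G.V := {v | ∀ l ∈ L, G.graph.Adj l v}
  have hB : ∀ v, v ∈ B ↔ ∀ l ∈ L, G.graph.Adj l v := fun v => mem_filter_univ v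
  have hMB : ∀ v ∉ L, #{u ∈ B | G.graph.Adj v u} ≤ M := fun v hv => by
    refine (card_le_card fun u hu => ?_).trans (hM v hv)
    rw [mem_filter, hB] at hu
    exact (mem_filter_univ u).mpr ((forall_mem_insert _ _ _).mpr ⟨hu.2, hu.1⟩)
  have hBcard : (Fintype.card G.V : ℝ) - #L * (δ * Fintype.card G.V) ≤ #B :=
    card_sub_le_card_common fun y hy => by linarith [(hL y hy).2]
  obtain ⟨W, rfl, hW⟩ := exists_isReserve G.graph hB hMB (add_mul_card_compl_le hn hBcard hδ₃)
  have hJ : ∀ H ∈ F, ¬ MinorOf H.graph (exchange G.graph L (B \ W)) :=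
    hh _ fun H hH hle hminor => not_minorOf_of_mem_SPEX hG hH
      (hW.minorOf_of_exchange (hLk.trans_le (familyGamma_le_order hH)) hle hminor)
  exact isUniversal_of_isReserve hG hx hrho hW hJ hr hδ (fun v hv => (hL v hv).1) hxR hMB hδ₁
    hδ₂ hl

theorem exists_card_eq_familyGamma_dominating (hF : F.Nonempty) (hγ : ∀ H ∈ F, 1 ≤ H.gamma) :
    ∃ N : ℕ, ∀ n : ℕ, N ≤ n → ∀ G ∈ SPEX n F, ∃ L : Finset G.V,
      #L = familyGamma F ∧ ∀ l ∈ L, G.graph.IsUniversal l := by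
  classical
  obtain ⟨H₀, hH₀, hγ₀⟩ := exists_gamma_eq_familyGamma hF
  obtain ⟨h, hh⟩ := exists_order_bound hF hγ
  have hk : 1 ≤ familyGamma F := hγ₀ ▸ hγ H₀ hH₀
  set k := familyGamma F
  obtain ⟨δ, hδ, hδ₁, hδ₂, hδ₃⟩ := exists_reserve_parameter (2 ^ H₀.order) H₀.order h k
  obtain ⟨N, hN⟩ := exists_dominant_set hk Nat.one_le_two_pow H₀.order hδ
  refine ⟨N + 2 * h + 2 * k + 2, fun n hn G hG => ?_⟩
  let _ := Fintype.ofFinite G.V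
  have hcard : Fintype.card G.V = n := Nat.card_eq_fintype_card.symm.trans hG.1
  have : Nonempty G.V := Fintype.card_pos_iff.mp (by omega)
  have hG₀ : ¬ MinorOf H₀.graph G.graph := not_minorOf_of_mem_SPEX hG hH₀
  obtain ⟨r, x, z, hrho, hx, hz⟩ := exists_sparseEigen hG₀
  have hcommon : ∀ X : Finset G.V, #X = k + 1 → #{v | ∀ y ∈ X, G.graph.Adj y v} < H₀.order :=
    fun X hX => by convert card_common_neighbors_lt (hγ H₀ hH₀) hG₀ (hX.trans (by rw [hγ₀]))
  have hrsq : (k : ℝ) * (Fintype.card G.V - k) ≤ r ^ 2 :=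
    familyGamma_mul_le_sq_of_mem_SPEX hG hγ hx.r_nonneg hrho (by omega)
  have hr : 1 ≤ r := by
    have hk' : (1 : ℝ) ≤ k := mod_cast hk
    have hcard' : (2 : ℝ) * k + 2 ≤ Fintype.card G.V := mod_cast (by omega)
    nlinarith [hx.r_nonneg]
  obtain ⟨L, hLk, hL, hxR⟩ := hN G.graph r x z (by omega) hx hcommon hrsq hz
  rw [← hLk] at hδ₂ hδ₃
  refine ⟨L, hLk, fun l hl => isUniversal_of_dominant hG hx hrho hr hδ.le hLk
    (fun R => hh G.V L R (by rw [Set.ncard_coe_finset, hLk])) (by omega) hL hxR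
    (fun v hv => (hcommon _ (by rw [card_insert_of_notMem hv, hLk])).le) hδ₁ hδ₂ hδ₃ hl⟩

end Spex

end FinGraph

/-! ### Saturation -/

namespace GraphMinor

open SimpleGraph

theorem joinGraph_eq_self {V : Type*} {G : SimpleGraph V} {L : Set V}
    (hL : ∀ l ∈ L, G.IsUniversal l) : joinGraph L G = G := by
  refine le_antisymm ?_ (le_joinGraph L G)
  rintro u v ⟨hne, hu | hv | h⟩
  · exact hL u hu hne
  · exact (hL v hv hne.symm).symm
  · exact h

theorem induce_sup_edge {V : Type*} (G : SimpleGraph V) {S : Set V} (u v : S) :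
    (G ⊔ edge (u : V) v).induce S = G.induce S ⊔ edge u v := by
  ext a b
  simp only [comap_adj, sup_adj, edge_adj, Function.Embedding.subtype_apply, Subtype.ext_iff, ne_eq]

end GraphMinor

namespace GraphSpectrum

open Finset SimpleGraph

variable {V : Type*} [Fintype V] {G : SimpleGraph V} [DecidableRel G.Adj] {x : V → ℝ}

theorem quadForm_lt_of_le {G' : SimpleGraph V} [DecidableRel G'.Adj] (hle : G ≤ G')
    (hx : ∀ v, 0 ≤ x v) {u v : V} (h : ¬ G.Adj u v) (h' : G'.Adj u v) (hu : 0 < x u)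
    (hv : 0 < x v) : quadForm G x < quadForm G' x := by
  have hterm : ∀ a b, (if G.Adj a b then x a * x b else 0) ≤
      if G'.Adj a b then x a * x b else 0 := fun a b => by
    by_cases hab : G.Adj a b
    · rw [if_pos hab, if_pos (hle hab)]
    · rw [if_neg hab]
      exact ite_adj_mul_nonneg hx hx a b
  refine sum_lt_sum (fun a _ => sum_le_sum fun b _ => hterm a b)
    ⟨u, mem_univ u, sum_lt_sum (fun b _ => hterm u b) ⟨v, mem_univ v, ?_⟩⟩
  rw [if_neg h, if_pos h']
  exact mul_pos hu hv

theorem pos_of_eigen_of_isUniversal {r : ℝ} (hr : 0 ≤ r) (hx : ∀ v, 0 ≤ x v) (hne : ∃ v, x v ≠ 0)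
    (heig : ∀ u, ∑ v ∈ G.neighborFinset u, x v = r * x u) {l : V} (hl : G.IsUniversal l) (u : V) :
    0 < x u := by
  have hle : ∀ a b, G.Adj a b → x b ≤ r * x a := fun a b hab => heig a ▸
    single_le_sum (f := x) (fun v _ => hx v) ((G.mem_neighborFinset a b).mpr hab)
  have hxl : 0 < x l := by
    refine (hx l).lt_of_ne' fun hzero => ?_
    obtain ⟨v, hv⟩ := hne
    have hvl : x v ≤ r * x l := hle l v (hl fun heq => hv (heq ▸ hzero))
    rw [hzero, mul_zero] at hvl
    exact hv (hvl.antisymm (hx v))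
  rcases eq_or_ne l u with rfl | hlu
  · exact hxl
  · exact pos_of_mul_pos_right (hxl.trans_le (hle u l (hl hlu).symm)) hr

end GraphSpectrum

namespace FinGraph

open Set SimpleGraph GraphMinor GraphSpectrum

variable {n : ℕ} {F : Set FinGraph} {G : FinGraph}

theorem exists_isMinor_iff_exists_mem_Gam {D : Set G.V} (hD : D.ncard = familyGamma F)
    (hU : ∀ v ∈ D, G.graph.IsUniversal v) :
    (∃ H ∈ F, H.IsMinor G) ↔ ∃ K ∈ Gam F, K.IsMinor (G.delete D) := by
  have key : ∀ H ∈ F, H.IsMinor G ↔ ∃ S : Set H.V, S.ncard = H.order - familyGamma F ∧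
      (H.induce S).IsMinor (G.delete D) := fun H hH => by
    have hle : familyGamma F ≤ Nat.card H.V := familyGamma_le_order hH
    have hjoin := minorOf_joinGraph_iff (H := H.graph) (R := G.graph) (hD.trans_le hle)
    rw [joinGraph_eq_self hU] at hjoin
    rw [isMinor_iff, hjoin]
    refine exists_congr fun S => and_congr ?_
      (isMinor_iff (H := H.induce S) (G := G.delete D)).symm
    rw [hD, order]
    omega
  constructor
  · rintro ⟨H, hH, hminor⟩
    obtain ⟨S, hS, hminor⟩ := (key H hH).mp hminor
    obtain ⟨K, hK, hminor⟩ := exists_irreducibleInduced_isMinor hminor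
    rw [hS] at hK
    exact ⟨K, mem_biUnion hH hK, hminor⟩
  · rintro ⟨K, hK, hminor⟩
    obtain ⟨H, hH, ⟨S, hS, rfl⟩, -⟩ := mem_iUnion₂.mp hK
    exact ⟨H, hH, (key H hH).mpr ⟨S, hS, hminor⟩⟩

/-- A dominating vertex makes the Perron vector positive, so a new edge increases the spectral
radius. -/
theorem exists_isMinor_addEdge_of_mem_SPEX (hG : G ∈ SPEX n F) {l u v : G.V}
    (hl : G.graph.IsUniversal l) (huv : u ≠ v) (hadj : ¬ G.graph.Adj u v) :
    ∃ H ∈ F, H.IsMinor (G.addEdge u v) := by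
  classical
  let _ := Fintype.ofFinite G.V
  have : Nonempty G.V := ⟨l⟩
  by_contra! hfree
  obtain ⟨r, hr, hrho, -, x, hx, hne, heig⟩ := exists_nonneg_eigenvector G
  have hpos := pos_of_eigen_of_isUniversal hr hx hne heig hl
  have hle : quadForm (G.graph ⊔ edge u v) x ≤ r * ∑ v, x v ^ 2 :=
    quadForm_le_of_mem_SPEX hG hr hrho (J := G.graph ⊔ edge u v)
      (fun H hH h => hfree H hH (isMinor_iff.mpr h)) x
  have hlt : quadForm G.graph x < quadForm (G.graph ⊔ edge u v) x :=
    quadForm_lt_of_le le_sup_left hx hadj (Or.inr ((edge_adj u v u v).mpr ⟨.inl ⟨rfl, rfl⟩, huv⟩))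
      (hpos u) (hpos v)
  rw [quadForm_eq_of_eigen heig] at hlt
  exact hlt.not_ge hle

theorem delete_mem_SAT_of_mem_SPEX (hk : 1 ≤ familyGamma F) (hG : G ∈ SPEX n F) {D : Set G.V}
    (hD : D.ncard = familyGamma F) (hU : ∀ v ∈ D, G.graph.IsUniversal v) :
    G.delete D ∈ SAT (n - familyGamma F) (Gam F) := by
  obtain ⟨l, hl⟩ : D.Nonempty := nonempty_of_ncard_ne_zero (by omega)
  refine ⟨?_, fun K hK hminor => ?_, ?_⟩
  · have hcompl := ncard_add_ncard_compl D
    have hn : Nat.card G.V = n := hG.1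
    have horder : (G.delete D).order = Dᶜ.ncard := Nat.card_coe_set_eq _
    omega
  · obtain ⟨H, hH, hminor⟩ := (exists_isMinor_iff_exists_mem_Gam hD hU).mpr ⟨K, hK, hminor⟩
    exact hG.2.1 H hH hminor
  · rintro ⟨u, hu⟩ ⟨v, hv⟩ huv hadj
    have hU' : ∀ w ∈ D, (G.addEdge u v).graph.IsUniversal w := fun w hw a hwa =>
      Or.inl (hU w hw hwa)
    obtain ⟨K, hK, hminor⟩ := (exists_isMinor_iff_exists_mem_Gam (G := G.addEdge u v) hD
      hU').mp (exists_isMinor_addEdge_of_mem_SPEX hG (hU l hl) (fun h => huv (Subtype.ext h)) hadj)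
    have hdelete : ((G.addEdge u v).delete D).graph =
        ((G.delete D).addEdge ⟨u, hu⟩ ⟨v, hv⟩).graph :=
      induce_sup_edge G.graph (S := Dᶜ) ⟨u, hu⟩ ⟨v, hv⟩
    exact ⟨K, hK, isMinor_iff.mpr (hdelete ▸ isMinor_iff.mp hminor)⟩

/-- A further dominating vertex would give `γ_H + 1` vertices with many common neighbours. -/
theorem dominatingVertices_eq_of_mem_SPEX (hG : G ∈ SPEX n F) {H : FinGraph} (hH : H ∈ F)
    (hγ : 1 ≤ H.gamma) (hn : H.gamma + 1 + H.order ≤ n) {L : Finset G.V} (hL : L.card = H.gamma)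
    (hU : ∀ l ∈ L, G.graph.IsUniversal l) : G.dominatingVertices = L := by
  classical
  let _ := Fintype.ofFinite G.V
  refine Subset.antisymm (fun v hv => ?_) hU
  by_contra hvL
  have hX : (insert v L).card = H.gamma + 1 := by rw [Finset.card_insert_of_notMem hvL, hL]
  have hcommon := card_common_neighbors_lt hγ (not_minorOf_of_mem_SPEX hG hH) hX
  have hsubset : (insert v L)ᶜ ⊆
      Finset.univ.filter fun w => ∀ y ∈ insert v L, G.graph.Adj y w := fun w hw => by
    refine (Finset.mem_filter_univ w).mpr fun y hy => ?_
    have hyw : y ≠ w := ne_of_mem_of_not_mem hy (Finset.mem_compl.mp hw)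
    rcases Finset.mem_insert.mp hy with rfl | hyL
    · exact hv hyw
    · exact hU y hyL hyw
  have hle := Finset.card_le_card hsubset
  have hcard : Fintype.card G.V = n := Nat.card_eq_fintype_card.symm.trans hG.1
  rw [Finset.card_compl, hX, hcard] at hle
  convert absurd hcommon (not_lt.mpr ((Nat.le_sub_of_add_le' hn).trans (hle.trans_eq _)))
  congr!

theorem familyGamma_singleton (H : FinGraph) : familyGamma {H} = H.gamma := by
  rw [familyGamma, image_singleton, csInf_singleton]

theorem Gam_singleton {H : FinGraph} (hγ : 1 ≤ H.gamma) :
    Gam {H} = irreducibleInduced (H.alpha + 1) H := by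
  have hs : H.order - H.gamma = H.alpha + 1 := by
    rw [order_eq_gamma_add hγ]
    omega
  rw [Gam, biUnion_singleton, familyGamma_singleton, hs]

end FinGraph

theorem theorem1p2_general (F : Set FinGraph) (hF : F.Nonempty) (hγ : ∀ H ∈ F, 1 ≤ H.gamma) :
    ∃ N : ℕ, ∀ n : ℕ, N ≤ n → ∀ G ∈ FinGraph.SPEX n F,
      G.dominatingVertices.ncard = FinGraph.familyGamma F ∧
      G.delete G.dominatingVertices ∈
        FinGraph.SAT (n - FinGraph.familyGamma F) (FinGraph.Gam F) ∧
      ∀ H : FinGraph, F = {H} →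
        G.delete G.dominatingVertices ∈
          FinGraph.SAT (n - H.gamma) (FinGraph.irreducibleInduced (H.alpha + 1) H) := by
  obtain ⟨H₀, hH₀, hγ₀⟩ := FinGraph.exists_gamma_eq_familyGamma hF
  obtain ⟨N, hN⟩ := FinGraph.exists_card_eq_familyGamma_dominating hF hγ
  refine ⟨N + (H₀.gamma + 1 + H₀.order), fun n hn G hG => ?_⟩
  obtain ⟨L, hL, hU⟩ := hN n (by omega) G hG
  have hD : G.dominatingVertices = L := FinGraph.dominatingVertices_eq_of_mem_SPEX hG hH₀
    (hγ H₀ hH₀) (by omega) (hL.trans hγ₀.symm) hU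
  have hcard : G.dominatingVertices.ncard = FinGraph.familyGamma F := by
    rw [hD, Set.ncard_coe_finset, hL]
  have hsat : G.delete G.dominatingVertices ∈
      FinGraph.SAT (n - FinGraph.familyGamma F) (FinGraph.Gam F) :=
    FinGraph.delete_mem_SAT_of_mem_SPEX (hγ₀ ▸ hγ H₀ hH₀) hG hcard fun _ hv => hv
  refine ⟨hcard, hsat, ?_⟩
  rintro H rfl
  rwa [FinGraph.Gam_singleton (hγ H rfl), FinGraph.familyGamma_singleton] at hsat

theorem theorem1p2 (F : Set FinGraph) (hF : F.Nonempty)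
    (hdeg : ∀ H ∈ F, H.MinDegreePos) (hstar : ∀ H ∈ F, ¬ H.IsStar) :
    ∃ N : ℕ, ∀ n : ℕ, N ≤ n → ∀ G ∈ FinGraph.SPEX n F,
      G.dominatingVertices.ncard = FinGraph.familyGamma F ∧
      G.delete G.dominatingVertices ∈
        FinGraph.SAT (n - FinGraph.familyGamma F) (FinGraph.Gam F) ∧
      ∀ H : FinGraph, F = {H} →
        G.delete G.dominatingVertices ∈
          FinGraph.SAT (n - H.gamma) (FinGraph.irreducibleInduced (H.alpha + 1) H) :=
  theorem1p2_general F hF fun H hH => FinGraph.one_le_gamma (hdeg H hH) (hstar H hH)
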